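/- **Setting.** Let $T\ge 0$, let $U,V$ be nonempty compact metric spaces, and for $i=1,2$ let $$L^i_t[u,v]\varphi(x)=\tfrac12\langle G^i\nabla,\nabla\rangle\varphi(x)+\langle f^i,\nabla\varphi(x)\rangle+\int_{\mathbb R^d}\big[\varphi(x+y)-\varphi(x)-\langle y,\nabla\varphi(x)\rangle\mathbf 1_{B_1}(y)\big]\,\nu^i(dy)$$ be generators of Lévy–Khintchine type, with coefficients $G^i,f^i,\nu^i$ depending on $(t,x,u,v)$: $G^i$ is symmetric nonnegative, $\nu^i(\{0\})=0$, $\int\min\{1,\|y\|^2\}\nu^i(dy)<\infty$. Put $$\Sigma^i=\operatorname{tr}G^i+\int\|y\|^2\nu^i(dy),\qquad b^i=f^i+\int_{\mathbb R^d\setminus B_1}y\,\nu^i(dy).$$ Assume on $[0,T]\times\mathbb R^d\times U\times V$: $G^i,f^i$ are continuous and $\nu^i$ is weakly continuous; $\|b^i(t,x,u,v)-b^i(s,x,u,v)\|^2\le\alpha^i(t-s)$ with $\alpha^i\ge0$, $\alpha^i(\delta)\to0$ as $\delta\to0$; $|\Sigma^i|\le M_0^i$, $\|b^i\|\le M_1^i$;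 $\|b^i(t,x,u,v)-b^i(t,y,u,v)\|\le K^i\|x-y\|$. Let $g:\mathbb R^d\to\mathbb R$ be Lipschitz with constant $R$. Assume the Isaacs condition $\min_u\max_v\langle\xi,b^i(t,x,u,v)\rangle=\max_v\min_u\langle\xi,b^i(t,x,u,v)\rangle$ for all $t\in[0,T]$, $x,\xi\in\mathbb R^d$ holds for $i=1$ or for $i=2$. Let $\mathcal D^i$ be classes of test functions with $C_b^2(\mathbb R^d)\cup\{\|\cdot-a\|^2:a\in\mathbb R^d\}\subset\mathcal D^i\subset C^2(\mathbb R^d)$. Let $D([t_0,T],\mathbb R^d)$ be the Skorokhod space. **Strategies and outcomes.** A strategy of the first player on $[t_0,T]$ is a filtered space $(\Omega^U,\mathcal F^U,\{\mathcal F^U_s\})$ with, for each $x(\cdot)\in D([t_0,T],\mathbb R^d)$, a probability $P^U_{x(\cdot)}$ and a progressively measurable $U$-valued process $u_{x(\cdot)}$, both nonanticipative in $x(\cdot)$ (if $x=y$ on $[t_0,t]$, then $P^U_{x(\cdot)}=P^U_{y(\cdot)}$ on $\mathcal F^U_t$ and $u_{x(\cdot)}(s)=u_{y(\cdot)}(s)$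 $P^U_{x(\cdot)}$-a.s. for $s\le t$), such that for each $t$ the map $(x(\cdot),s,\omega)\mapsto u_{x(\cdot)}(s,\omega)$, $s\in[t_0,t]$, is measurable with respect to $\sigma(x(r):r\le t)\otimes\mathcal B([t_0,t])\otimes\mathcal F^U_t$. Strategies $\mathfrak v$ of the second player are defined likewise, with values in $V$. A realization of the motion generated by $\mathfrak u,\mathfrak v$ from $(t_0,x_0)$ is a filtered space $\Omega^X$, a probability $P$ on $\Omega^X\times\Omega^U\times\Omega^V$ and a càdlàg process $X$ adapted to the product filtration such that $X(t_0)=x_0$ a.s.; for every $\varphi\in\mathcal D^1$ the process $\varphi(X(t))-\int_{t_0}^tL^1_\tau[u_{X(\cdot)}(\tau),v_{X(\cdot)}(\tau)]\varphi(X(\tau))\,d\tau$ is a martingale; and the conditional laws of $\omega^U$ and of $\omega^V$ given $X(\cdot)=x(\cdot)$ are $P^U_{x(\cdot)}$ and $P^V_{x(\cdot)}$. Let $J^*(t_0,x_0,\mathfrak u,\mathfrak v)$ be the supremum of $\mathbb E g(X(T))$ over all realizations. **$u$-stability.** $c_+:[0,T]\times\mathbb R^d\to\mathbb R$ is $u$-stable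 with respect to $L^2$ if $c_+(T,\cdot)=g$ and for all $0\le t<\theta\le T$ there is a filtered space on which for all $\xi\in\mathbb R^d$, $v\in V$ there are a progressively measurable process $\mu_{\xi,v}$ with values in the probabilities on $U$, an adapted process $Y_{\xi,v}$ and a probability $P_{\xi,v}$ with $Y_{\xi,v}(t)=\xi$ a.s., $\varphi(Y_{\xi,v}(s))-\int_t^s\int_UL^2_\tau[w,v]\varphi(Y_{\xi,v}(\tau))\,\mu_{\xi,v}(\tau,dw)\,d\tau$ a martingale on $[t,\theta]$ for all $\varphi\in\mathcal D^2$, and $c_+(t,\xi)\ge\mathbb E_{\xi,v}\,c_+(\theta,Y_{\xi,v}(\theta))$; moreover $(\xi,v)\mapsto\mathbb E_{\xi,v}\phi$ is measurable for every bounded random variable $\phi$, and $(\xi,v,s)\mapsto\mathbb E_{\xi,v}\varphi(Y_{\xi,v}(s))$ is measurable for $\varphi\in\mathcal D^2$. **Extremal shift.** Put $\varpi(t,z,\xi,u,v)=\langle z-\xi,b^1(t,z,u,v)\rangle$ if the Isaacs condition holds for $i=1$, and $\varpi(t,z,\xi,u,v)=\langle z-\xi,b^2(t,\xi,u,v)\rangle$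 otherwise. For a partition $\Delta=\{t_0<\dots<t_r=T\}$ of $[t_0,T]$ let $u_l[z,\xi]$ be measurable in $(z,\xi)$ with $\max_v\varpi(t_l,z,\xi,u_l[z,\xi],v)=\min_u\max_v\varpi(t_l,z,\xi,u,v)$. A model of the game for $\Delta$ consists of a filtered space and, for each $x(\cdot)\in D([t_0,T],\mathbb R^d)$, a probability $P_{x(\cdot)}$, a progressively measurable control $\hat v_{x(\cdot)}$ with values in $V$, a progressively measurable process $\hat\mu_{x(\cdot)}$ with values in the probabilities on $U$, and a càdlàg adapted process $Y_{x(\cdot)}$ such that: 1. $Y_{x(\cdot)}(\tau),\hat\mu_{x(\cdot)}(\tau),\hat v_{x(\cdot)}(\tau)$ depend only on the values $x(t_k)$ with $t_k\le\tau$, $(x(\cdot),\omega)\mapsto Y_{x(\cdot)}(\tau,\omega)$ is measurable with respect to $\sigma(x(r):r\le\tau)$ and the model filtration at time $\tau$, and $P_{x(\cdot)}$ is nonanticipative in $x(\cdot)$; 2. for $\tau\in[t_k,t_{k+1})$, $\max_v\min_u\varpi(t_k,x(t_k),Y_{x(\cdot)}(t_k),u,v)=\min_u\varpi(t_k,x(t_k),Y_{x(\cdot)}(t_k),u,\hat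 v_{x(\cdot)}(\tau))$; 3. $Y_{x(\cdot)}(t_0)=x(t_0)$ a.s., and $\varphi(Y_{x(\cdot)}(s))-\int_{t_0}^s\int_UL^2_\tau[w,\hat v_{x(\cdot)}(\tau)]\varphi(Y_{x(\cdot)}(\tau))\,\hat\mu_{x(\cdot)}(\tau,dw)\,d\tau$ is a martingale for all $\varphi\in\mathcal D^2$; 4. $\mathbb E_{x(\cdot)}c_+(t_0,Y_{x(\cdot)}(t_0))\ge\dots\ge\mathbb E_{x(\cdot)}c_+(t_r,Y_{x(\cdot)}(t_r))$. The stepwise strategy $\hat{\mathfrak u}_\Delta$ built from a model (and from selectors $u_l$) has the filtered space and the probabilities $P_{x(\cdot)}$ of the model, and the control $u_{x(\cdot)}(\tau,\omega)=u_l[x(t_l),Y_{x(\cdot)}(t_l,\omega)]$ for $\tau\in[t_l,t_{l+1})$. **Theorem.** Let $c_+$ be $u$-stable with respect to $L^2$. Then for every $(t_0,x_0)\in[0,T]\times\mathbb R^d$ $$\lim_{\delta\downarrow0}\ \sup\{J^*(t_0,x_0,\hat{\mathfrak u}_\Delta,\mathfrak v):\ d(\Delta)\le\delta\}\ \le\ c_+(t_0,x_0)+R\,C\sqrt{\Theta},$$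 where $d(\Delta)=\max_l(t_{l+1}-t_l)$; the supremum is over all partitions $\Delta$ of $[t_0,T]$ with $d(\Delta)\le\delta$, all strategies $\hat{\mathfrak u}_\Delta$ built as above, and all strategies $\mathfrak v$ of the second player; the limit exists in $[-\infty,\infty]$; and $$\Theta=\varkappa+M_0^1+M_0^2,\quad \varkappa=\sup_{[0,T]\times\mathbb R^d\times U\times V}\|b^1-b^2\|^2,\quad C=\sqrt{Te^{\beta T}},\quad \beta=2+2K^i,$$ with $i=1$ if the Isaacs condition holds for $b^1$ and $i=2$ otherwise. -/

import Mathlib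

open Set Filter Topology MeasureTheory ProbabilityTheory
open scoped NNReal ENNReal

universe uU uV w w₁ w₂ w₃

/-- The state space `ℝᵈ` with its Euclidean norm. -/
abbrev State (d : ℕ) : Type := EuclideanSpace ℝ (Fin d)

/-! ### Generators of Lévy–Khintchine type -/

/-- The coefficients `G(t,x,u,v)`, `f(t,x,u,v)`, `ν(t,x,u,v,dy)` of a controlled generator. -/
structure Generator (d : ℕ) (U : Type uU) (V : Type uV) where
  G : ℝ → State d → U → V → Matrix (Fin d) (Fin d) ℝ
  f : ℝ → State d → U → V → State d
  ν : ℝ → State d → U → V → Measure (State d)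

namespace Generator

variable {d : ℕ} {U : Type uU} {V : Type uV}

/-- `L_t[u,v] φ (x) = ½⟨G∇,∇⟩φ(x) + ⟨f,∇⟩φ(x)
      + ∫ [φ(x+y) - φ(x) - ⟨y,∇φ(x)⟩ 1_{B₁}(y)] ν(dy)`. -/
noncomputable def op (L : Generator d U V) (t : ℝ) (u : U) (v : V)
    (φ : State d → ℝ) (x : State d) : ℝ :=
  (1 / 2 : ℝ) * (∑ j, ∑ k, L.G t x u v j k *
      fderiv ℝ (fderiv ℝ φ) x (EuclideanSpace.single j 1) (EuclideanSpace.single k 1))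
    + fderiv ℝ φ x (L.f t x u v)
    + ∫ y, (φ (x + y) - φ x
        - (Metric.ball (0 : State d) 1).indicator (fun z => fderiv ℝ φ x z) y) ∂(L.ν t x u v)

/-- `Σ = tr G + ∫ ‖y‖² ν(dy)`. -/
noncomputable def sigma (L : Generator d U V) (t : ℝ) (x : State d) (u : U) (v : V) : ℝ :=
  (L.G t x u v).trace + ∫ y, ‖y‖ ^ 2 ∂(L.ν t x u v)

/-- `b = f + ∫_{ℝᵈ ∖ B₁} y ν(dy)`. -/
noncomputable def drift (L : Generator d U V) (t : ℝ) (x : State d) (u : U) (v : V) : State d :=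
  L.f t x u v + ∫ y in (Metric.ball (0 : State d) 1)ᶜ, y ∂(L.ν t x u v)

/-- The standing assumptions on one generator on the time interval `[0,T]`: it is of
Lévy–Khintchine type, its coefficients are continuous, and `M₀`, `M₁`, `K` are admissible
constants for the bounds on `Σ`, on `b`, and for the Lipschitz continuity of `b` in `x`. -/
structure IsAdmissible [TopologicalSpace U] [TopologicalSpace V]
    (L : Generator d U V) (T M₀ M₁ K : ℝ) : Prop where
  posSemidef : ∀ t ∈ Icc 0 T, ∀ x u v, (L.G t x u v).PosSemidef
  no_atom : ∀ t ∈ Icc 0 T, ∀ x u v, L.ν t x u v {0} = 0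
  levy : ∀ t ∈ Icc 0 T, ∀ x u v,
    ∫⁻ y, ENNReal.ofReal (min 1 (‖y‖ ^ 2)) ∂(L.ν t x u v) < ∞
  continuous_G : ContinuousOn (fun p : ℝ × State d × U × V => L.G p.1 p.2.1 p.2.2.1 p.2.2.2)
    (Icc 0 T ×ˢ univ)
  continuous_f : ContinuousOn (fun p : ℝ × State d × U × V => L.f p.1 p.2.1 p.2.2.1 p.2.2.2)
    (Icc 0 T ×ˢ univ)
  /-- Weak continuity of the Lévy measures (which may be infinite near `0`): they are tested
  against bounded continuous functions that vanish near the origin. -/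
  weakly_continuous_ν : ∀ h : State d → ℝ, Continuous h → (∃ C, ∀ y, |h y| ≤ C) →
    (∀ᶠ y in 𝓝 0, h y = 0) →
    ContinuousOn (fun p : ℝ × State d × U × V => ∫ y, h y ∂(L.ν p.1 p.2.1 p.2.2.1 p.2.2.2))
      (Icc 0 T ×ˢ univ)
  modulus : ∃ α : ℝ → ℝ, (∀ δ, 0 ≤ α δ) ∧ Tendsto α (𝓝[≠] 0) (𝓝 0) ∧
    ∀ t ∈ Icc 0 T, ∀ s ∈ Icc 0 T, ∀ x u v,
      ‖L.drift t x u v - L.drift s x u v‖ ^ 2 ≤ α (t - s)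
  second_moment : ∀ t ∈ Icc 0 T, ∀ x u v, Integrable (fun y => ‖y‖ ^ 2) (L.ν t x u v)
  sigma_le : ∀ t ∈ Icc 0 T, ∀ x u v, |L.sigma t x u v| ≤ M₀
  drift_le : ∀ t ∈ Icc 0 T, ∀ x u v, ‖L.drift t x u v‖ ≤ M₁
  drift_lipschitz : ∀ t ∈ Icc 0 T, ∀ x y u v,
    ‖L.drift t x u v - L.drift t y u v‖ ≤ K * ‖x - y‖

/-- The Isaacs condition for the drift of `L`. -/
def Isaacs (T : ℝ) (L : Generator d U V) : Prop :=
  ∀ t ∈ Icc 0 T, ∀ x ξ : State d,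
    (⨅ u, ⨆ v, inner ℝ ξ (L.drift t x u v)) = ⨆ v, ⨅ u, inner ℝ ξ (L.drift t x u v)

end Generator

/-- `C_b²(ℝᵈ)`: `C²` functions, bounded together with their first two derivatives. -/
def Cb2 (d : ℕ) : Set (State d → ℝ) :=
  {φ | ContDiff ℝ 2 φ ∧ ∃ C : ℝ, ∀ x,
    |φ x| ≤ C ∧ ‖fderiv ℝ φ x‖ ≤ C ∧ ‖fderiv ℝ (fderiv ℝ φ) x‖ ≤ C}

/-- `𝒟` is a class of test functions with `C_b² ∪ {x ↦ ‖x-a‖²}_a ⊆ 𝒟 ⊆ C²`. -/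
def IsTestClass {d : ℕ} (D : Set (State d → ℝ)) : Prop :=
  Cb2 d ∪ range (fun (a : State d) (x : State d) => ‖x - a‖ ^ 2) ⊆ D ∧
    D ⊆ {φ | ContDiff ℝ 2 φ}

/-! ### Paths, filtrations and martingale problems -/

/-- Right-continuous with left limits. -/
def IsCadlag {d : ℕ} {a b : ℝ} (x : Icc a b → State d) : Prop :=
  ∀ t, ContinuousWithinAt x (Ici t) t ∧ ∃ l, Tendsto x (𝓝[<] t) (𝓝 l)

/-- The Skorokhod space `D([a,b], ℝᵈ)`. -/
abbrev SkorokhodPath (d : ℕ) (a b : ℝ) : Type := {x : Icc a b → State d // IsCadlag x}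

/-- The σ-algebra on `D([a,b], ℝᵈ)` generated by the evaluations at times in `[a,s]`. -/
@[reducible] def pathSigma (d : ℕ) {a b : ℝ} (s : Icc a b) : MeasurableSpace (SkorokhodPath d a b) :=
  ⨆ r : Iic s, MeasurableSpace.comap (fun x : SkorokhodPath d a b => x.1 r.1) inferInstance

/-- The σ-algebra on `D([a,b], ℝᵈ)` generated by all evaluations. -/
@[reducible] def pathSigmaAll (d : ℕ) (a b : ℝ) : MeasurableSpace (SkorokhodPath d a b) :=
  ⨆ r : Icc a b, MeasurableSpace.comap (fun x : SkorokhodPath d a b => x.1 r) inferInstance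

/-- Lebesgue measure on `[a,b]`. -/
noncomputable def clock (a b : ℝ) : Measure (Icc a b) :=
  Measure.comap ((↑) : Icc a b → ℝ) volume

/-- For every `φ ∈ D` the process `φ(Y(s)) - ∫_a^s A_τ φ dτ` is a (well-defined) martingale. -/
def IsDynkinMartingale {d : ℕ} {a b : ℝ} {Ω : Type*} {m : MeasurableSpace Ω}
    (D : Set (State d → ℝ)) (𝓕 : Filtration (Icc a b) m) (P : Measure Ω)
    (Y : Icc a b → Ω → State d) (A : (State d → ℝ) → Icc a b → Ω → ℝ) : Prop :=
  ∀ φ ∈ D, (∀ᵐ ω ∂P, Integrable (fun τ => A φ τ ω) (clock a b)) ∧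
    Martingale (fun s ω => φ (Y s ω) - ∫ τ in Iic s, A φ τ ω ∂(clock a b)) 𝓕 P

/-- The product filtration `𝓕_s ⊗ 𝓖_s ⊗ 𝓗_s`. -/
def prodFiltration {I Ω₁ Ω₂ Ω₃ : Type*} [Preorder I]
    {m₁ : MeasurableSpace Ω₁} {m₂ : MeasurableSpace Ω₂} {m₃ : MeasurableSpace Ω₃}
    (𝓕 : Filtration I m₁) (𝓖 : Filtration I m₂) (𝓗 : Filtration I m₃) :
    Filtration I (m₁.prod (m₂.prod m₃)) where
  seq s := (𝓕 s).prod ((𝓖 s).prod (𝓗 s))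
  mono' _ _ h := sup_le_sup (MeasurableSpace.comap_mono (𝓕.mono h))
    (MeasurableSpace.comap_mono (sup_le_sup (MeasurableSpace.comap_mono (𝓖.mono h))
      (MeasurableSpace.comap_mono (𝓗.mono h))))
  le' s := sup_le_sup (MeasurableSpace.comap_mono (𝓕.le s))
    (MeasurableSpace.comap_mono (sup_le_sup (MeasurableSpace.comap_mono (𝓖.le s))
      (MeasurableSpace.comap_mono (𝓗.le s))))

/-! ### Strategies, motions, outcomes -/

/-- A (randomized, with memory) strategy on `[t₀,T]` of a player whose controls lie in `A`. -/
structure Strategy (d : ℕ) (t₀ T : ℝ) (A : Type*) [MeasurableSpace A] where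
  Ω : Type w
  [mΩ : MeasurableSpace Ω]
  𝓕 : Filtration (Icc t₀ T) mΩ
  ctrl : SkorokhodPath d t₀ T → Icc t₀ T → Ω → A
  P : SkorokhodPath d t₀ T → Measure Ω
  isProb : ∀ x, IsProbabilityMeasure (P x)
  progressive : ∀ x, IsProgressive 𝓕 (ctrl x)
  nonanticipative_P : ∀ (t : Icc t₀ T) (x y : SkorokhodPath d t₀ T), (∀ s ≤ t, x.1 s = y.1 s) →
    ∀ B, MeasurableSet[𝓕 t] B → P x B = P y B
  nonanticipative_ctrl : ∀ (t : Icc t₀ T) (x y : SkorokhodPath d t₀ T), (∀ s ≤ t, x.1 s = y.1 s) →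
    ∀ s ≤ t, ∀ᵐ ω ∂(P x), ctrl x s ω = ctrl y s ω
  measurable_ctrl : ∀ t : Icc t₀ T,
    Measurable[(pathSigma d t).prod (Subtype.instMeasurableSpace.prod (𝓕 t))]
      (fun p : SkorokhodPath d t₀ T × Iic t × Ω => ctrl p.1 p.2.1 p.2.2)

attribute [instance] Strategy.mΩ

/-- A realization of the motion generated by the strategies `𝔲`, `𝔳` and the initial position
`(t₀,x₀)` in the game with generator `L`. -/
structure Realization {d : ℕ} {U : Type uU} {V : Type uV} [MeasurableSpace U] [MeasurableSpace V]
    (D : Set (State d → ℝ)) (L : Generator d U V) {t₀ T : ℝ} (x₀ : State d)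
    (𝔲 : Strategy.{w₁} d t₀ T U) (𝔳 : Strategy.{w₂} d t₀ T V) where
  Ω : Type w
  [mΩ : MeasurableSpace Ω]
  𝓕 : Filtration (Icc t₀ T) mΩ
  P : Measure (Ω × 𝔲.Ω × 𝔳.Ω)
  isProb : IsProbabilityMeasure P
  X : Ω × 𝔲.Ω × 𝔳.Ω → SkorokhodPath d t₀ T
  adapted : Adapted (prodFiltration 𝓕 𝔲.𝓕 𝔳.𝓕) (fun t ω => (X ω).1 t)
  initial : ∀ h : t₀ ≤ T, ∀ᵐ ω ∂P, (X ω).1 ⟨t₀, left_mem_Icc.2 h⟩ = x₀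
  dynkin : IsDynkinMartingale D (prodFiltration 𝓕 𝔲.𝓕 𝔳.𝓕) P (fun t ω => (X ω).1 t)
    (fun φ τ ω => L.op τ (𝔲.ctrl (X ω) τ ω.2.1) (𝔳.ctrl (X ω) τ ω.2.2) φ ((X ω).1 τ))
  /-- `𝔼(ζ | X(·) = x(·)) = 𝔼^U_{x(·)} ζ` for random variables `ζ` on `Ω^U`. -/
  cond_first : ∀ ζ : 𝔲.Ω → ℝ, Measurable ζ → (∃ C, ∀ ω, |ζ ω| ≤ C) →
    P[fun ω => ζ ω.2.1 | MeasurableSpace.comap X (pathSigmaAll d t₀ T)]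
      =ᵐ[P] fun ω => ∫ ω', ζ ω' ∂(𝔲.P (X ω))
  /-- `𝔼(ζ | X(·) = x(·)) = 𝔼^V_{x(·)} ζ` for random variables `ζ` on `Ω^V`. -/
  cond_second : ∀ ζ : 𝔳.Ω → ℝ, Measurable ζ → (∃ C, ∀ ω, |ζ ω| ≤ C) →
    P[fun ω => ζ ω.2.2 | MeasurableSpace.comap X (pathSigmaAll d t₀ T)]
      =ᵐ[P] fun ω => ∫ ω', ζ ω' ∂(𝔳.P (X ω))

attribute [instance] Realization.mΩ

/-- The upper outcome `J*(t₀,x₀,𝔲,𝔳)`: the supremum of `𝔼 g(X(T))` over all realizations. -/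
noncomputable def upperOutcome {d : ℕ} {U : Type uU} {V : Type uV}
    [MeasurableSpace U] [MeasurableSpace V]
    (D : Set (State d → ℝ)) (L : Generator d U V) (g : State d → ℝ) {t₀ T : ℝ} (h : t₀ ≤ T)
    (x₀ : State d) (𝔲 : Strategy.{w₁} d t₀ T U) (𝔳 : Strategy.{w₂} d t₀ T V) : EReal :=
  ⨆ R : Realization.{uU, uV, w, w₁, w₂} D L x₀ 𝔲 𝔳,
    ((∫ ω, g ((R.X ω).1 ⟨T, right_mem_Icc.2 h⟩) ∂(R.P) : ℝ) : EReal)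

/-! ### `u`-stability -/

/-- The filtered space, generalized controls, processes and probabilities on `[t,θ]` that occur
in the definition of `u`-stability. -/
structure StabilityWitness {d : ℕ} {U : Type uU} {V : Type uV}
    [MeasurableSpace U] [MeasurableSpace V] (D : Set (State d → ℝ)) (L : Generator d U V)
    (c : ℝ → State d → ℝ) (t θ : ℝ) (h : t ≤ θ) where
  Ω : Type w
  [mΩ : MeasurableSpace Ω]
  𝓕 : Filtration (Icc t θ) mΩ
  μ : State d → V → Icc t θ → Ω → ProbabilityMeasure U
  Y : State d → V → Icc t θ → Ω → State d
  P : State d → V → Measure Ω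
  isProb : ∀ ξ v, IsProbabilityMeasure (P ξ v)
  progressive : ∀ ξ v, IsProgressive 𝓕 (μ ξ v)
  adapted : ∀ ξ v, Adapted 𝓕 (Y ξ v)
  initial : ∀ ξ v, ∀ᵐ ω ∂(P ξ v), Y ξ v ⟨t, left_mem_Icc.2 h⟩ ω = ξ
  dynkin : ∀ ξ v, IsDynkinMartingale D 𝓕 (P ξ v) (Y ξ v)
    (fun φ τ ω => ∫ u, L.op τ u v φ (Y ξ v τ ω) ∂(μ ξ v τ ω : Measure U))
  integrable : ∀ ξ v, Integrable (fun ω => c θ (Y ξ v ⟨θ, right_mem_Icc.2 h⟩ ω)) (P ξ v)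
  stable : ∀ ξ v, ∫ ω, c θ (Y ξ v ⟨θ, right_mem_Icc.2 h⟩ ω) ∂(P ξ v) ≤ c t ξ
  measurable_P : ∀ ψ : Ω → ℝ, Measurable ψ → (∃ C, ∀ ω, |ψ ω| ≤ C) →
    Measurable (fun p : State d × V => ∫ ω, ψ ω ∂(P p.1 p.2))
  measurable_Y : ∀ φ ∈ D,
    Measurable (fun p : State d × V × Icc t θ => ∫ ω, φ (Y p.1 p.2.1 p.2.2 ω) ∂(P p.1 p.2.1))

/-- `c` is `u`-stable with respect to the generator `L`, for the terminal payoff `g` at `T`. -/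
def IsUStable {d : ℕ} {U : Type uU} {V : Type uV} [MeasurableSpace U] [MeasurableSpace V]
    (D : Set (State d → ℝ)) (L : Generator d U V) (T : ℝ) (g : State d → ℝ)
    (c : ℝ → State d → ℝ) : Prop :=
  (∀ x, c T x = g x) ∧
    ∀ t θ : ℝ, 0 ≤ t → (h : t < θ) → θ ≤ T →
      Nonempty (StabilityWitness.{uU, uV, w} D L c t θ h.le)

/-! ### Partitions, the model of the game and the extremal shift -/

/-- A partition `t₀ = t_0 < … < t_r = T` of `[t₀,T]`. -/
structure TimePartition (t₀ T : ℝ) where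
  r : ℕ
  pt : Fin (r + 1) → Icc t₀ T
  strictMono : StrictMono pt
  first : (pt 0 : ℝ) = t₀
  last : (pt (Fin.last r) : ℝ) = T

namespace TimePartition

variable {t₀ T : ℝ}

/-- The mesh `d(Δ) = max_l (t_{l+1} - t_l)`. -/
noncomputable def mesh (Δ : TimePartition t₀ T) : ℝ :=
  ⨆ l : Fin Δ.r, ((Δ.pt l.succ : ℝ) - Δ.pt l.castSucc)

theorem pt_zero_le (Δ : TimePartition t₀ T) (τ : Icc t₀ T) : Δ.pt 0 ≤ τ :=
  Subtype.coe_le_coe.1 (Δ.first.le.trans τ.2.1)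

/-- The greatest index `l` with `t_l ≤ τ`. -/
noncomputable def idx (Δ : TimePartition t₀ T) (τ : Icc t₀ T) : Fin (Δ.r + 1) :=
  (Finset.univ.filter (fun l => Δ.pt l ≤ τ)).max'
    ⟨0, Finset.mem_filter.2 ⟨Finset.mem_univ _, Δ.pt_zero_le τ⟩⟩

theorem pt_idx_le (Δ : TimePartition t₀ T) (τ : Icc t₀ T) : Δ.pt (Δ.idx τ) ≤ τ :=
  (Finset.mem_filter.1 (Finset.max'_mem (Finset.univ.filter (fun l => Δ.pt l ≤ τ))
    ⟨0, Finset.mem_filter.2 ⟨Finset.mem_univ _, Δ.pt_zero_le τ⟩⟩)).2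

theorem idx_mono (Δ : TimePartition t₀ T) : Monotone Δ.idx := by
  intro σ τ h
  exact Finset.le_max' (Finset.univ.filter (fun l => Δ.pt l ≤ τ)) _
    (Finset.mem_filter.2 ⟨Finset.mem_univ _, (Δ.pt_idx_le σ).trans h⟩)

theorem measurable_idx (Δ : TimePartition t₀ T) : Measurable Δ.idx :=
  Δ.idx_mono.measurable

end TimePartition

section Game

variable {d : ℕ} {U : Type uU} {V : Type uV}

open Classical in
/-- The function `ϖ(t,z,ξ,u,v)`: `⟨z-ξ, b¹(t,z,u,v)⟩` if the Isaacs condition holds for `b¹`,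
and `⟨z-ξ, b²(t,ξ,u,v)⟩` otherwise. -/
noncomputable def shiftFun (T : ℝ) (L₁ L₂ : Generator d U V) (t : ℝ) (z ξ : State d)
    (u : U) (v : V) : ℝ :=
  if L₁.Isaacs T then inner ℝ (z - ξ) (L₁.drift t z u v)
  else inner ℝ (z - ξ) (L₂.drift t ξ u v)

/-- A choice of the measurable functions `(z,ξ) ↦ u_l[z,ξ]` of the extremal shift:
`max_v ϖ(t_l,z,ξ,u_l[z,ξ],v) = min_u max_v ϖ(t_l,z,ξ,u,v)`. -/
structure ExtremalSelector [MeasurableSpace U] (L₁ L₂ : Generator d U V) {t₀ T : ℝ}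
    (Δ : TimePartition t₀ T) where
  sel : Fin (Δ.r + 1) → State d → State d → U
  measurable_sel : ∀ l, Measurable (fun p : State d × State d => sel l p.1 p.2)
  extremal : ∀ l z ξ, (⨆ v, shiftFun T L₁ L₂ (Δ.pt l) z ξ (sel l z ξ) v)
    = ⨅ u, ⨆ v, shiftFun T L₁ L₂ (Δ.pt l) z ξ u v

/-- A model of the game for the partition `Δ` (and the last index `r`, so on `[t₀,T]`). -/
structure Model [MeasurableSpace U] [MeasurableSpace V] (D : Set (State d → ℝ))
    (L₁ L₂ : Generator d U V) (c : ℝ → State d → ℝ) {t₀ T : ℝ} (Δ : TimePartition t₀ T) where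
  Γ : Type w
  [mΓ : MeasurableSpace Γ]
  𝓖 : Filtration (Icc t₀ T) mΓ
  P : SkorokhodPath d t₀ T → Measure Γ
  μ : SkorokhodPath d t₀ T → Icc t₀ T → Γ → ProbabilityMeasure U
  v : SkorokhodPath d t₀ T → Icc t₀ T → Γ → V
  Y : SkorokhodPath d t₀ T → Icc t₀ T → Γ → State d
  isProb : ∀ x, IsProbabilityMeasure (P x)
  progressive_μ : ∀ x, IsProgressive 𝓖 (μ x)
  progressive_v : ∀ x, IsProgressive 𝓖 (v x)
  adapted : ∀ x, Adapted 𝓖 (Y x)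
  cadlag : ∀ x ω, IsCadlag (fun τ => Y x τ ω)
  /-- `Y_x(τ)`, `μ_x(τ)`, `v_x(τ)` depend only on the values of `x` at the `t_k ≤ τ`. -/
  depends_Y : ∀ (τ : Icc t₀ T) (x y : SkorokhodPath d t₀ T),
    (∀ k, Δ.pt k ≤ τ → x.1 (Δ.pt k) = y.1 (Δ.pt k)) → Y x τ = Y y τ
  depends_μ : ∀ (τ : Icc t₀ T) (x y : SkorokhodPath d t₀ T),
    (∀ k, Δ.pt k ≤ τ → x.1 (Δ.pt k) = y.1 (Δ.pt k)) → μ x τ = μ y τ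
  depends_v : ∀ (τ : Icc t₀ T) (x y : SkorokhodPath d t₀ T),
    (∀ k, Δ.pt k ≤ τ → x.1 (Δ.pt k) = y.1 (Δ.pt k)) → v x τ = v y τ
  /-- The dependence of `Y_x(τ)` on `x` is measurable, and `P_x` is nonanticipative in `x`; this
  is what makes the extremal shift below an admissible strategy. -/
  measurable_Y : ∀ τ : Icc t₀ T, Measurable[(pathSigma d τ).prod (𝓖 τ)]
    (fun p : SkorokhodPath d t₀ T × Γ => Y p.1 τ p.2)
  nonanticipative_P : ∀ (t : Icc t₀ T) (x y : SkorokhodPath d t₀ T), (∀ s ≤ t, x.1 s = y.1 s) →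
    ∀ B, MeasurableSet[𝓖 t] B → P x B = P y B
  /-- The control `v_x` maximizes `min_u ϖ(t_k, x(t_k), Y_x(t_k), u, ·)` on `[t_k,t_{k+1})`. -/
  extremal_v : ∀ (x : SkorokhodPath d t₀ T) (ω : Γ) (k : Fin Δ.r) (τ : Icc t₀ T),
    Δ.pt k.castSucc ≤ τ → τ < Δ.pt k.succ →
    (⨆ v', ⨅ u, shiftFun T L₁ L₂ (Δ.pt k.castSucc) (x.1 (Δ.pt k.castSucc))
        (Y x (Δ.pt k.castSucc) ω) u v')
      = ⨅ u, shiftFun T L₁ L₂ (Δ.pt k.castSucc) (x.1 (Δ.pt k.castSucc))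
        (Y x (Δ.pt k.castSucc) ω) u (v x τ ω)
  initial : ∀ x, ∀ᵐ ω ∂(P x), Y x (Δ.pt 0) ω = x.1 (Δ.pt 0)
  dynkin : ∀ x, IsDynkinMartingale D 𝓖 (P x) (Y x)
    (fun φ τ ω => ∫ u, L₂.op τ u (v x τ ω) φ (Y x τ ω) ∂(μ x τ ω : Measure U))
  integrable_c : ∀ x l, Integrable (fun ω => c (Δ.pt l) (Y x (Δ.pt l) ω)) (P x)
  antitone_c : ∀ x, Antitone (fun l => ∫ ω, c (Δ.pt l) (Y x (Δ.pt l) ω) ∂(P x))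

attribute [instance] Model.mΓ

/-- The control `u_x(τ,ω) = u_l[x(t_l), Y_x(t_l,ω)]` for `τ ∈ [t_l,t_{l+1})`. -/
noncomputable def extremalCtrl [MeasurableSpace U] [MeasurableSpace V] {D : Set (State d → ℝ)}
    {L₁ L₂ : Generator d U V} {c : ℝ → State d → ℝ} {t₀ T : ℝ} {Δ : TimePartition t₀ T}
    (M : Model.{uU, uV, w} D L₁ L₂ c Δ) (S : ExtremalSelector L₁ L₂ Δ)
    (x : SkorokhodPath d t₀ T) (τ : Icc t₀ T) (ω : M.Γ) : U :=
  S.sel (Δ.idx τ) (x.1 (Δ.pt (Δ.idx τ))) (M.Y x (Δ.pt (Δ.idx τ)) ω)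

theorem measurable_extremalCtrl [MeasurableSpace U] [MeasurableSpace V] {D : Set (State d → ℝ)}
    {L₁ L₂ : Generator d U V} {c : ℝ → State d → ℝ} {t₀ T : ℝ} {Δ : TimePartition t₀ T}
    (M : Model.{uU, uV, w} D L₁ L₂ c Δ) (S : ExtremalSelector L₁ L₂ Δ) (t : Icc t₀ T) :
    Measurable[(pathSigma d t).prod (Subtype.instMeasurableSpace.prod (M.𝓖 t))]
      (fun p : SkorokhodPath d t₀ T × Iic t × M.Γ => extremalCtrl M S p.1 p.2.1 p.2.2) := by
  let m₁ : MeasurableSpace (SkorokhodPath d t₀ T) := pathSigma d t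
  let m₂ : MeasurableSpace M.Γ := M.𝓖 t
  have key : ∀ l : Fin (Δ.r + 1), Δ.pt l ≤ t → Measurable
      (fun p : SkorokhodPath d t₀ T × Iic t × M.Γ =>
        S.sel l (p.1.1 (Δ.pt l)) (M.Y p.1 (Δ.pt l) p.2.2)) := by
    intro l hl
    have h1 : Measurable (fun x : SkorokhodPath d t₀ T => x.1 (Δ.pt l)) :=
      Measurable.mono (comap_measurable _)
        (le_iSup (fun r : Iic t => MeasurableSpace.comap
          (fun x : SkorokhodPath d t₀ T => x.1 r.1) inferInstance) ⟨Δ.pt l, hl⟩) le_rfl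
    have hle : pathSigma d (Δ.pt l) ≤ pathSigma d t :=
      iSup_le fun r => le_iSup (fun r : Iic t => MeasurableSpace.comap
          (fun x : SkorokhodPath d t₀ T => x.1 r.1) inferInstance) ⟨r.1, le_trans r.2 hl⟩
    have h2 : Measurable (fun q : SkorokhodPath d t₀ T × M.Γ => M.Y q.1 (Δ.pt l) q.2) :=
      Measurable.mono (M.measurable_Y (Δ.pt l))
        (sup_le_sup (MeasurableSpace.comap_mono hle)
          (MeasurableSpace.comap_mono (M.𝓖.mono hl))) le_rfl
    have h3 : Measurable (fun p : SkorokhodPath d t₀ T × Iic t × M.Γ => M.Y p.1 (Δ.pt l) p.2.2) :=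
      h2.comp (measurable_fst.prodMk (measurable_snd.comp measurable_snd))
    exact (S.measurable_sel l).comp ((h1.comp measurable_fst).prodMk h3)
  have hidx : Measurable (fun p : SkorokhodPath d t₀ T × Iic t × M.Γ => Δ.idx p.2.1) :=
    Δ.measurable_idx.comp (measurable_subtype_coe.comp (measurable_fst.comp measurable_snd))
  intro B hB
  have hset : (fun p : SkorokhodPath d t₀ T × Iic t × M.Γ => extremalCtrl M S p.1 p.2.1 p.2.2) ⁻¹' B
      = ⋃ l : Fin (Δ.r + 1), ⋃ _ : Δ.pt l ≤ t,
        ((fun p : SkorokhodPath d t₀ T × Iic t × M.Γ => Δ.idx p.2.1) ⁻¹' {l}) ∩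
        ((fun p : SkorokhodPath d t₀ T × Iic t × M.Γ =>
          S.sel l (p.1.1 (Δ.pt l)) (M.Y p.1 (Δ.pt l) p.2.2)) ⁻¹' B) := by
    ext p
    simp only [mem_preimage, mem_iUnion, mem_inter_iff, mem_singleton_iff, extremalCtrl]
    constructor
    · intro h
      exact ⟨Δ.idx p.2.1, (Δ.pt_idx_le _).trans p.2.1.2, rfl, h⟩
    · rintro ⟨l, _, rfl, h⟩
      exact h
  rw [hset]
  exact MeasurableSet.iUnion fun l => MeasurableSet.iUnion fun hl =>
    (hidx (measurableSet_singleton l)).inter (key l hl hB)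

theorem isProgressive_extremalCtrl [MeasurableSpace U] [MeasurableSpace V]
    {D : Set (State d → ℝ)} {L₁ L₂ : Generator d U V} {c : ℝ → State d → ℝ} {t₀ T : ℝ}
    {Δ : TimePartition t₀ T} (M : Model.{uU, uV, w} D L₁ L₂ c Δ) (S : ExtremalSelector L₁ L₂ Δ)
    (x : SkorokhodPath d t₀ T) : IsProgressive M.𝓖 (extremalCtrl M S x) := by
  intro t
  have h : @Measurable (Iic t × M.Γ) (SkorokhodPath d t₀ T × Iic t × M.Γ)
      (Subtype.instMeasurableSpace.prod (M.𝓖 t))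
      ((pathSigma d t).prod (Subtype.instMeasurableSpace.prod (M.𝓖 t))) (fun q => (x, q)) :=
    @measurable_prodMk_left _ _ (pathSigma d t) (Subtype.instMeasurableSpace.prod (M.𝓖 t)) x
  intro B hB
  exact h (measurable_extremalCtrl M S t hB)

/-- The stepwise extremal-shift strategy `û_Δ` built from a model of the game. -/
noncomputable def extremalShift [MeasurableSpace U] [MeasurableSpace V] {D : Set (State d → ℝ)}
    {L₁ L₂ : Generator d U V} {c : ℝ → State d → ℝ} {t₀ T : ℝ} {Δ : TimePartition t₀ T}
    (M : Model.{uU, uV, w} D L₁ L₂ c Δ) (S : ExtremalSelector L₁ L₂ Δ) :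
    Strategy.{w} d t₀ T U where
  Ω := M.Γ
  𝓕 := M.𝓖
  ctrl := extremalCtrl M S
  P := M.P
  isProb := M.isProb
  progressive := isProgressive_extremalCtrl M S
  nonanticipative_P := M.nonanticipative_P
  nonanticipative_ctrl t x y hxy s hs := by
    refine ae_of_all _ fun ω => ?_
    have h1 : Δ.pt (Δ.idx s) ≤ t := (Δ.pt_idx_le s).trans hs
    have h2 : M.Y x (Δ.pt (Δ.idx s)) = M.Y y (Δ.pt (Δ.idx s)) :=
      M.depends_Y _ x y fun k hk => hxy _ (hk.trans h1)
    simp only [extremalCtrl, hxy _ h1, h2]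
  measurable_ctrl := measurable_extremalCtrl M S

end Game

/-! ### Constants -/

section Constants

variable {d : ℕ} {U : Type uU} {V : Type uV}

/-- `ϰ = sup ‖b¹ - b²‖²` over `[0,T] × ℝᵈ × U × V`. -/
noncomputable def driftMismatch (T : ℝ) (L₁ L₂ : Generator d U V) : ℝ :=
  ⨆ p : Icc (0 : ℝ) T × State d × U × V,
    ‖L₁.drift p.1 p.2.1 p.2.2.1 p.2.2.2 - L₂.drift p.1 p.2.1 p.2.2.1 p.2.2.2‖ ^ 2

open Classical in
/-- `β = 2 + 2Kⁱ`, with `i = 1` if the Isaacs condition holds for `b¹` and `i = 2` otherwise. -/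
noncomputable def betaConst (T : ℝ) (L₁ : Generator d U V) (K₁ K₂ : ℝ) : ℝ :=
  2 + 2 * (if L₁.Isaacs T then K₁ else K₂)

end Constants

/-!
Under the extremal shift the motion `X` of the game for `L₁` stays close, in mean square, to the
model process `Y` of the game for `L₂`, and the mean of `c` along `Y` decreases by the definition of
a model. The mean payoff of `X` thus exceeds `c(t₀,x₀)` by at most the Lipschitz constant of `g`
times the root mean square distance of `X` and `Y` at the terminal time.

*Reduction to quadratic functions.* On `‖· - a‖²` the generator takes the value `Σ + 2⟨b, x - a⟩`
(`Generator.op_norm_sub_sq`), so that both `X` and `Y` solve the martingale problem for quadratic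
functions with bounded data `Σ`, `b` (`IsQuadraticSolution`). This alone yields
`E‖Y(t) - Y(s)‖² = O(t - s)` and identifies `E⟨W, Y(t) - Y(s)⟩` for `W` known at time `s` as the
mean of the time integral of `⟨W, b⟩`.

*One step.* On `[t_k, t_{k+1})` the control of the first player keeps the drift of `X` in the
direction `X(t_k) - Y(t_k)` below the value of the game with payoff `ϖ`, the control `v̂` keeps the
drift of `Y` in this direction above it, and the Isaacs condition says that there is one value only
(`inner_drift_le_of_extremal`, `le_inner_drift_of_extremal`). The drift that does not enter `ϖ` is
compared with the one that does, at the cost of `ϰ` and of the Lipschitz constant. Hence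
`q = E‖X - Y‖²` satisfies `q(t_{k+1}) ≤ q(t_k) + (t_{k+1} - t_k)(β q(t_k) + Θ + error)`
(`Realization.integral_norm_sub_sq_step`), where the error is small with the mesh.

*The coupling.* The statement about `Y` is available under `P_x` for each fixed path `x` and has to
be integrated along the conditional law of the random element of the model given `X`
(`IsConditionalLaw.integral_nonpos`). The controls of the model are not assumed to be measurable in
`x`; therefore they are estimated away for fixed `x`, where the displacement of `X` is
deterministic, and only the values of `Y` enter the function that is integrated (`stepExcess`).

A discrete Gronwall inequality bounds `q(T)` by `T e^{βT} (Θ + error)`. The supremum over the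
partitions of mesh at most `δ` is monotone in `δ`, so that its limit at `0` exists and is at most
`c(t₀,x₀)` plus the Lipschitz constant of `g` times `√(T e^{βT} (Θ + η))` for every `η > 0`.
-/

/-! ### The generator on quadratic functions -/

theorem hasFDerivAt_norm_sub_sq {d : ℕ} (a x : State d) :
    HasFDerivAt (fun x : State d => ‖x - a‖ ^ 2) ((2 : ℝ) • innerSL ℝ (x - a)) x := by
  refine ((hasFDerivAt_id x).sub_const a).norm_sq.congr_fderiv ?_
  ext y
  simp

theorem fderiv_norm_sub_sq {d : ℕ} (a : State d) :
    fderiv ℝ (fun x : State d => ‖x - a‖ ^ 2) = fun x => (2 : ℝ) • innerSL ℝ (x - a) :=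
  funext fun x => (hasFDerivAt_norm_sub_sq a x).fderiv

theorem fderiv_fderiv_norm_sub_sq {d : ℕ} (a x y z : State d) :
    fderiv ℝ (fderiv ℝ (fun x : State d => ‖x - a‖ ^ 2)) x y z = 2 * inner ℝ y z := by
  have h : HasFDerivAt (fun x : State d => (2 : ℝ) • innerSL ℝ (x - a))
      ((2 : ℝ) • innerSL ℝ (E := State d)) x := by
    have h1 := ((innerSL ℝ (E := State d)).hasFDerivAt (x := x - a)).comp x
      ((hasFDerivAt_id x).sub_const a)
    exact (h1.const_smul (2 : ℝ)).congr_fderiv (by ext; simp)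
  rw [fderiv_norm_sub_sq, h.fderiv]
  simp only [_root_.smul_apply, smul_eq_mul]
  rw [innerSL_apply_apply]

namespace Generator

variable {d : ℕ} {U : Type uU} {V : Type uV}

theorem integrableOn_id_compl_ball {ν : Measure (State d)}
    (h : Integrable (fun y => ‖y‖ ^ 2) ν) :
    IntegrableOn (fun y : State d => y) (Metric.ball (0 : State d) 1)ᶜ ν := by
  refine Integrable.mono h.integrableOn measurable_id.aestronglyMeasurable ?_
  refine (ae_restrict_iff' Metric.isOpen_ball.measurableSet.compl).2 (ae_of_all _ fun y hy => ?_)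
  have : 1 ≤ ‖y‖ := by simpa using hy
  rw [Real.norm_of_nonneg (by positivity)]
  nlinarith

/-- On `‖· - a‖²` the compensated jump integral combines with the first-order term: the generator
acts through `Σ` and `b` only. -/
theorem op_norm_sub_sq (L : Generator d U V) {t : ℝ} {x : State d} {u : U} {v : V}
    (h2 : Integrable (fun y => ‖y‖ ^ 2) (L.ν t x u v)) (a : State d) :
    L.op t u v (fun x => ‖x - a‖ ^ 2) x
      = L.sigma t x u v + 2 * inner ℝ (L.drift t x u v) (x - a) := by
  have hball : MeasurableSet (Metric.ball (0 : State d) 1) := Metric.isOpen_ball.measurableSet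
  have hG : ∑ j, ∑ k, L.G t x u v j k *
      fderiv ℝ (fderiv ℝ (fun x : State d => ‖x - a‖ ^ 2)) x
        (EuclideanSpace.single j 1) (EuclideanSpace.single k 1) = 2 * (L.G t x u v).trace := by
    simp only [fderiv_fderiv_norm_sub_sq, Matrix.trace, Matrix.diag, Finset.mul_sum]
    refine Finset.sum_congr rfl fun j _ => ?_
    rw [Finset.sum_eq_single j]
    · simp; ring
    · intro k _ hk
      rw [EuclideanSpace.inner_single_left]
      simp [hk]
    · simp
  have hint : ∀ y : State d, (‖x + y - a‖ ^ 2 - ‖x - a‖ ^ 2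
        - (Metric.ball (0 : State d) 1).indicator
          (fun z => fderiv ℝ (fun x : State d => ‖x - a‖ ^ 2) x z) y)
      = ‖y‖ ^ 2
        + 2 * inner ℝ (x - a) ((Metric.ball (0 : State d) 1)ᶜ.indicator (fun y => y) y) := by
    intro y
    have hxy : x + y - a = (x - a) + y := by abel
    have e := norm_add_sq_real (x - a) y
    rw [fderiv_norm_sub_sq, hxy, e]
    by_cases hy : y ∈ Metric.ball (0 : State d) 1
    · rw [indicator_of_mem hy, indicator_of_notMem (by simpa using hy)]
      simp only [_root_.smul_apply, smul_eq_mul, innerSL_apply_apply, inner_zero_right]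
      ring
    · rw [indicator_of_notMem hy, indicator_of_mem (by simpa using hy)]
      ring
  have hI : Integrable ((Metric.ball (0 : State d) 1)ᶜ.indicator (fun y : State d => y))
      (L.ν t x u v) := (integrable_indicator_iff hball.compl).2 (integrableOn_id_compl_ball h2)
  rw [op, hG, sigma, drift]
  simp only [hint]
  rw [integral_add h2 ((hI.const_inner _).const_mul _), integral_const_mul, integral_inner hI,
    integral_indicator hball.compl, inner_add_left, fderiv_norm_sub_sq,
    real_inner_comm (x - a) (∫ y in (Metric.ball (0 : State d) 1)ᶜ, y ∂L.ν t x u v)]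
  simp only [_root_.smul_apply, innerSL_apply_apply, smul_eq_mul]
  rw [real_inner_comm (x - a) (L.f t x u v)]
  ring

/-- A continuous cut-off of the norm. As `n → ∞` it converges to the indicator of `r ≥ 1` for
`(c, e) = (1, 1)` and of `r > 0` for `(c, e) = (0, -1)`. -/
noncomputable def cutoff (c e : ℝ) (n : ℕ) (r : ℝ) : ℝ :=
  max 0 (min 1 (min (((n : ℝ) + 2) * (r - c) + e) (n + 2 - r)))

theorem continuous_cutoff (c e : ℝ) (n : ℕ) : Continuous (cutoff c e n) := by
  unfold cutoff; fun_prop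

theorem cutoff_nonneg (c e : ℝ) (n : ℕ) (r : ℝ) : 0 ≤ cutoff c e n r := le_max_left _ _

theorem cutoff_le_one (c e : ℝ) (n : ℕ) (r : ℝ) : cutoff c e n r ≤ 1 :=
  max_le zero_le_one (min_le_left _ _)

theorem cutoff_eq_zero_of_low {c e : ℝ} {n : ℕ} {r : ℝ} (h : ((n : ℝ) + 2) * (r - c) + e ≤ 0) :
    cutoff c e n r = 0 :=
  max_eq_left ((min_le_right _ _).trans ((min_le_left _ _).trans h))

theorem cutoff_eq_zero_of_high {c e : ℝ} {n : ℕ} {r : ℝ} (h : (n : ℝ) + 2 ≤ r) :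
    cutoff c e n r = 0 :=
  max_eq_left ((min_le_right _ _).trans ((min_le_right _ _).trans (by linarith)))

theorem cutoff_eq_one {c e : ℝ} {n : ℕ} {r : ℝ} (h : 1 ≤ ((n : ℝ) + 2) * (r - c) + e)
    (h' : r ≤ n + 1) : cutoff c e n r = 1 := by
  rw [cutoff, min_eq_left (le_min h (by linarith)), max_eq_right zero_le_one]

theorem tendsto_cutoff_one_of_gt {c e r : ℝ} (h : c < r) :
    Tendsto (fun n => cutoff c e n r) atTop (𝓝 1) := by
  refine tendsto_const_nhds.congr' ?_
  obtain ⟨N, hN⟩ := exists_nat_ge (max r ((1 - e) / (r - c)))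
  filter_upwards [eventually_ge_atTop N] with n hn
  have hn' : (N : ℝ) ≤ n := by exact_mod_cast hn
  refine (cutoff_eq_one ?_ ?_).symm
  · have := (le_max_right _ _).trans (hN.trans hn')
    rw [div_le_iff₀ (by linarith)] at this
    nlinarith
  · linarith [(le_max_left _ _).trans (hN.trans hn')]

theorem tendsto_cutoff_zero_of_lt {c e r : ℝ} (h : r < c) :
    Tendsto (fun n => cutoff c e n r) atTop (𝓝 0) := by
  refine tendsto_const_nhds.congr' ?_
  obtain ⟨N, hN⟩ := exists_nat_ge (e / (c - r))
  filter_upwards [eventually_ge_atTop N] with n hn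
  have hn' : (N : ℝ) ≤ n := by exact_mod_cast hn
  refine (cutoff_eq_zero_of_low ?_).symm
  have := hN.trans hn'
  rw [div_le_iff₀ (by linarith)] at this
  nlinarith

theorem continuous_slice [TopologicalSpace U] [TopologicalSpace V] {T : ℝ}
    (t : ℝ) (x : State d) (v : V) (ht : t ∈ Icc 0 T) {E : Type*}
    [TopologicalSpace E] {F : ℝ × State d × U × V → E} (hF : ContinuousOn F (Icc 0 T ×ˢ univ)) :
    Continuous (fun u => F (t, x, u, v)) :=
  hF.comp_continuous (by fun_prop) fun _ => ⟨ht, mem_univ _⟩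

section Measurability

variable [TopologicalSpace U] [MeasurableSpace U] [BorelSpace U] [TopologicalSpace V]
  {L : Generator d U V} {T M₀ M₁ K : ℝ}

/-- Integrals against `ν(t,x,u,v)` of a pointwise limit of admissible test functions that are
dominated by `‖y‖²` depend measurably on the control `u`. -/
theorem IsAdmissible.measurable_integral (hL : L.IsAdmissible T M₀ M₁ K) {t : ℝ}
    (ht : t ∈ Icc 0 T) (x : State d) (v : V) {h : State d → ℝ} {hn : ℕ → State d → ℝ}
    (hcont : ∀ n, Continuous (hn n)) (hbdd : ∀ n, ∃ C, ∀ y, |hn n y| ≤ C)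
    (hzero : ∀ n, ∀ᶠ y in 𝓝 0, hn n y = 0) (C : ℝ) (hdom : ∀ n y, |hn n y| ≤ C * ‖y‖ ^ 2)
    (hlim : ∀ y, Tendsto (fun n => hn n y) atTop (𝓝 (h y))) :
    Measurable (fun u => ∫ y, h y ∂(L.ν t x u v)) := by
  refine measurable_of_tendsto_metrizable (f := fun n u => ∫ y, hn n y ∂(L.ν t x u v))
    (fun n => (continuous_slice t x v ht
      (hL.weakly_continuous_ν (hn n) (hcont n) (hbdd n) (hzero n))).measurable) ?_
  refine tendsto_pi_nhds.2 fun u => ?_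
  exact tendsto_integral_of_dominated_convergence (fun y => C * ‖y‖ ^ 2)
    (fun n => (hcont n).aestronglyMeasurable) ((hL.second_moment t ht x u v).const_mul C)
    (fun n => ae_of_all _ (hdom n)) (ae_of_all _ hlim)

theorem IsAdmissible.measurable_sigma (hL : L.IsAdmissible T M₀ M₁ K) {t : ℝ}
    (ht : t ∈ Icc 0 T) (x : State d) (v : V) : Measurable (fun u => L.sigma t x u v) := by
  have hG := continuous_slice t x v ht hL.continuous_G
  refine (Continuous.measurable (f := fun u => (L.G t x u v).trace)
    (hG.matrix_trace)).add ?_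
  refine hL.measurable_integral ht x v (hn := fun n y => ‖y‖ ^ 2 * cutoff 0 (-1) n ‖y‖)
    (fun n => (by fun_prop : Continuous fun y : State d => ‖y‖ ^ 2).mul
      ((continuous_cutoff _ _ n).comp continuous_norm)) (fun n => ⟨((n : ℝ) + 2) ^ 2, fun y => ?_⟩)
    (fun n => ?_) 1 (fun n y => ?_) (fun y => ?_)
  · rw [abs_of_nonneg (mul_nonneg (by positivity) (cutoff_nonneg _ _ _ _))]
    rcases le_total ((n : ℝ) + 2) ‖y‖ with h | h
    · rw [cutoff_eq_zero_of_high h, mul_zero]; positivity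
    · calc ‖y‖ ^ 2 * cutoff 0 (-1) n ‖y‖ ≤ ‖y‖ ^ 2 * 1 := by gcongr; exact cutoff_le_one _ _ _ _
        _ ≤ _ := by rw [mul_one]; gcongr
  · have : ∀ᶠ y : State d in 𝓝 0, ‖y‖ < 1 / ((n : ℝ) + 2) := by
      have : Tendsto (fun y : State d => ‖y‖) (𝓝 0) (𝓝 0) := by
        simpa using (continuous_norm (E := State d)).tendsto 0
      exact this.eventually_lt_const (by positivity)
    filter_upwards [this] with y hy
    rw [cutoff_eq_zero_of_low, mul_zero]
    rw [lt_div_iff₀ (by positivity)] at hy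
    linarith
  · rw [abs_of_nonneg (mul_nonneg (by positivity) (cutoff_nonneg _ _ _ _)), one_mul]
    exact mul_le_of_le_one_right (by positivity) (cutoff_le_one _ _ _ _)
  · rcases (norm_nonneg y).eq_or_lt with h | h
    · simp [← h]
    · simpa using (tendsto_cutoff_one_of_gt h).const_mul (‖y‖ ^ 2)

theorem IsAdmissible.measurable_inner_drift (hL : L.IsAdmissible T M₀ M₁ K) {t : ℝ}
    (ht : t ∈ Icc 0 T) (x : State d) (v : V) (p : State d) :
    Measurable (fun u => inner ℝ p (L.drift t x u v)) := by
  have hf := continuous_slice t x v ht hL.continuous_f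
  have key : ∀ u, inner ℝ p (L.drift t x u v) = inner ℝ p (L.f t x u v)
      + ∫ y, (Metric.ball (0 : State d) 1)ᶜ.indicator (fun y => inner ℝ p y) y ∂(L.ν t x u v) := by
    intro u
    rw [drift, inner_add_right, integral_indicator Metric.isOpen_ball.measurableSet.compl,
      ← integral_inner (integrableOn_id_compl_ball (hL.second_moment t ht x u v))]
  simp only [key]
  refine (Continuous.measurable (by fun_prop)).add ?_
  -- The cut-off vanishes for `‖y‖ ≤ 1/2`, so that `‖y‖ ≤ 2‖y‖²` on its support.
  have hlow : ∀ (n : ℕ) (y : State d), ‖y‖ ≤ 1 / 2 → cutoff 1 1 n ‖y‖ = 0 := by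
    intro n y hy
    refine cutoff_eq_zero_of_low ?_
    have : (0 : ℝ) ≤ n := n.cast_nonneg
    nlinarith
  have habs : ∀ (n : ℕ) (y : State d), |inner ℝ p y * cutoff 1 1 n ‖y‖|
      ≤ ‖p‖ * ‖y‖ * cutoff 1 1 n ‖y‖ := by
    intro n y
    rw [abs_mul, abs_of_nonneg (cutoff_nonneg _ _ _ _)]
    exact mul_le_mul_of_nonneg_right (abs_real_inner_le_norm _ _) (cutoff_nonneg _ _ _ _)
  refine hL.measurable_integral ht x v (hn := fun n y => inner ℝ p y * cutoff 1 1 n ‖y‖)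
    (fun n => (by fun_prop : Continuous fun y : State d => inner ℝ p y).mul
      ((continuous_cutoff _ _ n).comp continuous_norm))
    (fun n => ⟨‖p‖ * ((n : ℝ) + 2), fun y => (habs n y).trans ?_⟩)
    (fun n => ?_) (2 * ‖p‖) (fun n y => (habs n y).trans ?_) (fun y => ?_)
  · rcases le_total ((n : ℝ) + 2) ‖y‖ with h | h
    · rw [cutoff_eq_zero_of_high h, mul_zero]; positivity
    · calc ‖p‖ * ‖y‖ * cutoff 1 1 n ‖y‖ ≤ ‖p‖ * ‖y‖ * 1 := by
            gcongr; exact cutoff_le_one _ _ _ _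
        _ ≤ _ := by rw [mul_one]; gcongr
  · have : ∀ᶠ y : State d in 𝓝 0, ‖y‖ < 1 / 2 := by
      have : Tendsto (fun y : State d => ‖y‖) (𝓝 0) (𝓝 0) := by
        simpa using (continuous_norm (E := State d)).tendsto 0
      exact this.eventually_lt_const (by positivity)
    filter_upwards [this] with y hy
    rw [hlow n y hy.le, mul_zero]
  · rcases le_total ‖y‖ (1 / 2) with h | h
    · rw [hlow n y h, mul_zero]; positivity
    · calc ‖p‖ * ‖y‖ * cutoff 1 1 n ‖y‖ ≤ ‖p‖ * ‖y‖ * 1 := by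
            gcongr; exact cutoff_le_one _ _ _ _
        _ = ‖p‖ * (‖y‖ * 1) := by ring
        _ ≤ ‖p‖ * (2 * ‖y‖ ^ 2) :=
            mul_le_mul_of_nonneg_left (by nlinarith) (norm_nonneg p)
        _ = _ := by ring
  · rcases lt_trichotomy ‖y‖ 1 with h | h | h
    · rw [indicator_of_notMem (by simpa using h)]
      simpa using (tendsto_cutoff_zero_of_lt (e := 1) h).const_mul (inner ℝ p y)
    · rw [indicator_of_mem (by simp [h])]
      refine tendsto_const_nhds.congr fun n => ?_
      rw [cutoff_eq_one, mul_one]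
      · simp [h]
      · simp [h]
    · rw [indicator_of_mem (by simpa using h.le)]
      simpa using (tendsto_cutoff_one_of_gt (e := 1) h).const_mul (inner ℝ p y)

theorem IsAdmissible.measurable_drift (hL : L.IsAdmissible T M₀ M₁ K) {t : ℝ}
    (ht : t ∈ Icc 0 T) (x : State d) (v : V) : Measurable (fun u => L.drift t x u v) := by
  have : (fun u => L.drift t x u v) = fun u => ∑ j,
      inner ℝ (EuclideanSpace.basisFun (Fin d) ℝ j) (L.drift t x u v) •
        EuclideanSpace.basisFun (Fin d) ℝ j :=
    funext fun u => ((EuclideanSpace.basisFun (Fin d) ℝ).sum_repr' (L.drift t x u v)).symm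
  rw [this]
  exact Finset.measurable_sum _ fun j _ => (hL.measurable_inner_drift ht x v _).smul_const _

end Measurability

end Generator

/-! ### Time integrals and càdlàg processes -/

section Clock

variable {a b : ℝ}

theorem clock_apply_preimage (s : Set ℝ) (hs : s ⊆ Icc a b) :
    clock a b ((↑) ⁻¹' s) = volume s := by
  rw [clock, comap_subtype_coe_apply measurableSet_Icc, Subtype.image_preimage_coe,
    inter_eq_right.2 hs]

theorem clock_Ioc (s t : Icc a b) : clock a b (Ioc s t) = ENNReal.ofReal (t - s) := by
  have : Ioc s t = (↑) ⁻¹' Ioc (s : ℝ) (t : ℝ) := by ext; simp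
  rw [this, clock_apply_preimage _ (fun x hx => ⟨s.2.1.trans hx.1.le, hx.2.trans t.2.2⟩),
    Real.volume_Ioc]

theorem clock_univ : clock a b univ = ENNReal.ofReal (b - a) := by
  have : (univ : Set (Icc a b)) = (↑) ⁻¹' Icc a b := by ext; simp
  rw [this, clock_apply_preimage _ subset_rfl, Real.volume_Icc]

instance : IsFiniteMeasure (clock a b) := ⟨by rw [clock_univ]; exact ENNReal.ofReal_lt_top⟩

instance : NullSingletonClass (clock a b) := ⟨fun s => by
  have : ({s} : Set (Icc a b)) = (↑) ⁻¹' {(s : ℝ)} := by ext; simp [Subtype.ext_iff]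
  rw [this, clock_apply_preimage _ (by simp), Real.volume_singleton]⟩

theorem clock_real_Ioc {s t : Icc a b} (h : s ≤ t) : (clock a b).real (Ioc s t) = t - s := by
  rw [measureReal_def, clock_Ioc, ENNReal.toReal_ofReal (sub_nonneg.2 h)]

theorem setIntegral_Iic_sub {E : Type*} [NormedAddCommGroup E] [NormedSpace ℝ E]
    {f : Icc a b → E} (hf : Integrable f (clock a b)) {s t : Icc a b} (h : s ≤ t) :
    ∫ τ in Iic t, f τ ∂(clock a b) - ∫ τ in Iic s, f τ ∂(clock a b)
      = ∫ τ in Ioc s t, f τ ∂(clock a b) := by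
  rw [← Iic_union_Ioc_eq_Iic h, setIntegral_union _ measurableSet_Ioc hf.integrableOn
    hf.integrableOn, add_sub_cancel_left]
  exact disjoint_left.2 fun x hx hx' => not_lt.2 hx hx'.1

theorem setIntegral_Ioc_le {f : Icc a b → ℝ} {s t : Icc a b} (h : s ≤ t)
    (hf : IntegrableOn f (Ioc s t) (clock a b)) {C : ℝ} (hC : ∀ τ, s ≤ τ → τ ≤ t → f τ ≤ C) :
    ∫ τ in Ioc s t, f τ ∂(clock a b) ≤ (t - s) * C := by
  calc ∫ τ in Ioc s t, f τ ∂(clock a b) ≤ ∫ _ in Ioc s t, C ∂(clock a b) :=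
        setIntegral_mono_on hf (integrable_const _) measurableSet_Ioc
          fun τ hτ => hC τ hτ.1.le hτ.2
    _ = _ := by rw [setIntegral_const, clock_real_Ioc h, smul_eq_mul]

/-- A right-continuous measurable process is jointly measurable: it is the limit of the processes
frozen at the next point of a grid of mesh `1/(n+1)`. -/
theorem measurable_uncurry_of_rightContinuous {d : ℕ} {Ω : Type*} [MeasurableSpace Ω]
    {Y : Icc a b → Ω → State d} (hY : ∀ τ, Measurable (Y τ))
    (hc : ∀ ω τ, ContinuousWithinAt (fun τ => Y τ ω) (Ici τ) τ) :
    Measurable (fun p : Icc a b × Ω => Y p.1 p.2) := by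
  by_cases hab : a ≤ b
  swap
  · have : IsEmpty (Icc a b) := ⟨fun x => hab (x.2.1.trans x.2.2)⟩
    exact measurable_of_empty _
  let G : ℕ → ℤ → Icc a b := fun n j => projIcc a b hab (((j : ℝ) + 1) / (n + 1))
  let g : ℕ → Icc a b → Icc a b := fun n τ => G n ⌊((n : ℝ) + 1) * τ⌋
  have hpos : ∀ n : ℕ, (0 : ℝ) < n + 1 := fun n => by positivity
  have hlow : ∀ (n : ℕ) (τ : Icc a b), (τ : ℝ) ≤ ((⌊((n : ℝ) + 1) * τ⌋ : ℝ) + 1) / (n + 1) := by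
    intro n τ
    rw [le_div_iff₀ (hpos n), mul_comm]
    exact (Int.lt_floor_add_one _).le
  have hhigh : ∀ (n : ℕ) (τ : Icc a b), ((⌊((n : ℝ) + 1) * τ⌋ : ℝ) + 1) / (n + 1)
      ≤ τ + 1 / ((n : ℝ) + 1) := by
    intro n τ
    have : ((τ : ℝ) + 1 / ((n : ℝ) + 1)) * (n + 1) = ((n : ℝ) + 1) * τ + 1 := by
      rw [add_mul, div_mul_cancel₀ _ (hpos n).ne', mul_comm (τ : ℝ)]
    rw [div_le_iff₀ (hpos n), this]
    linarith [Int.floor_le (((n : ℝ) + 1) * τ)]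
  have hg_ge : ∀ n τ, τ ≤ g n τ := by
    intro n τ
    calc τ = projIcc a b hab τ := (projIcc_val hab τ).symm
      _ ≤ g n τ := monotone_projIcc hab (hlow n τ)
  have hg_lim : ∀ τ, Tendsto (fun n => g n τ) atTop (𝓝[≥] τ) := by
    intro τ
    refine tendsto_nhdsWithin_iff.2 ⟨?_, Eventually.of_forall fun n => hg_ge n τ⟩
    have h1 : Tendsto (fun n : ℕ => ((⌊((n : ℝ) + 1) * τ⌋ : ℝ) + 1) / (n + 1)) atTop
        (𝓝 (τ : ℝ)) := by
      refine tendsto_of_tendsto_of_tendsto_of_le_of_le tendsto_const_nhds ?_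
        (fun n => hlow n τ) (fun n => hhigh n τ)
      simpa using tendsto_const_nhds.add (tendsto_one_div_add_atTop_nhds_zero_nat (𝕜 := ℝ))
    have h2 := ((continuous_projIcc (h := hab)).tendsto (τ : ℝ)).comp h1
    rw [projIcc_val] at h2
    exact h2
  refine measurable_of_tendsto_metrizable (f := fun n (p : Icc a b × Ω) => Y (g n p.1) p.2)
    (fun n => ?_) (tendsto_pi_nhds.2 fun p => (hc p.2 p.1).tendsto.comp (hg_lim p.1))
  · have h1 : Measurable (fun q : ℤ × Ω => Y (G n q.1) q.2) :=
      measurable_from_prod_countable_right fun j => hY (G n j)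
    have h2 : Measurable (fun p : Icc a b × Ω => (⌊((n : ℝ) + 1) * (p.1 : ℝ)⌋, p.2)) :=
      (Int.measurable_floor.comp (by fun_prop)).prodMk measurable_snd
    have h3 := h1.comp h2
    exact h3

end Clock

/-! ### Processes characterized by the martingale problem for quadratic functions -/

/-- The process `Y` solves the martingale problem with characteristics `S` and `B` on the quadratic
test functions `‖· - p‖²`: for every `p`, `‖Y(s) - p‖² - ∫ (S + 2⟨B, Y - p⟩) dτ` is a martingale.
Here `S`, the rate of quadratic variation, and `B`, the drift, are bounded by `M₀`, `M₁`; of their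
measurability only the time integrability of these integrands along almost every path is kept. -/
structure IsQuadraticSolution {d : ℕ} {a b : ℝ} {Ω : Type*} {m : MeasurableSpace Ω}
    (𝓕 : Filtration (Icc a b) m) (P : Measure Ω) (Y : Icc a b → Ω → State d)
    (S : Icc a b → Ω → ℝ) (B : Icc a b → Ω → State d) (M₀ M₁ : ℝ) : Prop where
  adapted : Adapted 𝓕 Y
  rightCont : ∀ ω τ, ContinuousWithinAt (fun τ => Y τ ω) (Ici τ) τ
  abs_le : ∀ τ ω, |S τ ω| ≤ M₀
  norm_le : ∀ τ ω, ‖B τ ω‖ ≤ M₁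
  pathIntegrable : ∀ p, ∀ᵐ ω ∂P,
    Integrable (fun τ => S τ ω + 2 * inner ℝ (B τ ω) (Y τ ω - p)) (clock a b)
  martingale : ∀ p, Martingale (fun s ω => ‖Y s ω - p‖ ^ 2
    - ∫ τ in Iic s, (S τ ω + 2 * inner ℝ (B τ ω) (Y τ ω - p)) ∂(clock a b)) 𝓕 P

theorem MeasureTheory.Martingale.integral_abs_mono {ι Ω : Type*} [Preorder ι]
    {m : MeasurableSpace Ω} {P : Measure Ω} {𝓕 : Filtration ι m} {N : ι → Ω → ℝ}
    (hN : Martingale N 𝓕 P) {s t : ι} (hst : s ≤ t) : ∫ ω, |N s ω| ∂P ≤ ∫ ω, |N t ω| ∂P := by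
  have h : ∫ ω, |(P[N t | 𝓕 s]) ω| ∂P = ∫ ω, |N s ω| ∂P :=
    integral_congr_ae ((hN.condExp_ae_eq hst).fun_comp (fun x => |x|))
  rw [← h]
  exact integral_abs_condExp_le _

theorem norm_le_sum_abs_inner {d : ℕ} (x : State d) :
    ‖x‖ ≤ ∑ j, |inner ℝ x (EuclideanSpace.basisFun (Fin d) ℝ j)| := by
  conv_lhs => rw [← (EuclideanSpace.basisFun (Fin d) ℝ).sum_repr' x]
  refine (norm_sum_le _ _).trans (Finset.sum_le_sum fun j _ => ?_)
  rw [norm_smul, (EuclideanSpace.basisFun (Fin d) ℝ).orthonormal.1 j, mul_one, Real.norm_eq_abs,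
    real_inner_comm]

theorem integrable_of_inner_basis {d : ℕ} {α : Type*} [MeasurableSpace α] {μ : Measure α}
    {f : α → State d}
    (h : ∀ j, Integrable (fun x => inner ℝ (f x) (EuclideanSpace.basisFun (Fin d) ℝ j)) μ) :
    Integrable f μ := by
  have : f = fun x => ∑ j, inner ℝ (f x) (EuclideanSpace.basisFun (Fin d) ℝ j) •
      EuclideanSpace.basisFun (Fin d) ℝ j := by
    funext x
    conv_lhs => rw [← (EuclideanSpace.basisFun (Fin d) ℝ).sum_repr' (f x)]
    simp only [real_inner_comm]
  rw [this]
  exact integrable_finsetSum _ fun j _ => (h j).smul_const _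

namespace IsQuadraticSolution

variable {d : ℕ} {a b : ℝ} {Ω : Type*} {m : MeasurableSpace Ω} {𝓕 : Filtration (Icc a b) m}
  {P : Measure Ω} {Y : Icc a b → Ω → State d} {S : Icc a b → Ω → ℝ}
  {B : Icc a b → Ω → State d} {M₀ M₁ : ℝ}

theorem measurable (h : IsQuadraticSolution 𝓕 P Y S B M₀ M₁) (τ : Icc a b) : Measurable (Y τ) :=
  (h.adapted τ).mono (𝓕.le τ) le_rfl

theorem measurable_uncurry (h : IsQuadraticSolution 𝓕 P Y S B M₀ M₁) :
    Measurable (fun p : Icc a b × Ω => Y p.1 p.2) :=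
  measurable_uncurry_of_rightContinuous h.measurable h.rightCont

theorem ae_integrable_inner_drift (h : IsQuadraticSolution 𝓕 P Y S B M₀ M₁) (p : State d) :
    ∀ᵐ ω ∂P, Integrable (fun τ => inner ℝ (B τ ω) p) (clock a b) := by
  filter_upwards [h.pathIntegrable 0, h.pathIntegrable p] with ω h0 hp
  refine ((h0.sub hp).const_mul (1 / 2)).congr (ae_of_all _ fun τ => ?_)
  simp only [Pi.sub_apply, inner_sub_right, inner_zero_right]
  ring

theorem ae_integrable_drift (h : IsQuadraticSolution 𝓕 P Y S B M₀ M₁) :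
    ∀ᵐ ω ∂P, Integrable (fun τ => B τ ω) (clock a b) := by
  filter_upwards [ae_all_iff.2 fun j =>
    h.ae_integrable_inner_drift (EuclideanSpace.basisFun (Fin d) ℝ j)] with ω hω
  exact integrable_of_inner_basis hω

variable [IsProbabilityMeasure P]

theorem nonneg₀ (h : IsQuadraticSolution 𝓕 P Y S B M₀ M₁) (τ : Icc a b) : 0 ≤ M₀ := by
  obtain ⟨ω⟩ := P.nonempty_of_neZero
  exact (abs_nonneg _).trans (h.abs_le τ ω)

theorem nonneg₁ (h : IsQuadraticSolution 𝓕 P Y S B M₀ M₁) (τ : Icc a b) : 0 ≤ M₁ := by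
  obtain ⟨ω⟩ := P.nonempty_of_neZero
  exact (norm_nonneg _).trans (h.norm_le τ ω)

/-- Polarization: the difference of the martingales of `‖·‖²` and `‖· - p‖²` is the martingale of a
linear function. -/
theorem exists_linear_martingale (h : IsQuadraticSolution 𝓕 P Y S B M₀ M₁) (p : State d) :
    ∃ N : Icc a b → Ω → ℝ, Martingale N 𝓕 P ∧ ∀ᵐ ω ∂P, ∀ s,
      N s ω = inner ℝ (Y s ω) p - ∫ τ in Iic s, inner ℝ (B τ ω) p ∂(clock a b) := by
  refine ⟨_, (((h.martingale 0).sub (h.martingale p)).add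
    (martingale_const 𝓕 P (‖p‖ ^ 2))).smul (1 / 2), ?_⟩
  filter_upwards [h.pathIntegrable 0, h.pathIntegrable p] with ω h0 hp s
  have e : ∫ τ in Iic s, inner ℝ (B τ ω) p ∂(clock a b)
      = (1 / 2) * (∫ τ in Iic s, (S τ ω + 2 * inner ℝ (B τ ω) (Y τ ω - 0)) ∂(clock a b)
        - ∫ τ in Iic s, (S τ ω + 2 * inner ℝ (B τ ω) (Y τ ω - p)) ∂(clock a b)) := by
    rw [← integral_sub h0.integrableOn hp.integrableOn, ← integral_const_mul]
    congr 1
    ext τ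
    simp only [inner_sub_right, inner_zero_right]
    ring
  rw [e]
  simp only [Pi.smul_apply, Pi.add_apply, Pi.sub_apply, smul_eq_mul]
  rw [norm_sub_sq_real (Y s ω) p, sub_zero]
  ring

theorem abs_setIntegral_inner_drift_le (h : IsQuadraticSolution 𝓕 P Y S B M₀ M₁) (p : State d)
    (ω : Ω) (s : Icc a b) :
    |∫ τ in Iic s, inner ℝ (B τ ω) p ∂(clock a b)| ≤ M₁ * ‖p‖ * (b - a) := by
  have hab : a ≤ b := s.2.1.trans s.2.2
  have hM := h.nonneg₁ s
  rw [← Real.norm_eq_abs]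
  refine (norm_setIntegral_le_of_norm_le_const (C := M₁ * ‖p‖) (measure_lt_top _ _)
    fun τ _ => (norm_inner_le_norm _ _).trans
      (mul_le_mul_of_nonneg_right (h.norm_le τ ω) (norm_nonneg _))).trans ?_
  gcongr
  calc (clock a b).real (Iic s) ≤ (clock a b).real univ := measureReal_mono (subset_univ _)
    _ = b - a := by
      rw [measureReal_def, clock_univ, ENNReal.toReal_ofReal (sub_nonneg.2 hab)]

theorem integrable_inner (h : IsQuadraticSolution 𝓕 P Y S B M₀ M₁) (p : State d) :
    ∃ C, ∀ s, Integrable (fun ω => inner ℝ (Y s ω) p) P ∧ ∫ ω, |inner ℝ (Y s ω) p| ∂P ≤ C := by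
  by_cases hab : a ≤ b
  swap
  · exact ⟨0, fun s => (hab (s.2.1.trans s.2.2)).elim⟩
  obtain ⟨N, hN, hNe⟩ := h.exists_linear_martingale p
  have hle : ∀ s, ∀ᵐ ω ∂P, |inner ℝ (Y s ω) p| ≤ |N s ω| + M₁ * ‖p‖ * (b - a) := by
    intro s
    filter_upwards [hNe] with ω hω
    have h1 := h.abs_setIntegral_inner_drift_le p ω s
    have h2 : inner ℝ (Y s ω) p = N s ω + ∫ τ in Iic s, inner ℝ (B τ ω) p ∂(clock a b) := by
      rw [hω s]; ring
    rw [h2]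
    exact (abs_add_le _ _).trans (by linarith)
  have hmaj : ∀ s, Integrable (fun ω => |N s ω| + M₁ * ‖p‖ * (b - a)) P := fun s =>
    (hN.integrable s).abs.add (integrable_const _)
  have hint : ∀ s, Integrable (fun ω => inner ℝ (Y s ω) p) P := fun s =>
    (hmaj s).mono' ((h.measurable s).inner_const (c := p)).aestronglyMeasurable
      (by simpa using hle s)
  refine ⟨∫ ω, |N ⟨b, right_mem_Icc.2 hab⟩ ω| ∂P + M₁ * ‖p‖ * (b - a), fun s => ⟨hint s, ?_⟩⟩
  calc ∫ ω, |inner ℝ (Y s ω) p| ∂P ≤ ∫ ω, (|N s ω| + M₁ * ‖p‖ * (b - a)) ∂P :=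
        integral_mono_ae (hint s).abs (hmaj s) (hle s)
    _ = ∫ ω, |N s ω| ∂P + M₁ * ‖p‖ * (b - a) := by
        rw [integral_add (hN.integrable s).abs (integrable_const _)]; simp
    _ ≤ _ := add_le_add (hN.integral_abs_mono s.2.2) le_rfl

theorem integrable_norm (h : IsQuadraticSolution 𝓕 P Y S B M₀ M₁) :
    ∃ C, ∀ s, Integrable (Y s) P ∧ ∫ ω, ‖Y s ω‖ ∂P ≤ C := by
  choose C hC using fun j => h.integrable_inner (EuclideanSpace.basisFun (Fin d) ℝ j)
  refine ⟨∑ j, C j, fun s => ?_⟩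
  have hi : Integrable (Y s) P := integrable_of_inner_basis fun j => (hC j s).1
  refine ⟨hi, ?_⟩
  calc ∫ ω, ‖Y s ω‖ ∂P
      ≤ ∫ ω, ∑ j, |inner ℝ (Y s ω) (EuclideanSpace.basisFun (Fin d) ℝ j)| ∂P :=
        integral_mono hi.norm (integrable_finsetSum _ fun j _ => (hC j s).1.abs)
          fun ω => norm_le_sum_abs_inner _
    _ = ∑ j, ∫ ω, |inner ℝ (Y s ω) (EuclideanSpace.basisFun (Fin d) ℝ j)| ∂P :=
        integral_finsetSum _ fun j _ => (hC j s).1.abs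
    _ ≤ _ := Finset.sum_le_sum fun j _ => (hC j s).2

theorem integrable_prod (h : IsQuadraticSolution 𝓕 P Y S B M₀ M₁) :
    Integrable (fun p : Icc a b × Ω => Y p.1 p.2) ((clock a b).prod P) := by
  obtain ⟨C, hC⟩ := h.integrable_norm
  refine (integrable_prod_iff h.measurable_uncurry.aestronglyMeasurable).2
    ⟨ae_of_all _ fun s => (hC s).1, ?_⟩
  refine Integrable.of_bound (C := C) ?_ (ae_of_all _ fun s => ?_)
  · exact (h.measurable_uncurry.norm.stronglyMeasurable.integral_prod_right').aestronglyMeasurable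
  · rw [Real.norm_of_nonneg (integral_nonneg fun _ => norm_nonneg _)]
    exact (hC s).2

/-- Square integrability, uniformly in time. -/
theorem integrable_norm_sq (h : IsQuadraticSolution 𝓕 P Y S B M₀ M₁) :
    ∃ C, ∀ s, Integrable (fun ω => ‖Y s ω‖ ^ 2) P ∧ ∫ ω, ‖Y s ω‖ ^ 2 ∂P ≤ C := by
  by_cases hab : a ≤ b
  swap
  · exact ⟨0, fun s => (hab (s.2.1.trans s.2.2)).elim⟩
  let t₁ : Icc a b := ⟨b, right_mem_Icc.2 hab⟩
  have hM₀ := h.nonneg₀ t₁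
  have hM₁ := h.nonneg₁ t₁
  obtain ⟨N, hN, hNe⟩ : ∃ N : Icc a b → Ω → ℝ, Martingale N 𝓕 P ∧ ∀ s ω, ‖Y s ω‖ ^ 2 = N s ω
      + ∫ τ in Iic s, (S τ ω + 2 * inner ℝ (B τ ω) (Y τ ω - 0)) ∂(clock a b) :=
    ⟨_, h.martingale 0, fun s ω => by simp⟩
  have hprod := h.integrable_prod.norm
  have hJ : Integrable (fun ω => ∫ τ, (M₀ + 2 * M₁ * ‖Y τ ω‖) ∂(clock a b)) P :=
    Integrable.integral_prod_right ((integrable_const M₀).add (hprod.const_mul (2 * M₁)))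
  have hle : ∀ s, ∀ᵐ ω ∂P, ‖Y s ω‖ ^ 2
      ≤ |N s ω| + ∫ τ, (M₀ + 2 * M₁ * ‖Y τ ω‖) ∂(clock a b) := by
    intro s
    filter_upwards [hprod.prod_left_ae] with ω hω
    have hmaj : Integrable (fun τ => M₀ + 2 * M₁ * ‖Y τ ω‖) (clock a b) :=
      (integrable_const _).add (hω.const_mul _)
    rw [hNe s ω]
    refine add_le_add (le_abs_self _) ?_
    calc ∫ τ in Iic s, (S τ ω + 2 * inner ℝ (B τ ω) (Y τ ω - 0)) ∂(clock a b)
        ≤ ‖∫ τ in Iic s, (S τ ω + 2 * inner ℝ (B τ ω) (Y τ ω - 0)) ∂(clock a b)‖ :=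
          le_abs_self _
      _ ≤ ∫ τ in Iic s, (M₀ + 2 * M₁ * ‖Y τ ω‖) ∂(clock a b) := by
          refine norm_integral_le_of_norm_le hmaj.integrableOn (ae_of_all _ fun τ => ?_)
          rw [sub_zero, Real.norm_eq_abs]
          have h1 := h.abs_le τ ω
          have h2 : |inner ℝ (B τ ω) (Y τ ω)| ≤ M₁ * ‖Y τ ω‖ :=
            (abs_real_inner_le_norm _ _).trans
              (mul_le_mul_of_nonneg_right (h.norm_le τ ω) (norm_nonneg _))
          calc |S τ ω + 2 * inner ℝ (B τ ω) (Y τ ω)|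
              ≤ |S τ ω| + |2 * inner ℝ (B τ ω) (Y τ ω)| := abs_add_le _ _
            _ ≤ _ := by rw [abs_mul, abs_two]; linarith
      _ ≤ _ := setIntegral_le_integral hmaj (ae_of_all _ fun τ => by positivity)
  have hmaj : ∀ s, Integrable
      (fun ω => |N s ω| + ∫ τ, (M₀ + 2 * M₁ * ‖Y τ ω‖) ∂(clock a b)) P :=
    fun s => (hN.integrable s).abs.add hJ
  have hint : ∀ s, Integrable (fun ω => ‖Y s ω‖ ^ 2) P := fun s =>
    (hmaj s).mono' ((h.measurable s).norm.pow_const 2).aestronglyMeasurable (by simpa using hle s)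
  refine ⟨∫ ω, |N t₁ ω| ∂P + ∫ ω, ∫ τ, (M₀ + 2 * M₁ * ‖Y τ ω‖) ∂(clock a b) ∂P,
    fun s => ⟨hint s, ?_⟩⟩
  calc ∫ ω, ‖Y s ω‖ ^ 2 ∂P
      ≤ ∫ ω, (|N s ω| + ∫ τ, (M₀ + 2 * M₁ * ‖Y τ ω‖) ∂(clock a b)) ∂P :=
        integral_mono_ae (hint s) (hmaj s) (hle s)
    _ = ∫ ω, |N s ω| ∂P + ∫ ω, ∫ τ, (M₀ + 2 * M₁ * ‖Y τ ω‖) ∂(clock a b) ∂P :=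
        integral_add (hN.integrable s).abs hJ
    _ ≤ _ := add_le_add (hN.integral_abs_mono s.2.2) le_rfl

theorem memLp (h : IsQuadraticSolution 𝓕 P Y S B M₀ M₁) (s : Icc a b) : MemLp (Y s) 2 P := by
  obtain ⟨C, hC⟩ := h.integrable_norm_sq
  exact (memLp_two_iff_integrable_sq_norm (h.measurable s).aestronglyMeasurable).2 (hC s).1

end IsQuadraticSolution

/-! ### Increments of a solution -/

/-- Martingale increments are orthogonal to the past. -/
theorem MeasureTheory.Martingale.integral_mul_sub_eq_zero {ι Ω : Type*} [Preorder ι]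
    {m : MeasurableSpace Ω} {P : Measure Ω} [IsFiniteMeasure P] {𝓕 : Filtration ι m}
    {N : ι → Ω → ℝ} (hN : Martingale N 𝓕 P) {s t : ι} (hst : s ≤ t) {W : Ω → ℝ}
    (hW : StronglyMeasurable[𝓕 s] W) (hi : Integrable (W * (N t - N s)) P) :
    ∫ ω, W ω * (N t ω - N s ω) ∂P = 0 := by
  have h0 : P[N t - N s | 𝓕 s] =ᵐ[P] 0 := by
    have h1 := condExp_sub (hN.integrable t) (hN.integrable s) (𝓕 s)
    filter_upwards [h1, hN.condExp_ae_eq hst, hN.condExp_ae_eq le_rfl (i := s)] with ω e1 e2 e3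
    rw [e1, Pi.sub_apply, e2, e3, sub_self, Pi.zero_apply]
  have h2 := condExp_mul_of_stronglyMeasurable_left hW hi
    ((hN.integrable t).sub (hN.integrable s))
  calc ∫ ω, W ω * (N t ω - N s ω) ∂P = ∫ ω, (P[W * (N t - N s) | 𝓕 s]) ω ∂P :=
        (integral_condExp (𝓕.le s)).symm
    _ = ∫ _, (0 : ℝ) ∂P := by
        refine integral_congr_ae ?_
        filter_upwards [h2, h0] with ω e1 e2
        rw [e1, Pi.mul_apply, e2, Pi.zero_apply, mul_zero]
    _ = 0 := integral_zero _ _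

theorem MeasureTheory.MemLp.integrable_real_inner {α E : Type*} [NormedAddCommGroup E]
    [InnerProductSpace ℝ E] [MeasurableSpace α] {μ : Measure α} {f g : α → E}
    (hf : MemLp f 2 μ) (hg : MemLp g 2 μ) : Integrable (fun x => inner ℝ (f x) (g x)) μ := by
  refine (hf.norm.integrable_mul hg.norm).mono' (hf.1.inner hg.1) (ae_of_all _ fun x => ?_)
  exact norm_inner_le_norm _ _

namespace IsQuadraticSolution

variable {d : ℕ} {a b : ℝ} {Ω : Type*} {m : MeasurableSpace Ω} {𝓕 : Filtration (Icc a b) m}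
  {P : Measure Ω} [IsProbabilityMeasure P] {Y : Icc a b → Ω → State d} {S : Icc a b → Ω → ℝ}
  {B : Icc a b → Ω → State d} {M₀ M₁ : ℝ}

theorem memLp_sub (h : IsQuadraticSolution 𝓕 P Y S B M₀ M₁) (s t : Icc a b) :
    MemLp (fun ω => Y t ω - Y s ω) 2 P := (h.memLp t).sub (h.memLp s)

theorem integrable_norm_sub_sq (h : IsQuadraticSolution 𝓕 P Y S B M₀ M₁) (s t : Icc a b) :
    Integrable (fun ω => ‖Y t ω - Y s ω‖ ^ 2) P := (h.memLp_sub s t).integrable_norm_pow two_ne_zero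

theorem exists_integral_norm_sub_sq_le (h : IsQuadraticSolution 𝓕 P Y S B M₀ M₁) :
    ∃ C, ∀ s t, ∫ ω, ‖Y t ω - Y s ω‖ ^ 2 ∂P ≤ C := by
  obtain ⟨C, hC⟩ := h.integrable_norm_sq
  refine ⟨2 * C + 2 * C, fun s t => ?_⟩
  calc ∫ ω, ‖Y t ω - Y s ω‖ ^ 2 ∂P ≤ ∫ ω, (2 * ‖Y t ω‖ ^ 2 + 2 * ‖Y s ω‖ ^ 2) ∂P := by
        refine integral_mono (h.integrable_norm_sub_sq s t)
          (((hC t).1.const_mul 2).add ((hC s).1.const_mul 2)) fun ω => ?_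
        have h1 := norm_sub_le (Y t ω) (Y s ω)
        have h2 := norm_nonneg (Y t ω - Y s ω)
        have h3 : ‖Y t ω - Y s ω‖ ^ 2 ≤ (‖Y t ω‖ + ‖Y s ω‖) ^ 2 := by gcongr
        exact h3.trans (by nlinarith [sq_nonneg (‖Y t ω‖ - ‖Y s ω‖)])
    _ = 2 * ∫ ω, ‖Y t ω‖ ^ 2 ∂P + 2 * ∫ ω, ‖Y s ω‖ ^ 2 ∂P := by
        rw [integral_add ((hC t).1.const_mul 2) ((hC s).1.const_mul 2), integral_const_mul,
          integral_const_mul]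
    _ ≤ _ := by linarith [(hC t).2, (hC s).2]

theorem integrable_prod_norm_sub_sq (h : IsQuadraticSolution 𝓕 P Y S B M₀ M₁) (s t : Icc a b) :
    Integrable (fun p : Icc a b × Ω => ‖Y p.1 p.2 - Y s p.2‖ ^ 2)
      (((clock a b).restrict (Ioc s t)).prod P) := by
  obtain ⟨C, hC⟩ := h.exists_integral_norm_sub_sq_le
  have hmeas : Measurable (fun p : Icc a b × Ω => ‖Y p.1 p.2 - Y s p.2‖ ^ 2) :=
    (h.measurable_uncurry.sub ((h.measurable s).comp measurable_snd)).norm.pow_const 2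
  refine (integrable_prod_iff hmeas.aestronglyMeasurable).2
    ⟨ae_of_all _ fun τ => h.integrable_norm_sub_sq s τ, ?_⟩
  refine Integrable.of_bound (C := C) ?_ (ae_of_all _ fun τ => ?_)
  · exact hmeas.norm.stronglyMeasurable.integral_prod_right'.aestronglyMeasurable
  · rw [Real.norm_of_nonneg (integral_nonneg fun _ => norm_nonneg _)]
    simpa using hC s τ

/-- Integration of a pathwise bound in terms of `∫ ‖Y(τ) - Y(s)‖² dτ`. -/
theorem integral_le_of_path_le (h : IsQuadraticSolution 𝓕 P Y S B M₀ M₁) {s t : Icc a b}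
    (hst : s ≤ t) {Φ Z : Ω → ℝ} (hΦ : Integrable Φ P) (hZ : Integrable Z P) {κ H : ℝ} (hκ : 0 ≤ κ)
    (hH : ∀ τ, s ≤ τ → τ ≤ t → ∫ ω, ‖Y τ ω - Y s ω‖ ^ 2 ∂P ≤ H)
    (hle : ∀ᵐ ω ∂P, IntegrableOn (fun τ => ‖Y τ ω - Y s ω‖ ^ 2) (Ioc s t) (clock a b) →
      Φ ω ≤ (t - s) * Z ω + κ * ∫ τ in Ioc s t, ‖Y τ ω - Y s ω‖ ^ 2 ∂(clock a b)) :
    ∫ ω, Φ ω ∂P ≤ (t - s) * (∫ ω, Z ω ∂P + κ * H) := by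
  have hp := h.integrable_prod_norm_sub_sq s t
  have hi : Integrable
      (fun ω => κ * ∫ τ in Ioc s t, ‖Y τ ω - Y s ω‖ ^ 2 ∂(clock a b)) P :=
    hp.integral_prod_right.const_mul κ
  calc ∫ ω, Φ ω ∂P
      ≤ ∫ ω, ((t - s) * Z ω + κ * ∫ τ in Ioc s t, ‖Y τ ω - Y s ω‖ ^ 2 ∂(clock a b)) ∂P := by
        refine integral_mono_ae hΦ ((hZ.const_mul _).add hi) ?_
        filter_upwards [hle, hp.prod_left_ae] with ω h1 h2
        exact h1 h2
    _ = (t - s) * ∫ ω, Z ω ∂P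
        + κ * ∫ τ in Ioc s t, ∫ ω, ‖Y τ ω - Y s ω‖ ^ 2 ∂P ∂(clock a b) := by
        rw [integral_add (hZ.const_mul _) hi, integral_const_mul, integral_const_mul,
          ← integral_integral_swap (f := fun τ ω => ‖Y τ ω - Y s ω‖ ^ 2) hp]
    _ ≤ (t - s) * ∫ ω, Z ω ∂P + κ * ((t - s) * H) := by
        gcongr
        exact setIntegral_Ioc_le hst hp.integral_prod_left hH
    _ = _ := by ring

/-- The drift identity `𝔼⟨W, Y(t) - Y(s)⟩ = 𝔼 ∫ ⟨W, B⟩ dτ` for `W` known at time `s`. -/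
theorem integral_inner_sub (h : IsQuadraticSolution 𝓕 P Y S B M₀ M₁) {s t : Icc a b}
    (hst : s ≤ t) {W : Ω → State d} (hW : Measurable[𝓕 s] W) (hW2 : MemLp W 2 P) :
    Integrable (fun ω => ∫ τ in Ioc s t, inner ℝ (W ω) (B τ ω) ∂(clock a b)) P ∧
      ∫ ω, inner ℝ (W ω) (Y t ω - Y s ω) ∂P
        = ∫ ω, ∫ τ in Ioc s t, inner ℝ (W ω) (B τ ω) ∂(clock a b) ∂P := by
  let e := EuclideanSpace.basisFun (Fin d) ℝ
  choose N hN hNe using fun j => h.exists_linear_martingale (e j)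
  have hD : ∀ j, ∀ᵐ ω ∂P, N j t ω - N j s ω = inner ℝ (Y t ω - Y s ω) (e j)
      - ∫ τ in Ioc s t, inner ℝ (B τ ω) (e j) ∂(clock a b) := by
    intro j
    filter_upwards [hNe j, h.ae_integrable_inner_drift (e j)] with ω h1 h2
    rw [h1, h1, ← setIntegral_Iic_sub h2 hst, inner_sub_left]
    ring
  have hDL : ∀ j, MemLp (fun ω => N j t ω - N j s ω) 2 P := by
    intro j
    have hm : MemLp (fun ω =>
        ‖Y t ω - Y s ω‖ + (M₁ * ‖e j‖ * (b - a) + M₁ * ‖e j‖ * (b - a))) 2 P :=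
      (h.memLp_sub s t).norm.add (memLp_const _)
    refine hm.mono' (((hN j).integrable t).sub ((hN j).integrable s)).aestronglyMeasurable ?_
    filter_upwards [hNe j] with ω h1
    have e1 : N j t ω - N j s ω = inner ℝ (Y t ω - Y s ω) (e j)
        - (∫ τ in Iic t, inner ℝ (B τ ω) (e j) ∂(clock a b)
        - ∫ τ in Iic s, inner ℝ (B τ ω) (e j) ∂(clock a b)) := by
      rw [h1, h1, inner_sub_left]; ring
    have e2 : ‖(inner ℝ (Y t ω - Y s ω) (e j) : ℝ)‖ ≤ ‖Y t ω - Y s ω‖ := by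
      simpa [e] using norm_inner_le_norm (𝕜 := ℝ) (Y t ω - Y s ω) (e j)
    rw [e1]
    refine (norm_sub_le _ _).trans (add_le_add e2 ((norm_sub_le _ _).trans (add_le_add ?_ ?_)))
    · exact h.abs_setIntegral_inner_drift_le _ _ _
    · exact h.abs_setIntegral_inner_drift_le _ _ _
  have hWj : ∀ j, MemLp (fun ω => inner ℝ (W ω) (e j)) 2 P := fun j => hW2.inner_const (e j)
  have hprod : ∀ j, Integrable (fun ω => inner ℝ (W ω) (e j) * (N j t ω - N j s ω)) P :=
    fun j => (hWj j).integrable_mul (hDL j)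
  have hzero : ∀ j, ∫ ω, inner ℝ (W ω) (e j) * (N j t ω - N j s ω) ∂P = 0 := fun j =>
    (hN j).integral_mul_sub_eq_zero hst
      (Measurable.stronglyMeasurable (hW.inner_const (c := e j))) (hprod j)
  have hsum : ∀ᵐ ω ∂P, ∫ τ in Ioc s t, inner ℝ (W ω) (B τ ω) ∂(clock a b)
      = inner ℝ (W ω) (Y t ω - Y s ω) - ∑ j, inner ℝ (W ω) (e j) * (N j t ω - N j s ω) := by
    filter_upwards [ae_all_iff.2 hD, h.ae_integrable_drift] with ω h1 h2
    have e1 : ∫ τ in Ioc s t, inner ℝ (W ω) (B τ ω) ∂(clock a b)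
        = ∑ j, inner ℝ (W ω) (e j) * ∫ τ in Ioc s t, inner ℝ (B τ ω) (e j) ∂(clock a b) := by
      simp only [← integral_const_mul]
      rw [← integral_finsetSum _ fun j _ => ((h2.inner_const (e j)).integrableOn.const_mul _)]
      refine integral_congr_ae (ae_of_all _ fun τ => ?_)
      simp only
      rw [← e.sum_inner_mul_inner (W ω) (B τ ω)]
      exact Finset.sum_congr rfl fun j _ => by rw [real_inner_comm (e j) (B τ ω)]
    rw [e1, ← e.sum_inner_mul_inner (W ω) (Y t ω - Y s ω), ← Finset.sum_sub_distrib]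
    refine Finset.sum_congr rfl fun j _ => ?_
    rw [h1 j, real_inner_comm (e j) (Y t ω - Y s ω)]
    ring
  have hI : Integrable (fun ω => inner ℝ (W ω) (Y t ω - Y s ω)) P :=
    hW2.integrable_real_inner (h.memLp_sub s t)
  have hS : Integrable (fun ω => ∑ j, inner ℝ (W ω) (e j) * (N j t ω - N j s ω)) P :=
    integrable_finsetSum _ fun j _ => hprod j
  refine ⟨(hI.sub hS).congr (hsum.mono fun ω hω => hω.symm), ?_⟩
  rw [integral_congr_ae hsum, integral_sub hI hS, integral_finsetSum _ fun j _ => hprod j]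
  simp [hzero]

/-- If the drift in the direction `W` is at most `Z` up to the displacement of `Y`, then so is the
mean increment of `Y` in that direction. -/
theorem two_mul_integral_inner_sub_le (h : IsQuadraticSolution 𝓕 P Y S B M₀ M₁) {s t : Icc a b}
    (hst : s ≤ t) {W : Ω → State d} (hW : Measurable[𝓕 s] W) (hW2 : MemLp W 2 P) {Z : Ω → ℝ}
    (hZ : Integrable Z P) {κ H : ℝ} (hκ : 0 ≤ κ)
    (hH : ∀ τ, s ≤ τ → τ ≤ t → ∫ ω, ‖Y τ ω - Y s ω‖ ^ 2 ∂P ≤ H)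
    (hle : ∀ ω τ, s ≤ τ → τ < t →
      2 * inner ℝ (W ω) (B τ ω) ≤ Z ω + κ * ‖Y τ ω - Y s ω‖ ^ 2) :
    2 * ∫ ω, inner ℝ (W ω) (Y t ω - Y s ω) ∂P ≤ (t - s) * (∫ ω, Z ω ∂P + κ * H) := by
  obtain ⟨h1, h2⟩ := h.integral_inner_sub hst hW hW2
  rw [h2, ← integral_const_mul]
  refine h.integral_le_of_path_le hst (h1.const_mul 2) hZ hκ hH ?_
  filter_upwards [h.ae_integrable_drift] with ω hB hY
  rw [← integral_const_mul, ← integral_const_mul]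
  have hc : ((t : ℝ) - s) * Z ω = ∫ _ in Ioc s t, Z ω ∂(clock a b) := by
    rw [setIntegral_const, clock_real_Ioc hst, smul_eq_mul]
  rw [hc, ← integral_add (integrable_const _) (hY.const_mul κ)]
  refine setIntegral_mono_on_ae ((hB.const_inner (W ω)).const_mul 2).integrableOn
    ((integrable_const _).add (hY.const_mul κ)) measurableSet_Ioc ?_
  -- The hypothesis excludes the right end point, which is a null set.
  filter_upwards [compl_mem_ae_iff.2 (measure_singleton t)] with τ hτ hm
  exact hle ω τ hm.1.le (lt_of_le_of_ne hm.2 hτ)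

theorem integral_norm_sub_sq_le_of_le (h : IsQuadraticSolution 𝓕 P Y S B M₀ M₁) {s t : Icc a b}
    (hst : s ≤ t) {κ H : ℝ} (hκ : 0 < κ)
    (hH : ∀ τ, s ≤ τ → τ ≤ t → ∫ ω, ‖Y τ ω - Y s ω‖ ^ 2 ∂P ≤ H) :
    ∫ ω, ‖Y t ω - Y s ω‖ ^ 2 ∂P ≤ (t - s) * (M₀ + M₁ ^ 2 / κ + κ * H) := by
  obtain ⟨h1, h2⟩ := h.integral_inner_sub hst (h.adapted s) (h.memLp s)
  have hM₁ := h.nonneg₁ s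
  obtain ⟨N, hN, hNe⟩ : ∃ N : Icc a b → Ω → ℝ, Martingale N 𝓕 P ∧ ∀ s ω, N s ω = ‖Y s ω‖ ^ 2
      - ∫ τ in Iic s, (S τ ω + 2 * inner ℝ (B τ ω) (Y τ ω - 0)) ∂(clock a b) :=
    ⟨_, h.martingale 0, fun s ω => by simp⟩
  have hI : Integrable (fun ω => inner ℝ (Y s ω) (Y t ω - Y s ω)) P :=
    (h.memLp s).integrable_real_inner (h.memLp_sub s t)
  have hN0 : ∫ ω, (N t ω - N s ω) ∂P = 0 := by
    have hs := hN.setIntegral_eq hst MeasurableSet.univ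
    rw [setIntegral_univ, setIntegral_univ] at hs
    rw [integral_sub (hN.integrable t) (hN.integrable s), ← hs, sub_self]
  have hΔ : Integrable (fun ω => ‖Y t ω - Y s ω‖ ^ 2 - (N t ω - N s ω)
      + 2 * (inner ℝ (Y s ω) (Y t ω - Y s ω)
        - ∫ τ in Ioc s t, inner ℝ (Y s ω) (B τ ω) ∂(clock a b))) P :=
    ((h.integrable_norm_sub_sq s t).sub ((hN.integrable t).sub (hN.integrable s))).add
      ((hI.sub h1).const_mul 2)
  have hΔe : ∫ ω, (‖Y t ω - Y s ω‖ ^ 2 - (N t ω - N s ω)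
      + 2 * (inner ℝ (Y s ω) (Y t ω - Y s ω)
        - ∫ τ in Ioc s t, inner ℝ (Y s ω) (B τ ω) ∂(clock a b))) ∂P
      = ∫ ω, ‖Y t ω - Y s ω‖ ^ 2 ∂P := by
    have hd : Integrable (fun ω => N t ω - N s ω) P := (hN.integrable t).sub (hN.integrable s)
    have hd' : Integrable (fun ω => 2 * (inner ℝ (Y s ω) (Y t ω - Y s ω)
        - ∫ τ in Ioc s t, inner ℝ (Y s ω) (B τ ω) ∂(clock a b))) P := (hI.sub h1).const_mul 2
    have hd'' : Integrable (fun ω => ‖Y t ω - Y s ω‖ ^ 2 - (N t ω - N s ω)) P :=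
      (h.integrable_norm_sub_sq s t).sub hd
    rw [integral_add hd'' hd', integral_sub (h.integrable_norm_sub_sq s t) hd,
      integral_const_mul, integral_sub hI h1, hN0, h2]
    ring
  rw [← hΔe]
  have hfin := h.integral_le_of_path_le hst hΔ (integrable_const (M₀ + M₁ ^ 2 / κ)) hκ.le hH ?_
  · simpa using hfin
  filter_upwards [h.ae_integrable_drift, h.pathIntegrable 0] with ω hB h0 hY
  have hYB : Integrable (fun τ => inner ℝ (Y s ω) (B τ ω)) (clock a b) := hB.const_inner _
  have hexp : ‖Y t ω - Y s ω‖ ^ 2 - (N t ω - N s ω)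
      + 2 * (inner ℝ (Y s ω) (Y t ω - Y s ω)
        - ∫ τ in Ioc s t, inner ℝ (Y s ω) (B τ ω) ∂(clock a b))
      = ∫ τ in Ioc s t, (S τ ω + 2 * inner ℝ (B τ ω) (Y τ ω - 0)
        - 2 * inner ℝ (Y s ω) (B τ ω)) ∂(clock a b) := by
    rw [integral_sub h0.integrableOn (hYB.const_mul 2).integrableOn, integral_const_mul,
      ← setIntegral_Iic_sub h0 hst, hNe, hNe, norm_sub_sq_real, inner_sub_right,
      real_inner_self_eq_norm_sq, real_inner_comm (Y s ω) (Y t ω)]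
    ring
  have hc : ((t : ℝ) - s) * (M₀ + M₁ ^ 2 / κ)
      = ∫ _ in Ioc s t, (M₀ + M₁ ^ 2 / κ) ∂(clock a b) := by
    rw [setIntegral_const, clock_real_Ioc hst, smul_eq_mul]
  rw [hexp, hc, ← integral_const_mul, ← integral_add (integrable_const _) (hY.const_mul κ)]
  refine setIntegral_mono_on ((h0.sub (hYB.const_mul 2)).integrableOn)
    ((integrable_const _).add (hY.const_mul κ)) measurableSet_Ioc fun τ _ => ?_
  have e1 : S τ ω + 2 * inner ℝ (B τ ω) (Y τ ω - 0) - 2 * inner ℝ (Y s ω) (B τ ω)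
      = S τ ω + 2 * inner ℝ (B τ ω) (Y τ ω - Y s ω) := by
    rw [sub_zero, inner_sub_right, real_inner_comm (B τ ω) (Y s ω)]; ring
  have e2 : inner ℝ (B τ ω) (Y τ ω - Y s ω) ≤ M₁ * ‖Y τ ω - Y s ω‖ :=
    (real_inner_le_norm _ _).trans (mul_le_mul_of_nonneg_right (h.norm_le τ ω) (norm_nonneg _))
  have e3 : 2 * (M₁ * ‖Y τ ω - Y s ω‖) ≤ M₁ ^ 2 / κ + κ * ‖Y τ ω - Y s ω‖ ^ 2 := by
    have : 0 ≤ (M₁ - κ * ‖Y τ ω - Y s ω‖) ^ 2 / κ := by positivity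
    have e4 : (M₁ - κ * ‖Y τ ω - Y s ω‖) ^ 2 / κ
        = M₁ ^ 2 / κ + κ * ‖Y τ ω - Y s ω‖ ^ 2 - 2 * (M₁ * ‖Y τ ω - Y s ω‖) := by
      field_simp
      ring
    linarith
  linarith [le_abs_self (S τ ω), h.abs_le τ ω]

end IsQuadraticSolution

/-- The constant in the bound `𝔼‖Y(t) - Y(s)‖² ≤ incrementConst · (t - s)` on a time interval of
length `ℓ`. -/
noncomputable def incrementConst (ℓ M₀ M₁ : ℝ) : ℝ := 2 * (M₀ + 2 * (ℓ + 1) * M₁ ^ 2)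

namespace IsQuadraticSolution

variable {d : ℕ} {a b : ℝ} {Ω : Type*} {m : MeasurableSpace Ω} {𝓕 : Filtration (Icc a b) m}
  {P : Measure Ω} [IsProbabilityMeasure P] {Y : Icc a b → Ω → State d} {S : Icc a b → Ω → ℝ}
  {B : Icc a b → Ω → State d} {M₀ M₁ : ℝ}

theorem integral_norm_sub_sq_le (h : IsQuadraticSolution 𝓕 P Y S B M₀ M₁) {s t : Icc a b}
    (hst : s ≤ t) :
    ∫ ω, ‖Y t ω - Y s ω‖ ^ 2 ∂P ≤ incrementConst (b - a) M₀ M₁ * (t - s) := by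
  have hM₀ := h.nonneg₀ s
  have hab : 0 ≤ b - a := sub_nonneg.2 (s.2.1.trans s.2.2)
  have hst' : (0 : ℝ) ≤ t - s := sub_nonneg.2 hst
  have hstab : (t : ℝ) - s ≤ b - a := by linarith [t.2.2, s.2.1]
  obtain ⟨C, hC⟩ := h.exists_integral_norm_sub_sq_le
  let H : ℝ := ⨆ τ : Icc s t, ∫ ω, ‖Y τ ω - Y s ω‖ ^ 2 ∂P
  have hbdd : BddAbove (range fun τ : Icc s t => ∫ ω, ‖Y τ ω - Y s ω‖ ^ 2 ∂P) :=
    ⟨C, by rintro _ ⟨τ, rfl⟩; exact hC s τ⟩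
  have hH : ∀ τ, s ≤ τ → τ ≤ t → ∫ ω, ‖Y τ ω - Y s ω‖ ^ 2 ∂P ≤ H :=
    fun τ h1 h2 => le_ciSup hbdd ⟨τ, h1, h2⟩
  have hH0 : 0 ≤ H := (integral_nonneg fun _ => by positivity).trans (hH t hst le_rfl)
  have hκ : 0 < 1 / (2 * (b - a + 1)) := by positivity
  have hne : Nonempty (Icc s t) := ⟨⟨s, le_rfl, hst⟩⟩
  -- The supremum over `[s,t]` is finite and bounds itself with a factor `1/2`.
  have key : H ≤ (t - s) * (M₀ + 2 * (b - a + 1) * M₁ ^ 2) + H / 2 := by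
    refine ciSup_le fun τ => ?_
    have h1 := h.integral_norm_sub_sq_le_of_le τ.2.1 hκ
      (fun σ h1 h2 => hH σ h1 (h2.trans τ.2.2))
    have hτ : ((τ : Icc a b) : ℝ) ≤ t := τ.2.2
    have hτ' : (s : ℝ) ≤ (τ : Icc a b) := τ.2.1
    refine h1.trans ?_
    have e1 : M₁ ^ 2 / (1 / (2 * (b - a + 1))) = 2 * (b - a + 1) * M₁ ^ 2 := by
      field_simp
    rw [e1, mul_add]
    refine add_le_add (by gcongr) ?_
    calc (((τ : Icc a b) : ℝ) - s) * (1 / (2 * (b - a + 1)) * H)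
        ≤ (b - a + 1) * (1 / (2 * (b - a + 1)) * H) :=
          mul_le_mul_of_nonneg_right (by linarith) (by positivity)
      _ = H / 2 := by field_simp
  have := hH t hst le_rfl
  unfold incrementConst
  linarith

theorem integral_norm_sub_sq_le_of_pos (h : IsQuadraticSolution 𝓕 P Y S B M₀ M₁) {s t : Icc a b}
    (hst : s ≤ t) {ε : ℝ} (hε : 0 < ε) :
    ∫ ω, ‖Y t ω - Y s ω‖ ^ 2 ∂P
      ≤ (t - s) * (M₀ + ε * M₁ ^ 2 + incrementConst (b - a) M₀ M₁ / ε * (t - s)) := by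
  have hM₀ := h.nonneg₀ s
  have hab : 0 ≤ b - a := sub_nonneg.2 (s.2.1.trans s.2.2)
  refine (h.integral_norm_sub_sq_le_of_le hst (κ := 1 / ε)
    (H := incrementConst (b - a) M₀ M₁ * (t - s)) (by positivity) fun τ h1 h2 => ?_).trans_eq ?_
  · refine (h.integral_norm_sub_sq_le h1).trans ?_
    have : ((τ : Icc a b) : ℝ) ≤ t := h2
    unfold incrementConst
    gcongr
  · field_simp

end IsQuadraticSolution

namespace IsQuadraticSolution

variable {d : ℕ} {a b : ℝ} {Ω : Type*} {m : MeasurableSpace Ω} {𝓕 : Filtration (Icc a b) m}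
  {P : Measure Ω} [IsProbabilityMeasure P] {Y : Icc a b → Ω → State d} {S : Icc a b → Ω → ℝ}
  {B : Icc a b → Ω → State d} {M₀ M₁ : ℝ}

/-- One step of the extremal shift for a single process: the drift in the direction `W` is at most
`Z/2` up to the modulus of continuity `√ε + K‖Y(τ) - Y(s)‖` of the drift, whose contribution is
absorbed into `‖W‖²/2` and terms that are small with `ε` and `t - s`. -/
theorem integral_step_le (h : IsQuadraticSolution 𝓕 P Y S B M₀ M₁) {s t : Icc a b}
    (hst : s ≤ t) {W : Ω → State d} (hW : Measurable[𝓕 s] W) (hW2 : MemLp W 2 P) {Z : Ω → ℝ}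
    (hZ : Integrable Z P) {ε K : ℝ} (hε : 0 < ε)
    (hle : ∀ ω τ, s ≤ τ → τ < t → 2 * inner ℝ (W ω) (B τ ω)
      ≤ Z ω + 2 * (‖W ω‖ * (√ε + K * ‖Y τ ω - Y s ω‖))) :
    2 * ∫ ω, inner ℝ (W ω) (Y t ω - Y s ω) ∂P + ∫ ω, ‖Y t ω - Y s ω‖ ^ 2 ∂P
      ≤ (t - s) * (∫ ω, Z ω ∂P + 1 / 2 * ∫ ω, ‖W ω‖ ^ 2 ∂P + (M₀ + ε * (4 + M₁ ^ 2)
        + incrementConst (b - a) M₀ M₁ * (4 * K ^ 2 + 1 / ε) * (t - s))) := by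
  have hM₀ := h.nonneg₀ s
  have hab : 0 ≤ b - a := sub_nonneg.2 (s.2.1.trans s.2.2)
  have hWsq : Integrable (fun ω => ‖W ω‖ ^ 2) P := hW2.integrable_norm_pow two_ne_zero
  have h1 := h.two_mul_integral_inner_sub_le hst hW hW2
    (Z := fun ω => Z ω + 1 / 2 * ‖W ω‖ ^ 2 + 4 * ε)
    ((hZ.add (hWsq.const_mul _)).add (integrable_const _)) (κ := 4 * K ^ 2)
    (H := incrementConst (b - a) M₀ M₁ * (t - s)) (by positivity) (fun τ h1 h2 => ?_)
    (fun ω τ h1 h2 => ?_)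
  · have h2 := h.integral_norm_sub_sq_le_of_pos hst hε
    have e : ∫ ω, (Z ω + 1 / 2 * ‖W ω‖ ^ 2 + 4 * ε) ∂P
        = ∫ ω, Z ω ∂P + 1 / 2 * ∫ ω, ‖W ω‖ ^ 2 ∂P + 4 * ε := by
      have hi : Integrable (fun ω => Z ω + 1 / 2 * ‖W ω‖ ^ 2) P := hZ.add (hWsq.const_mul _)
      rw [integral_add hi (integrable_const _), integral_add hZ (hWsq.const_mul _),
        integral_const_mul]
      simp
    rw [e] at h1
    refine (add_le_add h1 h2).trans_eq ?_
    ring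
  · refine (h.integral_norm_sub_sq_le h1).trans ?_
    have : ((τ : Icc a b) : ℝ) ≤ t := h2
    unfold incrementConst
    gcongr
  · have h3 := hle ω τ h1 h2
    have h4 := Real.sq_sqrt hε.le
    nlinarith [sq_nonneg (‖W ω‖ - 2 * (√ε + K * ‖Y τ ω - Y s ω‖)),
      sq_nonneg (√ε - K * ‖Y τ ω - Y s ω‖)]

end IsQuadraticSolution

/-! ### Disintegration along a conditional law -/

section Disintegration

variable {Ω E Γ : Type*} {mΩ : MeasurableSpace Ω} [mE : MeasurableSpace E]
  {mΓ : MeasurableSpace Γ} {P : Measure Ω} [IsProbabilityMeasure P] {X : Ω → E} {ϖ : Ω → Γ}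
  {κ : E → Measure Γ}

/-- The family `κ` is a version of the conditional law of `ϖ` given `X`. The measurability of
`x ↦ κ x` is not part of the definition. -/
def IsConditionalLaw (P : Measure Ω) (X : Ω → E) (ϖ : Ω → Γ) (κ : E → Measure Γ) : Prop :=
  ∀ ζ : Γ → ℝ, Measurable ζ → (∃ C, ∀ γ, |ζ γ| ≤ C) →
    P[fun ω => ζ (ϖ ω) | MeasurableSpace.comap X mE] =ᵐ[P] fun ω => ∫ γ, ζ γ ∂(κ (X ω))

theorem IsConditionalLaw.measure_prod (h : IsConditionalLaw P X ϖ κ) (hX : Measurable X)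
    (hϖ : Measurable ϖ) [∀ x, IsProbabilityMeasure (κ x)] {s : Set (E × Γ)}
    (hs : MeasurableSet s) :
    AEMeasurable (fun ω => κ (X ω) (Prod.mk (X ω) ⁻¹' s)) P ∧
      P ((fun ω => (X ω, ϖ ω)) ⁻¹' s) = ∫⁻ ω, κ (X ω) (Prod.mk (X ω) ⁻¹' s) ∂P := by
  have hpair : Measurable fun ω => (X ω, ϖ ω) := hX.prodMk hϖ
  induction s, hs using
    MeasurableSpace.induction_on_inter generateFrom_prod.symm isPiSystem_prod with
  | empty => simp
  | basic s hs =>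
    obtain ⟨A, hA, C, hC, rfl⟩ := hs
    have hA : MeasurableSet A := hA
    have hC : MeasurableSet C := hC
    have hζ : Measurable (C.indicator (1 : Γ → ℝ)) := measurable_one.indicator hC
    have hc := h _ hζ ⟨1, fun γ => by
      by_cases hγ : γ ∈ C <;> simp [hγ]⟩
    have hint : ∀ ω, ∫ γ, C.indicator (1 : Γ → ℝ) γ ∂(κ (X ω)) = (κ (X ω)).real C :=
      fun ω => integral_indicator_one hC
    simp only [hint] at hc
    have hreal : AEStronglyMeasurable (fun ω => (κ (X ω)).real C) P :=
      (stronglyMeasurable_condExp.mono hX.comap_le).aestronglyMeasurable.congr hc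
    have hκC : AEMeasurable (fun ω => κ (X ω) C) P := by
      refine hreal.aemeasurable.ennreal_ofReal.congr (ae_of_all _ fun ω => ?_)
      simp
    have hAX : MeasurableSet (X ⁻¹' A) := hX hA
    have hsec : ∀ ω, κ (X ω) (Prod.mk (X ω) ⁻¹' (A ×ˢ C))
        = (X ⁻¹' A).indicator (fun ω => κ (X ω) C) ω := by
      intro ω
      by_cases hω : X ω ∈ A
      · rw [indicator_of_mem (by exact hω), mk_preimage_prod_right hω]
      · rw [indicator_of_notMem (by exact hω), mk_preimage_prod_right_eq_empty hω, measure_empty]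
    simp only [hsec]
    refine ⟨hκC.indicator hAX, ?_⟩
    rw [lintegral_indicator hAX]
    have hbd : Integrable (fun ω => C.indicator (1 : Γ → ℝ) (ϖ ω)) P := by
      refine Integrable.of_bound (C := 1) (hζ.comp hϖ).aestronglyMeasurable
        (ae_of_all _ fun ω => ?_)
      by_cases hω : ϖ ω ∈ C <;> simp [hω]
    have e1 : ∫ ω in X ⁻¹' A, (κ (X ω)).real C ∂P
        = P.real ((fun ω => (X ω, ϖ ω)) ⁻¹' (A ×ˢ C)) := by
      calc ∫ ω in X ⁻¹' A, (κ (X ω)).real C ∂P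
          = ∫ ω in X ⁻¹' A,
            (P[fun ω => C.indicator (1 : Γ → ℝ) (ϖ ω) | MeasurableSpace.comap X mE]) ω ∂P :=
            (setIntegral_congr_ae hAX (hc.mono fun ω hω _ => hω)).symm
        _ = ∫ ω in X ⁻¹' A, C.indicator (1 : Γ → ℝ) (ϖ ω) ∂P :=
            setIntegral_condExp hX.comap_le hbd ⟨A, hA, rfl⟩
        _ = ∫ ω in X ⁻¹' A, (ϖ ⁻¹' C).indicator (1 : Ω → ℝ) ω ∂P := rfl
        _ = P.real ((fun ω => (X ω, ϖ ω)) ⁻¹' (A ×ˢ C)) := by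
            rw [integral_indicator_one (hϖ hC), measureReal_restrict_apply (hϖ hC), inter_comm]
            rfl
    have hint' : Integrable (fun ω => (κ (X ω)).real C) P :=
      Integrable.of_bound (C := 1) hreal (ae_of_all _ fun ω => by
        rw [Real.norm_of_nonneg measureReal_nonneg]; exact measureReal_le_one)
    calc P ((fun ω => (X ω, ϖ ω)) ⁻¹' (A ×ˢ C))
        = ENNReal.ofReal (∫ ω in X ⁻¹' A, (κ (X ω)).real C ∂P) := by
          rw [e1, ofReal_measureReal]
      _ = ∫⁻ ω in X ⁻¹' A, ENNReal.ofReal ((κ (X ω)).real C) ∂P :=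
          ofReal_integral_eq_lintegral_ofReal hint'.integrableOn
            (ae_of_all _ fun ω => measureReal_nonneg)
      _ = _ := by simp
  | compl s hs ih =>
    have e : ∀ ω, κ (X ω) (Prod.mk (X ω) ⁻¹' sᶜ) = 1 - κ (X ω) (Prod.mk (X ω) ⁻¹' s) := by
      intro ω
      rw [preimage_compl, prob_compl_eq_one_sub (measurable_prodMk_left hs)]
    simp only [e]
    refine ⟨aemeasurable_const.sub ih.1, ?_⟩
    rw [preimage_compl, prob_compl_eq_one_sub (hpair hs), ih.2, lintegral_sub' ih.1]
    · simp
    · rw [← ih.2]; exact measure_ne_top _ _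
    · exact ae_of_all _ fun ω => prob_le_one
  | iUnion f hd hm ih =>
    have e : ∀ ω, κ (X ω) (Prod.mk (X ω) ⁻¹' ⋃ i, f i)
        = ∑' i, κ (X ω) (Prod.mk (X ω) ⁻¹' f i) := by
      intro ω
      rw [preimage_iUnion, measure_iUnion (fun i j hij => (hd hij).preimage _)
        fun i => measurable_prodMk_left (hm i)]
    simp only [e]
    refine ⟨AEMeasurable.tsum fun i => (ih i).1, ?_⟩
    rw [preimage_iUnion, measure_iUnion (fun i j hij => (hd hij).preimage _)
        fun i => hpair (hm i), lintegral_tsum fun i => (ih i).1]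
    exact tsum_congr fun i => (ih i).2

theorem IsConditionalLaw.lintegral_prod (h : IsConditionalLaw P X ϖ κ) (hX : Measurable X)
    (hϖ : Measurable ϖ) [∀ x, IsProbabilityMeasure (κ x)] {F : E × Γ → ℝ≥0∞}
    (hF : Measurable F) :
    AEMeasurable (fun ω => ∫⁻ γ, F (X ω, γ) ∂(κ (X ω))) P ∧
      ∫⁻ ω, F (X ω, ϖ ω) ∂P = ∫⁻ ω, ∫⁻ γ, F (X ω, γ) ∂(κ (X ω)) ∂P := by
  have hpair : Measurable fun ω => (X ω, ϖ ω) := hX.prodMk hϖ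
  refine Measurable.ennreal_induction (motive := fun F : E × Γ → ℝ≥0∞ =>
    AEMeasurable (fun ω => ∫⁻ γ, F (X ω, γ) ∂(κ (X ω))) P ∧
      ∫⁻ ω, F (X ω, ϖ ω) ∂P = ∫⁻ ω, ∫⁻ γ, F (X ω, γ) ∂(κ (X ω)) ∂P) ?_ ?_ ?_ hF
  · intro c s hs
    obtain ⟨h1, h2⟩ := h.measure_prod hX hϖ hs
    have e : ∀ ω, ∫⁻ γ, s.indicator (fun _ => c) (X ω, γ) ∂(κ (X ω))
        = c * κ (X ω) (Prod.mk (X ω) ⁻¹' s) := by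
      intro ω
      rw [← lintegral_indicator_const (measurable_prodMk_left hs)]
      rfl
    simp only [e]
    refine ⟨h1.const_mul c, ?_⟩
    rw [lintegral_const_mul'' _ h1, ← h2, ← lintegral_indicator_const (hpair hs)]
    rfl
  · intro f g _ hf hg ihf ihg
    have e : ∀ ω, ∫⁻ γ, (f + g) (X ω, γ) ∂(κ (X ω))
        = ∫⁻ γ, f (X ω, γ) ∂(κ (X ω)) + ∫⁻ γ, g (X ω, γ) ∂(κ (X ω)) := fun ω =>
      lintegral_add_left (hf.comp measurable_prodMk_left) _
    simp only [e]
    refine ⟨ihf.1.add ihg.1, ?_⟩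
    rw [lintegral_add_left' ihf.1, ← ihf.2, ← ihg.2]
    exact lintegral_add_left (hf.comp hpair) _
  · intro f hf hmono ih
    have e : ∀ ω, ∫⁻ γ, ⨆ n, f n (X ω, γ) ∂(κ (X ω))
        = ⨆ n, ∫⁻ γ, f n (X ω, γ) ∂(κ (X ω)) := fun ω =>
      lintegral_iSup (fun n => (hf n).comp measurable_prodMk_left)
        fun i j hij γ => hmono hij _
    simp only [e]
    refine ⟨AEMeasurable.iSup fun n => (ih n).1, ?_⟩
    rw [lintegral_iSup (f := fun n ω => f n (X ω, ϖ ω)) (fun n => (hf n).comp hpair)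
        fun i j hij ω => hmono hij _,
      lintegral_iSup' (fun n => (ih n).1)
        (ae_of_all _ fun ω i j hij => lintegral_mono fun γ => hmono hij _)]
    exact iSup_congr fun n => (ih n).2

/-- A function whose conditional expectations are nonpositive has nonpositive expectation. -/
theorem IsConditionalLaw.integral_nonpos (h : IsConditionalLaw P X ϖ κ) (hX : Measurable X)
    (hϖ : Measurable ϖ) [∀ x, IsProbabilityMeasure (κ x)] {F : E × Γ → ℝ}
    (hF : Measurable F) (hi : Integrable (fun ω => F (X ω, ϖ ω)) P)
    (hle : ∀ᵐ ω ∂P, Integrable (fun γ => F (X ω, γ)) (κ (X ω)) ∧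
      ∫ γ, F (X ω, γ) ∂(κ (X ω)) ≤ 0) :
    ∫ ω, F (X ω, ϖ ω) ∂P ≤ 0 := by
  rw [integral_eq_lintegral_pos_part_sub_lintegral_neg_part hi, sub_nonpos]
  refine ENNReal.toReal_mono hi.neg.lintegral_lt_top.ne ?_
  rw [(h.lintegral_prod hX hϖ hF.ennreal_ofReal).2,
    (h.lintegral_prod hX hϖ (F := fun p => ENNReal.ofReal (-F p)) hF.neg.ennreal_ofReal).2]
  refine lintegral_mono_ae (hle.mono fun ω hω => ?_)
  obtain ⟨h1, h2⟩ := hω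
  rw [integral_eq_lintegral_pos_part_sub_lintegral_neg_part h1, sub_nonpos] at h2
  exact (ENNReal.toReal_le_toReal h1.lintegral_lt_top.ne h1.neg.lintegral_lt_top.ne).1 h2

/-- A uniform bound on the conditional second moments gives square integrability. -/
theorem IsConditionalLaw.memLp_two {H : Type*} [NormedAddCommGroup H] [MeasurableSpace H]
    [BorelSpace H] [SecondCountableTopology H] (h : IsConditionalLaw P X ϖ κ) (hX : Measurable X)
    (hϖ : Measurable ϖ) [∀ x, IsProbabilityMeasure (κ x)] {F : E × Γ → H} (hF : Measurable F)
    (C : ℝ) (hi : ∀ x, Integrable (fun γ => ‖F (x, γ)‖ ^ 2) (κ x))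
    (hC : ∀ x, ∫ γ, ‖F (x, γ)‖ ^ 2 ∂(κ x) ≤ C) :
    MemLp (fun ω => F (X ω, ϖ ω)) 2 P := by
  have hm : AEStronglyMeasurable (fun ω => F (X ω, ϖ ω)) P :=
    (hF.comp (hX.prodMk hϖ)).aestronglyMeasurable
  refine (memLp_two_iff_integrable_sq_norm hm).2 ⟨hm.norm.pow 2, ?_⟩
  have h1 := (h.lintegral_prod hX hϖ (hF.norm.pow_const 2).ennreal_ofReal).2
  rw [hasFiniteIntegral_iff_ofReal (ae_of_all _ fun ω => by positivity), h1]
  calc ∫⁻ ω, ∫⁻ γ, ENNReal.ofReal (‖F (X ω, γ)‖ ^ 2) ∂(κ (X ω)) ∂P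
      ≤ ∫⁻ _, ENNReal.ofReal C ∂P := by
        refine lintegral_mono fun ω => ?_
        rw [← ofReal_integral_eq_lintegral_ofReal (hi _) (ae_of_all _ fun γ => by positivity)]
        exact ENNReal.ofReal_le_ofReal (hC _)
    _ < ∞ := by simp

end Disintegration

/-! ### The value of the extremal shift -/

section Value

variable {d : ℕ} {U : Type uU} {V : Type uV}

theorem iInf_iSup_le_add [Nonempty U] [Nonempty V] {f f' : U → V → ℝ} {C e : ℝ}
    (hf : ∀ u v, |f u v| ≤ C) (hf' : ∀ u v, |f' u v| ≤ C) (h : ∀ u v, f u v ≤ f' u v + e) :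
    (⨅ u, ⨆ v, f u v) ≤ (⨅ u, ⨆ v, f' u v) + e := by
  obtain ⟨v₀⟩ := ‹Nonempty V›
  rw [← sub_le_iff_le_add]
  refine le_ciInf fun u => ?_
  rw [sub_le_iff_le_add]
  have hb : ∀ u, BddAbove (range (f u)) := fun u =>
    ⟨C, by rintro _ ⟨v, rfl⟩; exact (abs_le.1 (hf u v)).2⟩
  have hb' : BddAbove (range (f' u)) := ⟨C, by rintro _ ⟨v, rfl⟩; exact (abs_le.1 (hf' u v)).2⟩
  have hbelow : BddBelow (range fun u => ⨆ v, f u v) :=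
    ⟨-C, by rintro _ ⟨u, rfl⟩; exact (abs_le.1 (hf u v₀)).1.trans (le_ciSup (hb u) v₀)⟩
  refine (ciInf_le hbelow u).trans (ciSup_le fun v => ?_)
  linarith [h u v, le_ciSup hb' v]

theorem abs_iInf_iSup_le [Nonempty U] [Nonempty V] {f : U → V → ℝ} {C : ℝ}
    (hf : ∀ u v, |f u v| ≤ C) : |⨅ u, ⨆ v, f u v| ≤ C := by
  have hC : 0 ≤ C := (abs_nonneg _).trans (hf (Classical.arbitrary U) (Classical.arbitrary V))
  have h0 : ∀ (u : U) (v : V), |(0 : ℝ)| ≤ C := fun _ _ => by simpa using hC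
  have h1 := iInf_iSup_le_add (e := C) hf h0 fun u v => by
    simpa using (abs_le.1 (hf u v)).2
  have h2 := iInf_iSup_le_add (e := C) h0 hf fun u v => by linarith [(abs_le.1 (hf u v)).1]
  simp only [ciSup_const, ciInf_const] at h1 h2
  exact abs_le.2 ⟨by linarith, by linarith⟩

theorem continuous_iInf_iSup_inner [Nonempty U] [Nonempty V]
    {β : State d × State d → U → V → State d} {M K : ℝ} (hM : ∀ p u v, ‖β p u v‖ ≤ M)
    (hK : ∀ p q u v, ‖β p u v - β q u v‖ ≤ K * dist p q) :
    Continuous fun p : State d × State d => ⨅ u, ⨆ v, inner ℝ (p.1 - p.2) (β p u v) := by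
  have hC : ∀ (p : State d × State d) u v,
      |inner ℝ (p.1 - p.2) (β p u v)| ≤ ‖p.1 - p.2‖ * M := fun p u v =>
    (abs_real_inner_le_norm _ _).trans (mul_le_mul_of_nonneg_left (hM p u v) (norm_nonneg _))
  let e : State d × State d → State d × State d → ℝ := fun p q =>
    ‖(p.1 - p.2) - (q.1 - q.2)‖ * M + ‖q.1 - q.2‖ * (K * dist p q)
  have he : ∀ p q u v, |inner ℝ (p.1 - p.2) (β p u v) - inner ℝ (q.1 - q.2) (β q u v)| ≤ e p q := by
    intro p q u v
    have h1 : (inner ℝ (p.1 - p.2) (β p u v) - inner ℝ (q.1 - q.2) (β q u v) : ℝ)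
        = inner ℝ ((p.1 - p.2) - (q.1 - q.2)) (β p u v)
          + inner ℝ (q.1 - q.2) (β p u v - β q u v) := by
      simp only [inner_sub_left, inner_sub_right]; ring
    rw [h1]
    refine (abs_add_le _ _).trans (add_le_add ?_ ?_)
    · exact (abs_real_inner_le_norm _ _).trans
        (mul_le_mul_of_nonneg_left (hM p u v) (norm_nonneg _))
    · exact (abs_real_inner_le_norm _ _).trans
        (mul_le_mul_of_nonneg_left (hK p q u v) (norm_nonneg _))
  refine continuous_iff_continuousAt.2 fun q => ?_
  have hlim : Tendsto (fun p => e p q) (𝓝 q) (𝓝 0) := by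
    have : Continuous fun p => e p q := by fun_prop
    simpa [e] using this.tendsto q
  refine tendsto_iff_dist_tendsto_zero.2 (squeeze_zero (fun _ => dist_nonneg) (fun p => ?_) hlim)
  have hp : ∀ u v, |inner ℝ (p.1 - p.2) (β p u v)| ≤ max (‖p.1 - p.2‖ * M) (‖q.1 - q.2‖ * M) :=
    fun u v => (hC p u v).trans (le_max_left _ _)
  have hq : ∀ u v, |inner ℝ (q.1 - q.2) (β q u v)| ≤ max (‖p.1 - p.2‖ * M) (‖q.1 - q.2‖ * M) :=
    fun u v => (hC q u v).trans (le_max_right _ _)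
  rw [Real.dist_eq, abs_le]
  constructor
  · linarith [iInf_iSup_le_add hq hp (e := e p q) fun u v => by
      linarith [(abs_le.1 (he p q u v)).1]]
  · linarith [iInf_iSup_le_add hp hq (e := e p q) fun u v => by
      linarith [(abs_le.1 (he p q u v)).2]]

/-- The value `min_u max_v ϖ(t,z,ξ,u,v)` of the auxiliary one-shot game. -/
noncomputable def shiftValue (T : ℝ) (L₁ L₂ : Generator d U V) (t : ℝ) (z ξ : State d) : ℝ :=
  ⨅ u, ⨆ v, shiftFun T L₁ L₂ t z ξ u v

open Classical in
/-- The Lipschitz constant of the drift for which the Isaacs condition is used. -/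
noncomputable def isaacsLip (T : ℝ) (L₁ : Generator d U V) (K₁ K₂ : ℝ) : ℝ :=
  if L₁.Isaacs T then K₁ else K₂

open Classical in
/-- The share of the drift mismatch that is charged to the first player: none if the Isaacs
condition holds for `b¹`, all of it otherwise. -/
noncomputable def isaacsShare (T : ℝ) (L₁ : Generator d U V) : ℝ :=
  if L₁.Isaacs T then 0 else 1

variable [TopologicalSpace U] [TopologicalSpace V] {L₁ L₂ : Generator d U V}
  {T M₀₁ M₁₁ K₁ M₀₂ M₁₂ K₂ : ℝ}

theorem norm_drift_sub_sq_le (hL₁ : L₁.IsAdmissible T M₀₁ M₁₁ K₁)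
    (hL₂ : L₂.IsAdmissible T M₀₂ M₁₂ K₂) {t : ℝ} (ht : t ∈ Icc 0 T) (x : State d) (u : U) (v : V) :
    ‖L₁.drift t x u v - L₂.drift t x u v‖ ^ 2 ≤ driftMismatch T L₁ L₂ := by
  refine le_ciSup (f := fun p : Icc (0 : ℝ) T × State d × U × V =>
    ‖L₁.drift p.1 p.2.1 p.2.2.1 p.2.2.2 - L₂.drift p.1 p.2.1 p.2.2.1 p.2.2.2‖ ^ 2)
    ⟨(M₁₁ + M₁₂) ^ 2, ?_⟩ (⟨t, ht⟩, x, u, v)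
  rintro _ ⟨p, rfl⟩
  have := (norm_sub_le (L₁.drift p.1 p.2.1 p.2.2.1 p.2.2.2) (L₂.drift p.1 p.2.1 p.2.2.1 p.2.2.2))
  have h1 := hL₁.drift_le p.1 p.1.2 p.2.1 p.2.2.1 p.2.2.2
  have h2 := hL₂.drift_le p.1 p.1.2 p.2.1 p.2.2.1 p.2.2.2
  simp only
  gcongr
  linarith

theorem abs_shiftFun_le (hL₁ : L₁.IsAdmissible T M₀₁ M₁₁ K₁)
    (hL₂ : L₂.IsAdmissible T M₀₂ M₁₂ K₂) {t : ℝ} (ht : t ∈ Icc 0 T) (z ξ : State d) (u : U)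
    (v : V) : |shiftFun T L₁ L₂ t z ξ u v| ≤ ‖z - ξ‖ * max M₁₁ M₁₂ := by
  unfold shiftFun
  split_ifs
  · refine (abs_real_inner_le_norm _ _).trans (mul_le_mul_of_nonneg_left ?_ (norm_nonneg _))
    exact (hL₁.drift_le t ht z u v).trans (le_max_left _ _)
  · refine (abs_real_inner_le_norm _ _).trans (mul_le_mul_of_nonneg_left ?_ (norm_nonneg _))
    exact (hL₂.drift_le t ht ξ u v).trans (le_max_right _ _)

theorem inner_drift_sub_le (hL₁ : L₁.IsAdmissible T M₀₁ M₁₁ K₁)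
    (hL₂ : L₂.IsAdmissible T M₀₂ M₁₂ K₂) {t : ℝ} (ht : t ∈ Icc 0 T) (z ξ : State d) (u : U)
    (v : V) :
    inner ℝ (z - ξ) (L₁.drift t z u v) - inner ℝ (z - ξ) (L₂.drift t ξ u v)
      ≤ (isaacsLip T L₁ K₁ K₂ + 1 / 2) * ‖z - ξ‖ ^ 2 + 1 / 2 * driftMismatch T L₁ L₂ := by
  -- The Lipschitz bound is applied to the drift selected by `isaacsLip`, the mismatch at the
  -- argument that remains.
  have key : ∀ (x : State d) (K : ℝ) (y : State d), ‖y‖ ≤ K * ‖z - ξ‖ →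
      L₁.drift t z u v - L₂.drift t ξ u v = y + (L₁.drift t x u v - L₂.drift t x u v) →
      inner ℝ (z - ξ) (L₁.drift t z u v) - inner ℝ (z - ξ) (L₂.drift t ξ u v)
      ≤ (K + 1 / 2) * ‖z - ξ‖ ^ 2 + 1 / 2 * driftMismatch T L₁ L₂ := by
    intro x K y hy he
    rw [← inner_sub_right, he, inner_add_right]
    have h1 := real_inner_le_norm (z - ξ) y
    have h2 := real_inner_le_norm (z - ξ) (L₁.drift t x u v - L₂.drift t x u v)
    have h3 := norm_drift_sub_sq_le hL₁ hL₂ ht x u v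
    have h4 := mul_le_mul_of_nonneg_left hy (norm_nonneg (z - ξ))
    nlinarith [sq_nonneg (‖z - ξ‖ - ‖L₁.drift t x u v - L₂.drift t x u v‖)]
  unfold isaacsLip
  split_ifs
  · exact key ξ K₁ _ (hL₁.drift_lipschitz t ht z ξ u v) (by abel)
  · exact key z K₂ _ (hL₂.drift_lipschitz t ht z ξ u v) (by abel)

/-- An extremal control of the first player keeps the drift of the motion in the direction `z - ξ`
below the value. -/
theorem inner_drift_le_of_extremal (hL₁ : L₁.IsAdmissible T M₀₁ M₁₁ K₁)
    (hL₂ : L₂.IsAdmissible T M₀₂ M₁₂ K₂) {t : ℝ} (ht : t ∈ Icc 0 T) {z ξ : State d} {u : U}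
    (hu : (⨆ v, shiftFun T L₁ L₂ t z ξ u v) = shiftValue T L₁ L₂ t z ξ) (v : V) :
    inner ℝ (z - ξ) (L₁.drift t z u v) ≤ shiftValue T L₁ L₂ t z ξ + isaacsShare T L₁ *
      ((isaacsLip T L₁ K₁ K₂ + 1 / 2) * ‖z - ξ‖ ^ 2 + 1 / 2 * driftMismatch T L₁ L₂) := by
  have hb : BddAbove (range fun v => shiftFun T L₁ L₂ t z ξ u v) :=
    ⟨_, by rintro _ ⟨v, rfl⟩; exact (abs_le.1 (abs_shiftFun_le hL₁ hL₂ ht z ξ u v)).2⟩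
  have h1 : shiftFun T L₁ L₂ t z ξ u v ≤ shiftValue T L₁ L₂ t z ξ := hu ▸ le_ciSup hb v
  have h2 := inner_drift_sub_le hL₁ hL₂ ht z ξ u v
  unfold shiftFun at h1
  unfold isaacsShare
  split_ifs at h1 ⊢
  · simpa using h1
  · linarith

/-- An extremal control of the second player in the model keeps the drift of the model in the
direction `z - ξ` above the value: by the Isaacs condition the lower value is the upper one. -/
theorem le_inner_drift_of_extremal (hL₁ : L₁.IsAdmissible T M₀₁ M₁₁ K₁)
    (hL₂ : L₂.IsAdmissible T M₀₂ M₁₂ K₂) (hI : L₁.Isaacs T ∨ L₂.Isaacs T) {t : ℝ}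
    (ht : t ∈ Icc 0 T) {z ξ : State d} {v : V}
    (hv : (⨆ v', ⨅ u, shiftFun T L₁ L₂ t z ξ u v') = ⨅ u, shiftFun T L₁ L₂ t z ξ u v) (u : U) :
    shiftValue T L₁ L₂ t z ξ - (1 - isaacsShare T L₁) *
      ((isaacsLip T L₁ K₁ K₂ + 1 / 2) * ‖z - ξ‖ ^ 2 + 1 / 2 * driftMismatch T L₁ L₂)
      ≤ inner ℝ (z - ξ) (L₂.drift t ξ u v) := by
  have hb : BddBelow (range fun u => shiftFun T L₁ L₂ t z ξ u v) :=
    ⟨_, by rintro _ ⟨u, rfl⟩; exact (abs_le.1 (abs_shiftFun_le hL₁ hL₂ ht z ξ u v)).1⟩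
  have hval : shiftValue T L₁ L₂ t z ξ = ⨆ v', ⨅ u, shiftFun T L₁ L₂ t z ξ u v' := by
    unfold shiftValue shiftFun
    split_ifs with h
    · exact h t ht z (z - ξ)
    · exact (hI.resolve_left h) t ht ξ (z - ξ)
  have h1 : shiftValue T L₁ L₂ t z ξ ≤ shiftFun T L₁ L₂ t z ξ u v := by
    rw [hval, hv]; exact ciInf_le hb u
  have h2 := inner_drift_sub_le hL₁ hL₂ ht z ξ u v
  unfold shiftFun at h1
  unfold isaacsShare
  split_ifs at h1 ⊢
  · linarith
  · linarith

variable [Nonempty U] [Nonempty V]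

theorem abs_shiftValue_le (hL₁ : L₁.IsAdmissible T M₀₁ M₁₁ K₁)
    (hL₂ : L₂.IsAdmissible T M₀₂ M₁₂ K₂) {t : ℝ} (ht : t ∈ Icc 0 T) (z ξ : State d) :
    |shiftValue T L₁ L₂ t z ξ| ≤ ‖z - ξ‖ * max M₁₁ M₁₂ :=
  abs_iInf_iSup_le fun u v => abs_shiftFun_le hL₁ hL₂ ht z ξ u v

theorem continuous_shiftValue (hL₁ : L₁.IsAdmissible T M₀₁ M₁₁ K₁)
    (hL₂ : L₂.IsAdmissible T M₀₂ M₁₂ K₂) {t : ℝ} (ht : t ∈ Icc 0 T) :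
    Continuous fun p : State d × State d => shiftValue T L₁ L₂ t p.1 p.2 := by
  unfold shiftValue shiftFun
  split_ifs
  · refine continuous_iInf_iSup_inner (β := fun p u v => L₁.drift t p.1 u v) (M := M₁₁) (K := |K₁|)
      (fun p u v => hL₁.drift_le t ht p.1 u v) fun p q u v => ?_
    refine (hL₁.drift_lipschitz t ht p.1 q.1 u v).trans ?_
    rw [← dist_eq_norm]
    exact mul_le_mul (le_abs_self _) (le_max_left _ _) dist_nonneg (abs_nonneg _)
  · refine continuous_iInf_iSup_inner (β := fun p u v => L₂.drift t p.2 u v) (M := M₁₂) (K := |K₂|)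
      (fun p u v => hL₂.drift_le t ht p.2 u v) fun p q u v => ?_
    refine (hL₂.drift_lipschitz t ht p.2 q.2 u v).trans ?_
    rw [← dist_eq_norm]
    exact mul_le_mul (le_abs_self _) (le_max_right _ _) dist_nonneg (abs_nonneg _)

end Value

section Game

variable {d : ℕ} {U : Type uU} {V : Type uV} {D D₁ D₂ : Set (State d → ℝ)}
  {L L₁ L₂ : Generator d U V} {t₀ T : ℝ}

theorem Icc_mem_of_start (ht₀ : t₀ ∈ Icc 0 T) (τ : Icc t₀ T) : (τ : ℝ) ∈ Icc 0 T :=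
  ⟨ht₀.1.trans τ.2.1, τ.2.2⟩

variable [MeasurableSpace U]

section Measurability

variable [MeasurableSpace V]

/-! ### Measurability of the model along the motion -/

theorem measurable_into_pathSigma {Ω : Type*} {m : MeasurableSpace Ω} {X : Ω → SkorokhodPath d t₀ T}
    {s : Icc t₀ T} (h : ∀ r ≤ s, Measurable fun ω => (X ω).1 r) :
    Measurable[m, pathSigma d s] X := by
  rw [measurable_iff_comap_le, MeasurableSpace.comap_iSup]
  refine iSup_le fun r => ?_
  rw [MeasurableSpace.comap_comp]
  exact (h r.1 r.2).comap_le

theorem measurable_into_pathSigmaAll {Ω : Type*} {m : MeasurableSpace Ω}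
    {X : Ω → SkorokhodPath d t₀ T} (h : ∀ r, Measurable fun ω => (X ω).1 r) :
    Measurable[m, pathSigmaAll d t₀ T] X := by
  rw [measurable_iff_comap_le, MeasurableSpace.comap_iSup]
  refine iSup_le fun r => ?_
  rw [MeasurableSpace.comap_comp]
  exact (h r).comap_le

theorem pathSigma_le_pathSigmaAll (s : Icc t₀ T) : pathSigma d s ≤ pathSigmaAll d t₀ T :=
  iSup_le fun r => le_iSup (fun r : Icc t₀ T => MeasurableSpace.comap
    (fun x : SkorokhodPath d t₀ T => x.1 r) inferInstance) r.1

theorem measurable_eval (r : Icc t₀ T) :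
    Measurable[pathSigmaAll d t₀ T] fun x : SkorokhodPath d t₀ T => x.1 r :=
  Measurable.mono (comap_measurable _) (le_iSup (fun r : Icc t₀ T => MeasurableSpace.comap
    (fun x : SkorokhodPath d t₀ T => x.1 r) inferInstance) r) le_rfl

theorem Model.measurable_Y_all {c : ℝ → State d → ℝ} {Δ : TimePartition t₀ T}
    (M : Model.{uU, uV, w₁} D L₁ L₂ c Δ) (τ : Icc t₀ T) :
    Measurable[(pathSigmaAll d t₀ T).prod M.mΓ]
      (fun p : SkorokhodPath d t₀ T × M.Γ => M.Y p.1 τ p.2) :=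
  (M.measurable_Y τ).mono (sup_le_sup (MeasurableSpace.comap_mono (pathSigma_le_pathSigmaAll τ))
    (MeasurableSpace.comap_mono (M.𝓖.le τ))) le_rfl

theorem Realization.measurable_X {x₀ : State d} {𝔲 : Strategy.{w₁} d t₀ T U}
    {𝔳 : Strategy.{w₂} d t₀ T V} (R : Realization.{uU, uV, w, w₁, w₂} D L x₀ 𝔲 𝔳) :
    Measurable[_, pathSigmaAll d t₀ T] R.X :=
  measurable_into_pathSigmaAll fun r => (R.adapted r).mono
    ((prodFiltration R.𝓕 𝔲.𝓕 𝔳.𝓕).le r) le_rfl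

/-- The model process evaluated along the motion is adapted to the filtration of the motion. -/
theorem Realization.measurable_model {c : ℝ → State d → ℝ} {Δ : TimePartition t₀ T}
    {M : Model.{uU, uV, w₁} D₂ L₁ L₂ c Δ} {S : ExtremalSelector L₁ L₂ Δ} {x₀ : State d}
    {𝔳 : Strategy.{w₂} d t₀ T V}
    (R : Realization.{uU, uV, w, w₁, w₂} D₁ L₁ x₀ (extremalShift M S) 𝔳) (s : Icc t₀ T) :
    Measurable[prodFiltration R.𝓕 M.𝓖 𝔳.𝓕 s] fun ω => M.Y (R.X ω) s ω.2.1 := by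
  have h1 : Measurable[prodFiltration R.𝓕 M.𝓖 𝔳.𝓕 s, pathSigma d s] R.X :=
    measurable_into_pathSigma fun r hr =>
      (R.adapted r).mono ((prodFiltration R.𝓕 M.𝓖 𝔳.𝓕).mono hr) le_rfl
  have h2 : Measurable[prodFiltration R.𝓕 M.𝓖 𝔳.𝓕 s, M.𝓖 s]
      fun ω : R.Ω × M.Γ × 𝔳.Ω => ω.2.1 := by
    let _ : MeasurableSpace R.Ω := R.𝓕 s
    let _ : MeasurableSpace M.Γ := M.𝓖 s
    let _ : MeasurableSpace 𝔳.Ω := 𝔳.𝓕 s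
    exact measurable_fst.comp measurable_snd
  exact (M.measurable_Y s).comp (h1.prodMk h2)

theorem Realization.measurable_model_ambient
    {c : ℝ → State d → ℝ} {Δ : TimePartition t₀ T}
    {M : Model.{uU, uV, w₁} D₂ L₁ L₂ c Δ} {S : ExtremalSelector L₁ L₂ Δ} {x₀ : State d}
    {𝔳 : Strategy.{w₂} d t₀ T V}
    (R : Realization.{uU, uV, w, w₁, w₂} D₁ L₁ x₀ (extremalShift M S) 𝔳) (τ : Icc t₀ T) :
    Measurable fun ω => M.Y (R.X ω) τ ω.2.1 :=
  (R.measurable_model τ).mono ((prodFiltration R.𝓕 M.𝓖 𝔳.𝓕).le τ) le_rfl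

theorem Realization.isConditionalLaw {c : ℝ → State d → ℝ} {Δ : TimePartition t₀ T}
    {M : Model.{uU, uV, w₁} D₂ L₁ L₂ c Δ} {S : ExtremalSelector L₁ L₂ Δ} {x₀ : State d}
    {𝔳 : Strategy.{w₂} d t₀ T V}
    (R : Realization.{uU, uV, w, w₁, w₂} D₁ L₁ x₀ (extremalShift M S) 𝔳) :
    IsConditionalLaw (mE := pathSigmaAll d t₀ T) (Γ := M.Γ) R.P R.X (fun ω => ω.2.1) M.P :=
  fun ζ hζ hC => R.cond_first ζ hζ hC

end Measurability

/-! ### The motion and the model as solutions of the quadratic martingale problem -/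

theorem IsTestClass.norm_sub_sq_mem {D : Set (State d → ℝ)} (hD : IsTestClass D) (p : State d) :
    (fun x : State d => ‖x - p‖ ^ 2) ∈ D := hD.1 (Or.inr ⟨p, rfl⟩)

variable [TopologicalSpace U] [TopologicalSpace V]

theorem Realization.isQuadraticSolution [MeasurableSpace V] {M₀ M₁ K : ℝ}
    (hL : L.IsAdmissible T M₀ M₁ K)
    (hD : IsTestClass D) (ht₀ : t₀ ∈ Icc 0 T) {x₀ : State d} {𝔲 : Strategy.{w₁} d t₀ T U}
    {𝔳 : Strategy.{w₂} d t₀ T V} (R : Realization.{uU, uV, w, w₁, w₂} D L x₀ 𝔲 𝔳) :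
    IsQuadraticSolution (prodFiltration R.𝓕 𝔲.𝓕 𝔳.𝓕) R.P (fun t ω => (R.X ω).1 t)
      (fun τ ω => L.sigma τ ((R.X ω).1 τ) (𝔲.ctrl (R.X ω) τ ω.2.1) (𝔳.ctrl (R.X ω) τ ω.2.2))
      (fun τ ω => L.drift τ ((R.X ω).1 τ) (𝔲.ctrl (R.X ω) τ ω.2.1) (𝔳.ctrl (R.X ω) τ ω.2.2))
      M₀ M₁ where
  adapted := R.adapted
  rightCont ω τ := ((R.X ω).2 τ).1
  abs_le τ ω := hL.sigma_le τ (Icc_mem_of_start ht₀ τ) _ _ _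
  norm_le τ ω := hL.drift_le τ (Icc_mem_of_start ht₀ τ) _ _ _
  pathIntegrable p := by
    have h := (R.dynkin _ (hD.norm_sub_sq_mem p)).1
    simpa only [L.op_norm_sub_sq (hL.second_moment _ (Icc_mem_of_start ht₀ _) _ _ _)] using h
  martingale p := by
    have h := (R.dynkin _ (hD.norm_sub_sq_mem p)).2
    simpa only [L.op_norm_sub_sq (hL.second_moment _ (Icc_mem_of_start ht₀ _) _ _ _)] using h

variable [BorelSpace U]

theorem Generator.IsAdmissible.integrable_drift {M₀ M₁ K : ℝ} (hL : L.IsAdmissible T M₀ M₁ K)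
    {t : ℝ} (ht : t ∈ Icc 0 T) (x : State d) (v : V) (μ : ProbabilityMeasure U) :
    Integrable (fun u => L.drift t x u v) (μ : Measure U) :=
  Integrable.of_bound (hL.measurable_drift ht x v).aestronglyMeasurable M₁
    (ae_of_all _ fun u => hL.drift_le t ht x u v)

theorem Generator.IsAdmissible.integral_op {M₀ M₁ K : ℝ} (hL : L.IsAdmissible T M₀ M₁ K)
    {t : ℝ} (ht : t ∈ Icc 0 T) (x p : State d) (v : V) (μ : ProbabilityMeasure U) :
    ∫ u, L.op t u v (fun x => ‖x - p‖ ^ 2) x ∂(μ : Measure U)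
      = ∫ u, L.sigma t x u v ∂(μ : Measure U)
        + 2 * inner ℝ (∫ u, L.drift t x u v ∂(μ : Measure U)) (x - p) := by
  have h1 : Integrable (fun u => L.sigma t x u v) (μ : Measure U) :=
    Integrable.of_bound (hL.measurable_sigma ht x v).aestronglyMeasurable M₀
      (ae_of_all _ fun u => hL.sigma_le t ht x u v)
  have h2 := hL.integrable_drift ht x v μ
  simp only [L.op_norm_sub_sq (hL.second_moment _ ht _ _ _)]
  rw [integral_add h1 ((h2.inner_const _).const_mul 2), integral_const_mul]
  congr 2
  simp only [real_inner_comm (x - p)]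
  exact integral_inner h2 (x - p)

theorem Model.isQuadraticSolution [MeasurableSpace V] {c : ℝ → State d → ℝ}
    {Δ : TimePartition t₀ T} {M₀ M₁ K : ℝ}
    (hL₂ : L₂.IsAdmissible T M₀ M₁ K) (hD : IsTestClass D) (ht₀ : t₀ ∈ Icc 0 T)
    (M : Model.{uU, uV, w₁} D L₁ L₂ c Δ) (x : SkorokhodPath d t₀ T) :
    IsQuadraticSolution M.𝓖 (M.P x) (M.Y x)
      (fun τ ω => ∫ u, L₂.sigma τ (M.Y x τ ω) u (M.v x τ ω) ∂(M.μ x τ ω : Measure U))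
      (fun τ ω => ∫ u, L₂.drift τ (M.Y x τ ω) u (M.v x τ ω) ∂(M.μ x τ ω : Measure U))
      M₀ M₁ where
  adapted := M.adapted x
  rightCont ω τ := (M.cadlag x ω τ).1
  abs_le τ ω := by
    have h := norm_integral_le_of_norm_le_const (μ := (M.μ x τ ω : Measure U))
      (ae_of_all _ fun u => (Real.norm_eq_abs _).trans_le
        (hL₂.sigma_le τ (Icc_mem_of_start ht₀ τ) (M.Y x τ ω) u (M.v x τ ω)))
    simpa using h
  norm_le τ ω := by
    have h := norm_integral_le_of_norm_le_const (μ := (M.μ x τ ω : Measure U))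
      (ae_of_all _ fun u => hL₂.drift_le τ (Icc_mem_of_start ht₀ τ) (M.Y x τ ω) u (M.v x τ ω))
    simpa using h
  pathIntegrable p := by
    have h := (M.dynkin x _ (hD.norm_sub_sq_mem p)).1
    simpa only [hL₂.integral_op (Icc_mem_of_start ht₀ _)] using h
  martingale p := by
    have h := (M.dynkin x _ (hD.norm_sub_sq_mem p)).2
    simpa only [hL₂.integral_op (Icc_mem_of_start ht₀ _)] using h

end Game

/-! ### One step of the extremal shift -/

namespace TimePartition

variable {t₀ T : ℝ} (Δ : TimePartition t₀ T)

theorem idx_eq {k : Fin Δ.r} {τ : Icc t₀ T} (h : Δ.pt k.castSucc ≤ τ) (h' : τ < Δ.pt k.succ) :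
    Δ.idx τ = k.castSucc := by
  refine le_antisymm ?_ (Finset.le_max' (Finset.univ.filter (fun l => Δ.pt l ≤ τ)) _
    (Finset.mem_filter.2 ⟨Finset.mem_univ _, h⟩))
  by_contra hlt
  have h1 : k.succ ≤ Δ.idx τ := Fin.castSucc_lt_iff_succ_le.1 (not_le.1 hlt)
  exact absurd ((Δ.strictMono.monotone h1).trans (Δ.pt_idx_le τ)) (not_le.2 h')

theorem sub_le_mesh (k : Fin Δ.r) : (Δ.pt k.succ : ℝ) - Δ.pt k.castSucc ≤ Δ.mesh :=
  le_ciSup (f := fun l : Fin Δ.r => (Δ.pt l.succ : ℝ) - Δ.pt l.castSucc)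
    (Set.finite_range _).bddAbove k

end TimePartition

section Step

variable {d : ℕ} {U : Type uU} {V : Type uV} {D₁ D₂ : Set (State d → ℝ)}
  {L L₁ L₂ : Generator d U V} {t₀ T : ℝ}

theorem integral_linear_combination {Ω : Type*} [MeasurableSpace Ω] {P : Measure Ω}
    [IsProbabilityMeasure P] {f g : Ω → ℝ} (hf : Integrable f P) (hg : Integrable g P)
    (p q r : ℝ) :
    Integrable (fun ω => p * f ω + q * g ω + r) P ∧
      ∫ ω, (p * f ω + q * g ω + r) ∂P = p * ∫ ω, f ω ∂P + q * ∫ ω, g ω ∂P + r := by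
  have h : Integrable (fun ω => p * f ω + q * g ω) P := (hf.const_mul p).add (hg.const_mul q)
  refine ⟨h.add (integrable_const r), ?_⟩
  rw [integral_add h (integrable_const r), integral_add (hf.const_mul p) (hg.const_mul q),
    integral_const_mul, integral_const_mul]
  simp

/-- The excess of the `Y`-dependent part of `‖X(t) - Y(t)‖² - ‖X(s) - Y(s)‖²` over its bound, where
`x, x'` and `y, y'` are the values of `X` and `Y` at `s, t`. The controls of the model do not enter,
so that along a motion this is a measurable function of the path and the random element of the
model. -/
noncomputable def stepExcess (T : ℝ) (L₁ L₂ : Generator d U V) (s t p q ε : ℝ)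
    (x x' y y' : State d) : ℝ :=
  -2 * inner ℝ (x - y) (y' - y) - 2 * inner ℝ (x' - x) (y' - y) + ‖y' - y‖ ^ 2
    - (t - s) * (-2 * shiftValue T L₁ L₂ s x y + p * ‖x - y‖ ^ 2 + q + ‖x' - x‖ ^ 2 / ε)

theorem measurable_stepExcess {s : ℝ} (t p q ε : ℝ) {Z : Type*}
    {m : MeasurableSpace Z} {x x' y y' : Z → State d} (hx : Measurable x) (hx' : Measurable x')
    (hy : Measurable y) (hy' : Measurable y')
    (hv : Measurable fun z => shiftValue T L₁ L₂ s (x z) (y z)) :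
    Measurable fun z => stepExcess T L₁ L₂ s t p q ε (x z) (x' z) (y z) (y' z) := by
  unfold stepExcess
  fun_prop

theorem Generator.IsAdmissible.inner_drift_le [TopologicalSpace U] [TopologicalSpace V]
    {M₀ M₁ K : ℝ} (hL : L.IsAdmissible T M₀ M₁ K) {s τ ε : ℝ} (hs : s ∈ Icc 0 T)
    (hmod : ∀ x u v, ‖L.drift τ x u v - L.drift s x u v‖ ^ 2 ≤ ε) (W x y : State d) (u : U)
    (v : V) :
    2 * inner ℝ W (L.drift τ y u v)
      ≤ 2 * inner ℝ W (L.drift s x u v) + 2 * (‖W‖ * (√ε + K * ‖y - x‖)) := by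
  have h1 : ‖L.drift τ y u v - L.drift s y u v‖ ≤ √ε := Real.le_sqrt_of_sq_le (hmod y u v)
  have h2 := hL.drift_lipschitz s hs y x u v
  have h3 : L.drift τ y u v = L.drift s x u v
      + ((L.drift τ y u v - L.drift s y u v) + (L.drift s y u v - L.drift s x u v)) := by abel
  have h4 := real_inner_le_norm W
    ((L.drift τ y u v - L.drift s y u v) + (L.drift s y u v - L.drift s x u v))
  have h5 := norm_add_le (L.drift τ y u v - L.drift s y u v) (L.drift s y u v - L.drift s x u v)
  have h6 := mul_le_mul_of_nonneg_left (h5.trans (add_le_add h1 h2)) (norm_nonneg W)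
  rw [h3, inner_add_right]
  linarith

variable [TopologicalSpace U] [Nonempty U] [TopologicalSpace V] [Nonempty V]
  {M₀₁ M₁₁ K₁ M₀₂ M₁₂ K₂ : ℝ}

theorem integrable_shiftValue {Ω : Type*} [MeasurableSpace Ω] {P : Measure Ω}
    [IsProbabilityMeasure P] (hL₁ : L₁.IsAdmissible T M₀₁ M₁₁ K₁)
    (hL₂ : L₂.IsAdmissible T M₀₂ M₁₂ K₂) {t : ℝ} (ht : t ∈ Icc 0 T) {X Y : Ω → State d}
    (hX : Measurable X) (hY : Measurable Y) (hXY : MemLp (fun ω => X ω - Y ω) 2 P) :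
    Integrable (fun ω => shiftValue T L₁ L₂ t (X ω) (Y ω)) P := by
  refine ((hXY.integrable one_le_two).norm.mul_const (max M₁₁ M₁₂)).mono'
    ((continuous_shiftValue hL₁ hL₂ ht).measurable.comp (hX.prodMk hY)).aestronglyMeasurable
    (ae_of_all _ fun ω => abs_shiftValue_le hL₁ hL₂ ht _ _)

theorem measurable_shiftValue_comp (hL₁ : L₁.IsAdmissible T M₀₁ M₁₁ K₁)
    (hL₂ : L₂.IsAdmissible T M₀₂ M₁₂ K₂) {s : ℝ} (hs : s ∈ Icc 0 T) {Z : Type*}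
    {m : MeasurableSpace Z} {x y : Z → State d} (hx : Measurable x) (hy : Measurable y) :
    Measurable fun z => shiftValue T L₁ L₂ s (x z) (y z) := by
  have hv := (continuous_shiftValue hL₁ hL₂ hs).measurable.comp (hx.prodMk hy)
  exact hv

variable [MeasurableSpace U] [MeasurableSpace V] {c : ℝ → State d → ℝ} {Δ : TimePartition t₀ T}

/-- The `k`-th step of the motion under the extremal shift: the drift of the motion in the direction
`X - Y` is at most the value of the one-shot game plus the share of the mismatch. -/
theorem Realization.step_le (hL₁ : L₁.IsAdmissible T M₀₁ M₁₁ K₁)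
    (hL₂ : L₂.IsAdmissible T M₀₂ M₁₂ K₂) (hD₁ : IsTestClass D₁) (ht₀ : t₀ ∈ Icc 0 T)
    {M : Model.{uU, uV, w₁} D₂ L₁ L₂ c Δ} {S : ExtremalSelector L₁ L₂ Δ} {x₀ : State d}
    {𝔳 : Strategy.{w₂} d t₀ T V}
    (R : Realization.{uU, uV, w, w₁, w₂} D₁ L₁ x₀ (extremalShift M S) 𝔳) {k : Fin Δ.r}
    {s t : Icc t₀ T} (hs : s = Δ.pt k.castSucc) (ht : t = Δ.pt k.succ) {ε : ℝ} (hε : 0 < ε)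
    (hmod : ∀ τ, s ≤ τ → τ ≤ t → ∀ x u v,
      ‖L₁.drift τ x u v - L₁.drift s x u v‖ ^ 2 ≤ ε)
    (hmem : MemLp (fun ω => (R.X ω).1 s - M.Y (R.X ω) s ω.2.1) 2 R.P) :
    2 * ∫ ω, inner ℝ ((R.X ω).1 s - M.Y (R.X ω) s ω.2.1) ((R.X ω).1 t - (R.X ω).1 s) ∂(R.P)
        + ∫ ω, ‖(R.X ω).1 t - (R.X ω).1 s‖ ^ 2 ∂(R.P)
      ≤ (t - s) * (2 * ∫ ω, shiftValue T L₁ L₂ s ((R.X ω).1 s) (M.Y (R.X ω) s ω.2.1) ∂(R.P)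
        + (isaacsShare T L₁ * (2 * isaacsLip T L₁ K₁ K₂ + 1) + 1 / 2)
          * ∫ ω, ‖(R.X ω).1 s - M.Y (R.X ω) s ω.2.1‖ ^ 2 ∂(R.P)
        + isaacsShare T L₁ * driftMismatch T L₁ L₂
        + (M₀₁ + ε * (4 + M₁₁ ^ 2)
          + incrementConst (T - t₀) M₀₁ M₁₁ * (4 * K₁ ^ 2 + 1 / ε) * (t - s))) := by
  have := R.isProb
  have hst : s ≤ t := by
    rw [hs, ht]; exact Δ.strictMono.monotone k.castSucc_lt_succ.le
  have hQ := R.isQuadraticSolution hL₁ hD₁ ht₀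
  have hsT := Icc_mem_of_start ht₀ s
  have hYm := R.measurable_model s
  have hval := integrable_shiftValue hL₁ hL₂ hsT (hQ.measurable s)
    (hYm.mono ((prodFiltration R.𝓕 M.𝓖 𝔳.𝓕).le s) le_rfl) hmem
  have hsq : Integrable (fun ω => ‖(R.X ω).1 s - M.Y (R.X ω) s ω.2.1‖ ^ 2) R.P :=
    hmem.integrable_norm_pow two_ne_zero
  obtain ⟨hZ, hZe⟩ := integral_linear_combination hval hsq 2
    (isaacsShare T L₁ * (2 * isaacsLip T L₁ K₁ K₂ + 1))
    (isaacsShare T L₁ * driftMismatch T L₁ L₂)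
  have h := hQ.integral_step_le hst (W := fun ω => (R.X ω).1 s - M.Y (R.X ω) s ω.2.1)
    ((R.adapted s).sub hYm) hmem hZ hε (K := K₁) ?_
  · rw [hZe] at h
    refine h.trans_eq ?_
    ring
  · intro ω τ h1 h2
    have hidx : Δ.idx τ = k.castSucc := Δ.idx_eq (hs ▸ h1) (ht ▸ h2)
    have hu : (⨆ v, shiftFun T L₁ L₂ s ((R.X ω).1 s) (M.Y (R.X ω) s ω.2.1)
        ((extremalShift M S).ctrl (R.X ω) τ ω.2.1) v)
        = shiftValue T L₁ L₂ s ((R.X ω).1 s) (M.Y (R.X ω) s ω.2.1) := by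
      have := S.extremal k.castSucc ((R.X ω).1 s) (M.Y (R.X ω) s ω.2.1)
      rw [← hs] at this
      simp only [extremalShift, extremalCtrl, hidx, ← hs]
      exact this
    have h3 := inner_drift_le_of_extremal hL₁ hL₂ hsT hu (𝔳.ctrl (R.X ω) τ ω.2.2)
    have h4 := hL₁.inner_drift_le hsT (hmod τ h1 h2.le)
      ((R.X ω).1 s - M.Y (R.X ω) s ω.2.1) ((R.X ω).1 s) ((R.X ω).1 τ)
      ((extremalShift M S).ctrl (R.X ω) τ ω.2.1) (𝔳.ctrl (R.X ω) τ ω.2.2)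
    refine h4.trans ?_
    linarith

variable [BorelSpace U]

/-- The `k`-th step of the model along a fixed path. The displacement of the path is known, so its
product with that of the model only sees the drift of the model and is of higher order. -/
theorem Model.integral_stepExcess_nonpos (hL₁ : L₁.IsAdmissible T M₀₁ M₁₁ K₁)
    (hL₂ : L₂.IsAdmissible T M₀₂ M₁₂ K₂) (hI : L₁.Isaacs T ∨ L₂.Isaacs T) (hD₂ : IsTestClass D₂)
    (ht₀ : t₀ ∈ Icc 0 T) (M : Model.{uU, uV, w₁} D₂ L₁ L₂ c Δ) (x : SkorokhodPath d t₀ T)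
    {k : Fin Δ.r} {s t : Icc t₀ T} (hs : s = Δ.pt k.castSucc) (ht : t = Δ.pt k.succ)
    {ε : ℝ} (hε : 0 < ε)
    (hmod : ∀ τ, s ≤ τ → τ ≤ t → ∀ x u v,
      ‖L₂.drift τ x u v - L₂.drift s x u v‖ ^ 2 ≤ ε) {p q : ℝ}
    (hp : p = (1 - isaacsShare T L₁) * (2 * isaacsLip T L₁ K₁ K₂ + 1) + 1 / 2)
    (hq : q = (1 - isaacsShare T L₁) * driftMismatch T L₁ L₂
      + (M₀₂ + ε * (4 + 2 * M₁₂ ^ 2)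
        + incrementConst (T - t₀) M₀₂ M₁₂ * (4 * K₂ ^ 2 + 1 / ε) * (t - s))) :
    Integrable (fun γ =>
        stepExcess T L₁ L₂ s t p q ε (x.1 s) (x.1 t) (M.Y x s γ) (M.Y x t γ)) (M.P x) ∧
      ∫ γ, stepExcess T L₁ L₂ s t p q ε (x.1 s) (x.1 t) (M.Y x s γ) (M.Y x t γ)
        ∂(M.P x) ≤ 0 := by
  have := M.isProb x
  have hst : s ≤ t := by
    rw [hs, ht]; exact Δ.strictMono.monotone k.castSucc_lt_succ.le
  have hst' : (0 : ℝ) ≤ t - s := sub_nonneg.2 hst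
  have hQ := M.isQuadraticSolution hL₂ hD₂ ht₀ x
  have hsT := Icc_mem_of_start ht₀ s
  have hM₁ := hQ.nonneg₁ s
  have hD : MemLp (fun γ => x.1 s - M.Y x s γ) 2 (M.P x) := (memLp_const _).sub (hQ.memLp s)
  have hΔY := hQ.memLp_sub s t
  have hval := integrable_shiftValue hL₁ hL₂ hsT (measurable_const (a := x.1 s)) (hQ.measurable s)
    hD
  have hsq : Integrable (fun γ => ‖x.1 s - M.Y x s γ‖ ^ 2) (M.P x) :=
    hD.integrable_norm_pow two_ne_zero
  obtain ⟨hZ, hZe⟩ := integral_linear_combination hval hsq (-2)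
    ((1 - isaacsShare T L₁) * (2 * isaacsLip T L₁ K₁ K₂ + 1))
    ((1 - isaacsShare T L₁) * driftMismatch T L₁ L₂)
  obtain ⟨hZ', hZe'⟩ := integral_linear_combination hval hsq (-2) p
    (q + ‖x.1 t - x.1 s‖ ^ 2 / ε)
  -- The displacement of the model in the direction `Y - x`.
  have h1 := hQ.integral_step_le hst (W := fun γ => -(x.1 s - M.Y x s γ))
    ((measurable_const.sub (M.adapted x s)).neg) hD.neg hZ hε (K := K₂) ?_
  swap
  · intro γ τ h1 h2
    have hv : (⨆ v', ⨅ u, shiftFun T L₁ L₂ s (x.1 s) (M.Y x s γ) u v')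
        = ⨅ u, shiftFun T L₁ L₂ s (x.1 s) (M.Y x s γ) u (M.v x τ γ) := by
      have := M.extremal_v x γ k τ (hs ▸ h1) (ht ▸ h2)
      rwa [← hs] at this
    have hb := hL₂.integrable_drift (Icc_mem_of_start ht₀ τ) (M.Y x τ γ) (M.v x τ γ) (M.μ x τ γ)
    rw [← integral_inner hb, ← integral_const_mul]
    refine (integral_mono ((hb.const_inner _).const_mul 2) (integrable_const
      (-2 * shiftValue T L₁ L₂ s (x.1 s) (M.Y x s γ)
        + (1 - isaacsShare T L₁) * (2 * isaacsLip T L₁ K₁ K₂ + 1) * ‖x.1 s - M.Y x s γ‖ ^ 2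
        + (1 - isaacsShare T L₁) * driftMismatch T L₁ L₂
        + 2 * (‖-(x.1 s - M.Y x s γ)‖ * (√ε + K₂ * ‖M.Y x τ γ - M.Y x s γ‖)))) fun u => ?_).trans_eq
      (by rw [integral_const, probReal_univ, one_smul])
    have h3 := le_inner_drift_of_extremal hL₁ hL₂ hI hsT hv u
    have h4 := hL₂.inner_drift_le hsT (hmod τ h1 h2.le) (-(x.1 s - M.Y x s γ)) (M.Y x s γ)
      (M.Y x τ γ) u (M.v x τ γ)
    refine h4.trans ?_
    simp only [inner_neg_left]
    linarith
  obtain ⟨C, hC⟩ := hQ.exists_integral_norm_sub_sq_le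
  -- The displacement of the model in the direction of the displacement of the path.
  have h2 := hQ.two_mul_integral_inner_sub_le hst (W := fun _ => -(x.1 t - x.1 s))
    measurable_const (memLp_const _) (Z := fun _ => ε * M₁₂ ^ 2 + ‖x.1 t - x.1 s‖ ^ 2 / ε)
    (integrable_const _) (κ := 0) le_rfl (fun τ _ _ => hC s τ) ?_
  swap
  · intro γ τ _ _
    rw [zero_mul, add_zero]
    have h3 := (real_inner_le_norm (-(x.1 t - x.1 s)) _).trans
      (mul_le_mul_of_nonneg_left (hQ.norm_le τ γ) (norm_nonneg _))
    rw [norm_neg] at h3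
    have h4 : 0 ≤ (ε * M₁₂ - ‖x.1 t - x.1 s‖) ^ 2 / ε := by positivity
    have h5 : (ε * M₁₂ - ‖x.1 t - x.1 s‖) ^ 2 / ε
        = ε * M₁₂ ^ 2 + ‖x.1 t - x.1 s‖ ^ 2 / ε - 2 * (‖x.1 t - x.1 s‖ * M₁₂) := by
      field_simp
      ring
    linarith
  have i1 : Integrable (fun γ => inner ℝ (x.1 s - M.Y x s γ) (M.Y x t γ - M.Y x s γ)) (M.P x) :=
    hD.integrable_real_inner hΔY
  have i2 : Integrable (fun γ => inner ℝ (x.1 t - x.1 s) (M.Y x t γ - M.Y x s γ)) (M.P x) :=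
    (hΔY.integrable one_le_two).const_inner _
  have i3 := hQ.integrable_norm_sub_sq s t
  have i12 : Integrable (fun γ => -2 * inner ℝ (x.1 s - M.Y x s γ) (M.Y x t γ - M.Y x s γ)
      - 2 * inner ℝ (x.1 t - x.1 s) (M.Y x t γ - M.Y x s γ)) (M.P x) :=
    (i1.const_mul _).sub (i2.const_mul _)
  have i123 : Integrable (fun γ => -2 * inner ℝ (x.1 s - M.Y x s γ) (M.Y x t γ - M.Y x s γ)
      - 2 * inner ℝ (x.1 t - x.1 s) (M.Y x t γ - M.Y x s γ) + ‖M.Y x t γ - M.Y x s γ‖ ^ 2)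
      (M.P x) := i12.add i3
  have hfun : ∀ γ, stepExcess T L₁ L₂ s t p q ε (x.1 s) (x.1 t) (M.Y x s γ) (M.Y x t γ)
      = (-2 * inner ℝ (x.1 s - M.Y x s γ) (M.Y x t γ - M.Y x s γ)
      - 2 * inner ℝ (x.1 t - x.1 s) (M.Y x t γ - M.Y x s γ) + ‖M.Y x t γ - M.Y x s γ‖ ^ 2)
      - (t - s) * (-2 * shiftValue T L₁ L₂ s (x.1 s) (M.Y x s γ)
        + p * ‖x.1 s - M.Y x s γ‖ ^ 2 + (q + ‖x.1 t - x.1 s‖ ^ 2 / ε)) := by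
    intro γ
    simp only [stepExcess]
    ring
  simp only [hfun]
  refine ⟨i123.sub (hZ'.const_mul _), ?_⟩
  rw [integral_sub i123 (hZ'.const_mul _), integral_add i12 i3,
    integral_sub (i1.const_mul _) (i2.const_mul _), integral_const_mul, integral_const_mul,
    integral_const_mul, hZe', sub_nonpos]
  simp only [inner_neg_left, integral_neg, norm_neg, zero_mul, add_zero, hZe] at h1 h2
  simp only [integral_const, probReal_univ, one_smul] at h2
  rw [hp, hq]
  calc _ = (2 * -∫ γ, inner ℝ (x.1 s - M.Y x s γ) (M.Y x t γ - M.Y x s γ) ∂(M.P x)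
        + ∫ γ, ‖M.Y x t γ - M.Y x s γ‖ ^ 2 ∂(M.P x))
        + 2 * -∫ γ, inner ℝ (x.1 t - x.1 s) (M.Y x t γ - M.Y x s γ) ∂(M.P x) := by ring
    _ ≤ _ := add_le_add h1 h2
    _ = _ := by ring

end Step

/-! ### The distance between the motion and the model -/

/-- The error of one step of length `δ`: it is small if first `ε` and then `δ` is small. -/
noncomputable def stepError (ℓ M₀₁ M₁₁ K₁ M₀₂ M₁₂ K₂ ε δ : ℝ) : ℝ :=
  ε * (8 + M₁₁ ^ 2 + 2 * M₁₂ ^ 2)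
    + (incrementConst ℓ M₀₁ M₁₁ * (4 * K₁ ^ 2 + 2 / ε)
      + incrementConst ℓ M₀₂ M₁₂ * (4 * K₂ ^ 2 + 1 / ε)) * δ

theorem LipschitzWith.integrable_comp {Ω : Type*} [MeasurableSpace Ω] {P : Measure Ω}
    [IsProbabilityMeasure P] {E : Type*} [NormedAddCommGroup E] {g : E → ℝ} {C : ℝ≥0}
    (hg : LipschitzWith C g) {Z : Ω → E} (hZ : MemLp Z 2 P) : Integrable (fun ω => g (Z ω)) P := by
  refine ((integrable_const |g 0|).add
    ((hZ.integrable one_le_two).norm.const_mul (C : ℝ))).mono'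
    (hg.continuous.comp_aestronglyMeasurable hZ.1) (ae_of_all _ fun ω => ?_)
  have h := hg.dist_le_mul (Z ω) 0
  rw [Real.dist_eq, dist_zero_right] at h
  have h' := abs_sub_abs_le_abs_sub (g (Z ω)) (g 0)
  simp only [Pi.add_apply, Real.norm_eq_abs]
  linarith

section Estimate

variable {d : ℕ} {U : Type uU} {V : Type uV} {D₁ D₂ : Set (State d → ℝ)}
  {L L₁ L₂ : Generator d U V} {t₀ T : ℝ} [TopologicalSpace U] [MeasurableSpace U]
  [BorelSpace U] [TopologicalSpace V] [MeasurableSpace V]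
  {M₀₁ M₁₁ K₁ M₀₂ M₁₂ K₂ : ℝ} {c : ℝ → State d → ℝ} {Δ : TimePartition t₀ T}
  {M : Model.{uU, uV, w₁} D₂ L₁ L₂ c Δ} {S : ExtremalSelector L₁ L₂ Δ} {x₀ : State d}
  {𝔳 : Strategy.{w₂} d t₀ T V}

theorem Realization.memLp_model (hL₁ : L₁.IsAdmissible T M₀₁ M₁₁ K₁)
    (hL₂ : L₂.IsAdmissible T M₀₂ M₁₂ K₂) (hD₁ : IsTestClass D₁) (hD₂ : IsTestClass D₂)
    (ht₀ : t₀ ∈ Icc 0 T)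
    (R : Realization.{uU, uV, w, w₁, w₂} D₁ L₁ x₀ (extremalShift M S) 𝔳) (τ : Icc t₀ T) :
    MemLp (fun ω => M.Y (R.X ω) τ ω.2.1) 2 R.P := by
  have := R.isProb
  have := M.isProb
  let _ : MeasurableSpace (SkorokhodPath d t₀ T) := pathSigmaAll d t₀ T
  have hX := (R.isQuadraticSolution hL₁ hD₁ ht₀).memLp (Δ.pt 0)
  -- Under `P_x` the model starts at `x(t₀)`, so its displacement is bounded in mean square.
  have hae : ∀ x, ∀ᵐ γ ∂(M.P x),
      ‖M.Y x τ γ - M.Y x (Δ.pt 0) γ‖ ^ 2 = ‖M.Y x τ γ - x.1 (Δ.pt 0)‖ ^ 2 := fun x => by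
    filter_upwards [M.initial x] with γ hγ
    rw [hγ]
  have hF : Measurable fun z : SkorokhodPath d t₀ T × M.Γ => M.Y z.1 τ z.2 - z.1.1 (Δ.pt 0) :=
    (M.measurable_Y_all τ).sub ((measurable_eval (Δ.pt 0)).comp measurable_fst)
  have h := R.isConditionalLaw.memLp_two R.measurable_X (measurable_fst.comp measurable_snd) hF
    (incrementConst (T - t₀) M₀₂ M₁₂ * (τ - Δ.pt 0))
    (fun x => ((M.isQuadraticSolution hL₂ hD₂ ht₀ x).integrable_norm_sub_sq _ _).congr (hae x))
    fun x => by
      refine (integral_congr_ae (hae x)).symm.trans_le ?_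
      exact (M.isQuadraticSolution hL₂ hD₂ ht₀ x).integral_norm_sub_sq_le (Δ.pt_zero_le τ)
  refine (h.add hX).ae_eq (ae_of_all _ fun ω => ?_)
  simp

theorem Realization.integral_norm_sub_sq_zero_le (hL₁ : L₁.IsAdmissible T M₀₁ M₁₁ K₁)
    (hL₂ : L₂.IsAdmissible T M₀₂ M₁₂ K₂) (hD₁ : IsTestClass D₁) (hD₂ : IsTestClass D₂)
    (ht₀ : t₀ ∈ Icc 0 T)
    (R : Realization.{uU, uV, w, w₁, w₂} D₁ L₁ x₀ (extremalShift M S) 𝔳) :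
    ∫ ω, ‖(R.X ω).1 (Δ.pt 0) - M.Y (R.X ω) (Δ.pt 0) ω.2.1‖ ^ 2 ∂(R.P) ≤ 0 := by
  have := R.isProb
  have := M.isProb
  let _ : MeasurableSpace (SkorokhodPath d t₀ T) := pathSigmaAll d t₀ T
  have hX := (R.isQuadraticSolution hL₁ hD₁ ht₀).memLp (Δ.pt 0)
  have hF : Measurable fun z : SkorokhodPath d t₀ T × M.Γ =>
      ‖z.1.1 (Δ.pt 0) - M.Y z.1 (Δ.pt 0) z.2‖ ^ 2 :=
    (((measurable_eval (Δ.pt 0)).comp measurable_fst).sub (M.measurable_Y_all _)).norm.pow_const 2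
  refine R.isConditionalLaw.integral_nonpos R.measurable_X (measurable_fst.comp measurable_snd) hF
    ((hX.sub (R.memLp_model hL₁ hL₂ hD₁ hD₂ ht₀ _)).integrable_norm_pow two_ne_zero)
    (ae_of_all _ fun ω => ?_)
  have h0 : (fun γ => ‖(R.X ω).1 (Δ.pt 0) - M.Y (R.X ω) (Δ.pt 0) γ‖ ^ 2) =ᵐ[M.P (R.X ω)]
      fun _ => (0 : ℝ) := by
    filter_upwards [M.initial (R.X ω)] with γ hγ
    simp [hγ]
  exact ⟨(integrable_congr h0).2 (integrable_zero _ _ _), by rw [integral_congr_ae h0]; simp⟩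

/-- Along the model the function `c` decreases in mean, so the model ends with mean payoff at most
`c(t₀,x₀)`. -/
theorem Realization.integral_payoff_model_le (hL₁ : L₁.IsAdmissible T M₀₁ M₁₁ K₁)
    (hL₂ : L₂.IsAdmissible T M₀₂ M₁₂ K₂) (hD₁ : IsTestClass D₁) (hD₂ : IsTestClass D₂)
    (ht₀ : t₀ ∈ Icc 0 T) {g : State d → ℝ} {C : ℝ≥0} (hg : LipschitzWith C g)
    (hc : ∀ x, c T x = g x)
    (R : Realization.{uU, uV, w, w₁, w₂} D₁ L₁ x₀ (extremalShift M S) 𝔳) :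
    Integrable (fun ω => g (M.Y (R.X ω) ⟨T, right_mem_Icc.2 ht₀.2⟩ ω.2.1)) R.P ∧
      ∫ ω, g (M.Y (R.X ω) ⟨T, right_mem_Icc.2 ht₀.2⟩ ω.2.1) ∂(R.P) ≤ c t₀ x₀ := by
  have := R.isProb
  have := M.isProb
  let _ : MeasurableSpace (SkorokhodPath d t₀ T) := pathSigmaAll d t₀ T
  have hT : (⟨T, right_mem_Icc.2 ht₀.2⟩ : Icc t₀ T) = Δ.pt (Fin.last Δ.r) :=
    Subtype.ext Δ.last.symm
  have h0 : Δ.pt 0 = ⟨t₀, left_mem_Icc.2 ht₀.2⟩ := Subtype.ext Δ.first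
  have hi := hg.integrable_comp (R.memLp_model hL₁ hL₂ hD₁ hD₂ ht₀ ⟨T, right_mem_Icc.2 ht₀.2⟩)
  refine ⟨hi, ?_⟩
  have hF : Measurable fun z : SkorokhodPath d t₀ T × M.Γ =>
      g (M.Y z.1 ⟨T, right_mem_Icc.2 ht₀.2⟩ z.2) - c t₀ x₀ :=
    (hg.continuous.measurable.comp (M.measurable_Y_all _)).sub measurable_const
  have key := R.isConditionalLaw.integral_nonpos R.measurable_X
    (measurable_fst.comp measurable_snd) hF (hi.sub (integrable_const _)) ?_
  · rw [integral_sub hi (integrable_const _)] at key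
    simpa using key
  · filter_upwards [R.initial ht₀.2] with ω hω
    have hint := hg.integrable_comp
      ((M.isQuadraticSolution hL₂ hD₂ ht₀ (R.X ω)).memLp ⟨T, right_mem_Icc.2 ht₀.2⟩)
    refine ⟨hint.sub (integrable_const _), ?_⟩
    have hanti : ∫ γ, g (M.Y (R.X ω) ⟨T, right_mem_Icc.2 ht₀.2⟩ γ) ∂(M.P (R.X ω)) ≤ c t₀ x₀ := by
      calc ∫ γ, g (M.Y (R.X ω) ⟨T, right_mem_Icc.2 ht₀.2⟩ γ) ∂(M.P (R.X ω))
          = ∫ γ, c (Δ.pt (Fin.last Δ.r)) (M.Y (R.X ω) (Δ.pt (Fin.last Δ.r)) γ)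
              ∂(M.P (R.X ω)) := by
            simp only [← hT, hc]
        _ ≤ ∫ γ, c (Δ.pt 0) (M.Y (R.X ω) (Δ.pt 0) γ) ∂(M.P (R.X ω)) :=
            M.antitone_c (R.X ω) (Fin.zero_le _)
        _ = ∫ _, c t₀ x₀ ∂(M.P (R.X ω)) := by
            refine integral_congr_ae ?_
            filter_upwards [M.initial (R.X ω)] with γ hγ
            rw [hγ, Δ.first, h0, hω]
        _ = c t₀ x₀ := by simp
    rw [integral_sub hint (integrable_const _)]
    simpa using hanti

variable [Nonempty U] [Nonempty V]

/-- One step of the extremal shift: the mean square distance `q` between the motion and the model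
satisfies `q' ≤ q + (t - s)(βq + Θ + error)`. -/
theorem Realization.integral_norm_sub_sq_step (hL₁ : L₁.IsAdmissible T M₀₁ M₁₁ K₁)
    (hL₂ : L₂.IsAdmissible T M₀₂ M₁₂ K₂) (hI : L₁.Isaacs T ∨ L₂.Isaacs T)
    (hD₁ : IsTestClass D₁) (hD₂ : IsTestClass D₂) (ht₀ : t₀ ∈ Icc 0 T)
    (R : Realization.{uU, uV, w, w₁, w₂} D₁ L₁ x₀ (extremalShift M S) 𝔳) {k : Fin Δ.r}
    {s t : Icc t₀ T} (hs : s = Δ.pt k.castSucc) (ht : t = Δ.pt k.succ) {ε : ℝ} (hε : 0 < ε)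
    (hmod₁ : ∀ τ, s ≤ τ → τ ≤ t → ∀ x u v,
      ‖L₁.drift τ x u v - L₁.drift s x u v‖ ^ 2 ≤ ε)
    (hmod₂ : ∀ τ, s ≤ τ → τ ≤ t → ∀ x u v,
      ‖L₂.drift τ x u v - L₂.drift s x u v‖ ^ 2 ≤ ε) :
    ∫ ω, ‖(R.X ω).1 t - M.Y (R.X ω) t ω.2.1‖ ^ 2 ∂(R.P)
      ≤ ∫ ω, ‖(R.X ω).1 s - M.Y (R.X ω) s ω.2.1‖ ^ 2 ∂(R.P)
        + (t - s) * (betaConst T L₁ K₁ K₂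
          * ∫ ω, ‖(R.X ω).1 s - M.Y (R.X ω) s ω.2.1‖ ^ 2 ∂(R.P)
          + (driftMismatch T L₁ L₂ + M₀₁ + M₀₂
            + stepError (T - t₀) M₀₁ M₁₁ K₁ M₀₂ M₁₂ K₂ ε (t - s))) := by
  have := R.isProb
  have := M.isProb
  let _ : MeasurableSpace (SkorokhodPath d t₀ T) := pathSigmaAll d t₀ T
  have hst : s ≤ t := by
    rw [hs, ht]; exact Δ.strictMono.monotone k.castSucc_lt_succ.le
  have hst' : (0 : ℝ) ≤ t - s := sub_nonneg.2 hst
  have hQ := R.isQuadraticSolution hL₁ hD₁ ht₀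
  have hsT := Icc_mem_of_start ht₀ s
  have hYs := R.memLp_model hL₁ hL₂ hD₁ hD₂ ht₀ s
  have hYt := R.memLp_model hL₁ hL₂ hD₁ hD₂ ht₀ t
  have hD : MemLp (fun ω => (R.X ω).1 s - M.Y (R.X ω) s ω.2.1) 2 R.P := (hQ.memLp s).sub hYs
  have hD' : MemLp (fun ω => (R.X ω).1 t - M.Y (R.X ω) t ω.2.1) 2 R.P := (hQ.memLp t).sub hYt
  have hΔX := hQ.memLp_sub s t
  have hval := integrable_shiftValue hL₁ hL₂ hsT (hQ.measurable s) (R.measurable_model_ambient s) hD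
  have hsq : Integrable (fun ω => ‖(R.X ω).1 s - M.Y (R.X ω) s ω.2.1‖ ^ 2) R.P :=
    hD.integrable_norm_pow two_ne_zero
  have hsq' : Integrable (fun ω => ‖(R.X ω).1 t - M.Y (R.X ω) t ω.2.1‖ ^ 2) R.P :=
    hD'.integrable_norm_pow two_ne_zero
  have hdx := hQ.integrable_norm_sub_sq s t
  have hin : Integrable (fun ω => inner ℝ ((R.X ω).1 s - M.Y (R.X ω) s ω.2.1)
      ((R.X ω).1 t - (R.X ω).1 s)) R.P := hD.integrable_real_inner hΔX
  -- The bounds for the increments of `X` and of `Y` involve the shares `isaacsShare` and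
  -- `1 - isaacsShare` of the mismatch, and their sum is `β` and `Θ`.
  obtain ⟨p, hp⟩ : ∃ p, p = (1 - isaacsShare T L₁) * (2 * isaacsLip T L₁ K₁ K₂ + 1) + 1 / 2 :=
    ⟨_, rfl⟩
  obtain ⟨q, hq⟩ : ∃ q, q = (1 - isaacsShare T L₁) * driftMismatch T L₁ L₂
      + (M₀₂ + ε * (4 + 2 * M₁₂ ^ 2)
        + incrementConst (T - t₀) M₀₂ M₁₂ * (4 * K₂ ^ 2 + 1 / ε) * (t - s)) := ⟨_, rfl⟩
  obtain ⟨i1, e1⟩ := integral_linear_combination hval hsq (-2 * ((t : ℝ) - s)) (1 + (t - s) * p)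
    ((t - s) * q)
  obtain ⟨i2, e2⟩ := integral_linear_combination hin hdx 2 (1 + (t - s) / ε) 0
  have hsplit : ∀ ω, stepExcess T L₁ L₂ s t p q ε ((R.X ω).1 s) ((R.X ω).1 t)
        (M.Y (R.X ω) s ω.2.1) (M.Y (R.X ω) t ω.2.1)
      = ‖(R.X ω).1 t - M.Y (R.X ω) t ω.2.1‖ ^ 2
        - ((-2 * ((t : ℝ) - s) * shiftValue T L₁ L₂ s ((R.X ω).1 s) (M.Y (R.X ω) s ω.2.1)
          + (1 + (t - s) * p) * ‖(R.X ω).1 s - M.Y (R.X ω) s ω.2.1‖ ^ 2 + (t - s) * q)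
        + (2 * inner ℝ ((R.X ω).1 s - M.Y (R.X ω) s ω.2.1) ((R.X ω).1 t - (R.X ω).1 s)
          + (1 + (t - s) / ε) * ‖(R.X ω).1 t - (R.X ω).1 s‖ ^ 2 + 0)) := by
    intro ω
    have e : (R.X ω).1 t - M.Y (R.X ω) t ω.2.1
        = ((R.X ω).1 s - M.Y (R.X ω) s ω.2.1) + (((R.X ω).1 t - (R.X ω).1 s)
          - (M.Y (R.X ω) t ω.2.1 - M.Y (R.X ω) s ω.2.1)) := by abel
    have e' : ‖(R.X ω).1 t - M.Y (R.X ω) t ω.2.1‖ ^ 2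
        = ‖(R.X ω).1 s - M.Y (R.X ω) s ω.2.1‖ ^ 2
          + 2 * (inner ℝ ((R.X ω).1 s - M.Y (R.X ω) s ω.2.1) ((R.X ω).1 t - (R.X ω).1 s)
            - inner ℝ ((R.X ω).1 s - M.Y (R.X ω) s ω.2.1)
              (M.Y (R.X ω) t ω.2.1 - M.Y (R.X ω) s ω.2.1))
          + (‖(R.X ω).1 t - (R.X ω).1 s‖ ^ 2
            - 2 * inner ℝ ((R.X ω).1 t - (R.X ω).1 s)
              (M.Y (R.X ω) t ω.2.1 - M.Y (R.X ω) s ω.2.1)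
            + ‖M.Y (R.X ω) t ω.2.1 - M.Y (R.X ω) s ω.2.1‖ ^ 2) := by
      rw [e, norm_add_sq_real, norm_sub_sq_real ((R.X ω).1 t - (R.X ω).1 s), inner_sub_right]
    rw [e', stepExcess]
    ring
  have hmeas : Measurable fun z : SkorokhodPath d t₀ T × M.Γ =>
      stepExcess T L₁ L₂ s t p q ε (z.1.1 s) (z.1.1 t) (M.Y z.1 s z.2) (M.Y z.1 t z.2) := by
    have hxs : Measurable fun z : SkorokhodPath d t₀ T × M.Γ => z.1.1 s :=
      (measurable_eval s).comp measurable_fst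
    have hxt : Measurable fun z : SkorokhodPath d t₀ T × M.Γ => z.1.1 t :=
      (measurable_eval t).comp measurable_fst
    exact measurable_stepExcess t p q ε hxs hxt (M.measurable_Y_all s) (M.measurable_Y_all t)
      (measurable_shiftValue_comp hL₁ hL₂ hsT hxs (M.measurable_Y_all s))
  have hint : Integrable (fun ω => stepExcess T L₁ L₂ s t p q ε ((R.X ω).1 s) ((R.X ω).1 t)
      (M.Y (R.X ω) s ω.2.1) (M.Y (R.X ω) t ω.2.1)) R.P := by
    simp only [hsplit]
    exact hsq'.sub (i1.add i2)
  have key := R.isConditionalLaw.integral_nonpos R.measurable_X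
    (measurable_fst.comp measurable_snd) hmeas hint (ae_of_all _ fun ω =>
      M.integral_stepExcess_nonpos hL₁ hL₂ hI hD₂ ht₀ (R.X ω) hs ht hε hmod₂ hp hq)
  have i12 : Integrable (fun ω => (-2 * ((t : ℝ) - s)
          * shiftValue T L₁ L₂ s ((R.X ω).1 s) (M.Y (R.X ω) s ω.2.1)
          + (1 + (t - s) * p) * ‖(R.X ω).1 s - M.Y (R.X ω) s ω.2.1‖ ^ 2 + (t - s) * q)
        + (2 * inner ℝ ((R.X ω).1 s - M.Y (R.X ω) s ω.2.1) ((R.X ω).1 t - (R.X ω).1 s)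
          + (1 + (t - s) / ε) * ‖(R.X ω).1 t - (R.X ω).1 s‖ ^ 2 + 0)) R.P := i1.add i2
  have key' : ∫ ω, ‖(R.X ω).1 t - M.Y (R.X ω) t ω.2.1‖ ^ 2 ∂(R.P)
      ≤ (-2 * ((t : ℝ) - s)
          * ∫ ω, shiftValue T L₁ L₂ s ((R.X ω).1 s) (M.Y (R.X ω) s ω.2.1) ∂(R.P)
          + (1 + (t - s) * p) * ∫ ω, ‖(R.X ω).1 s - M.Y (R.X ω) s ω.2.1‖ ^ 2 ∂(R.P)
          + (t - s) * q)
        + (2 * ∫ ω, inner ℝ ((R.X ω).1 s - M.Y (R.X ω) s ω.2.1)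
            ((R.X ω).1 t - (R.X ω).1 s) ∂(R.P)
          + (1 + (t - s) / ε) * ∫ ω, ‖(R.X ω).1 t - (R.X ω).1 s‖ ^ 2 ∂(R.P) + 0) := by
    rw [← e1, ← e2, ← integral_add i1 i2, ← sub_nonpos, ← integral_sub hsq' i12]
    simpa only [hsplit] using key
  have hX := R.step_le hL₁ hL₂ hD₁ ht₀ hs ht hε hmod₁ hD
  have hinc := mul_le_mul_of_nonneg_left (hQ.integral_norm_sub_sq_le hst)
    (div_nonneg hst' hε.le)
  have hβ : betaConst T L₁ K₁ K₂ = 2 + 2 * isaacsLip T L₁ K₁ K₂ := rfl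
  rw [hp, hq] at key'
  rw [hβ, stepError]
  generalize ∫ ω, ‖(R.X ω).1 t - M.Y (R.X ω) t ω.2.1‖ ^ 2 ∂(R.P) = q' at *
  generalize ∫ ω, ‖(R.X ω).1 s - M.Y (R.X ω) s ω.2.1‖ ^ 2 ∂(R.P) = q₀ at *
  generalize ∫ ω, shiftValue T L₁ L₂ s ((R.X ω).1 s) (M.Y (R.X ω) s ω.2.1) ∂(R.P) = v at *
  generalize ∫ ω, ‖(R.X ω).1 t - (R.X ω).1 s‖ ^ 2 ∂(R.P) = n at *
  generalize ∫ ω, inner ℝ ((R.X ω).1 s - M.Y (R.X ω) s ω.2.1)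
            ((R.X ω).1 t - (R.X ω).1 s) ∂(R.P) = i at *
  refine key'.trans ?_
  have hfin := add_le_add hX hinc
  refine le_of_sub_nonneg ((sub_nonneg.2 hfin).trans_eq ?_)
  ring

end Estimate

/-! ### Summation over the partition and passage to the limit -/

/-- A discrete Gronwall inequality along a partition. -/
theorem TimePartition.le_of_step_le {t₀ T : ℝ} (Δ : TimePartition t₀ T) {q : Fin (Δ.r + 1) → ℝ}
    {β θ : ℝ} (hβ : 0 ≤ β) (hθ : 0 ≤ θ) (h0 : q 0 ≤ 0)
    (h : ∀ k : Fin Δ.r, q k.succ ≤ q k.castSucc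
      + ((Δ.pt k.succ : ℝ) - Δ.pt k.castSucc) * (β * q k.castSucc + θ)) (k : Fin (Δ.r + 1)) :
    q k ≤ (Δ.pt k - t₀) * Real.exp (β * (Δ.pt k - t₀)) * θ := by
  induction k using Fin.induction with
  | zero => simpa [Δ.first] using h0
  | succ k ih =>
    have hstep : (0 : ℝ) ≤ (Δ.pt k.succ : ℝ) - Δ.pt k.castSucc :=
      sub_nonneg.2 (Δ.strictMono.monotone k.castSucc_lt_succ.le)
    have hs : (0 : ℝ) ≤ (Δ.pt k.castSucc : ℝ) - t₀ := sub_nonneg.2 (Δ.pt k.castSucc).2.1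
    have e : (Δ.pt k.succ : ℝ) - t₀
        = ((Δ.pt k.castSucc : ℝ) - t₀) + ((Δ.pt k.succ : ℝ) - Δ.pt k.castSucc) := by ring
    refine (h k).trans ?_
    rw [e]
    generalize (Δ.pt k.succ : ℝ) - Δ.pt k.castSucc = τ at *
    generalize (Δ.pt k.castSucc : ℝ) - t₀ = σ at *
    have h1 : 1 + τ * β ≤ Real.exp (β * τ) := by
      have := Real.add_one_le_exp (β * τ)
      linarith
    have h2 : (1 : ℝ) ≤ Real.exp (β * (σ + τ)) := Real.one_le_exp (by positivity)
    calc q k.castSucc + τ * (β * q k.castSucc + θ) = (1 + τ * β) * q k.castSucc + τ * 1 * θ := by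
          ring
      _ ≤ (1 + τ * β) * (σ * Real.exp (β * σ) * θ) + τ * 1 * θ := by gcongr
      _ ≤ Real.exp (β * τ) * (σ * Real.exp (β * σ) * θ) + τ * Real.exp (β * (σ + τ)) * θ := by
          gcongr
      _ = (σ + τ) * Real.exp (β * (σ + τ)) * θ := by
          rw [mul_add β, Real.exp_add]
          ring

theorem integral_norm_le_sqrt {Ω : Type*} [MeasurableSpace Ω] {P : Measure Ω}
    [IsProbabilityMeasure P] {E : Type*} [NormedAddCommGroup E] {Z : Ω → E} (hZ : MemLp Z 2 P) :
    ∫ ω, ‖Z ω‖ ∂P ≤ √(∫ ω, ‖Z ω‖ ^ 2 ∂P) := by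
  refine Real.le_sqrt_of_sq_le ?_
  have h := variance_nonneg (fun ω => ‖Z ω‖) P
  rw [variance_eq_sub hZ.norm] at h
  simpa using h

section Outcome

variable {d : ℕ} {U : Type uU} {V : Type uV} {D₁ D₂ : Set (State d → ℝ)}
  {L L₁ L₂ : Generator d U V} {t₀ T : ℝ} {M₀ M₁ K M₀₁ M₁₁ K₁ M₀₂ M₁₂ K₂ : ℝ}

theorem driftMismatch_nonneg : 0 ≤ driftMismatch T L₁ L₂ :=
  Real.iSup_nonneg fun _ => by positivity

theorem incrementConst_nonneg {ℓ : ℝ} (hℓ : 0 ≤ ℓ) (hM₀ : 0 ≤ M₀) : 0 ≤ incrementConst ℓ M₀ M₁ := by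
  unfold incrementConst
  positivity

theorem stepError_nonneg {ℓ ε δ : ℝ} (hℓ : 0 ≤ ℓ) (h₁ : 0 ≤ M₀₁) (h₂ : 0 ≤ M₀₂) (hε : 0 ≤ ε)
    (hδ : 0 ≤ δ) : 0 ≤ stepError ℓ M₀₁ M₁₁ K₁ M₀₂ M₁₂ K₂ ε δ := by
  have := incrementConst_nonneg (M₁ := M₁₁) hℓ h₁
  have := incrementConst_nonneg (M₁ := M₁₂) hℓ h₂
  unfold stepError
  positivity

theorem stepError_mono {ℓ ε δ δ' : ℝ} (hℓ : 0 ≤ ℓ) (h₁ : 0 ≤ M₀₁) (h₂ : 0 ≤ M₀₂) (hε : 0 ≤ ε)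
    (hδ : δ ≤ δ') : stepError ℓ M₀₁ M₁₁ K₁ M₀₂ M₁₂ K₂ ε δ
      ≤ stepError ℓ M₀₁ M₁₁ K₁ M₀₂ M₁₂ K₂ ε δ' := by
  have := incrementConst_nonneg (M₁ := M₁₁) hℓ h₁
  have := incrementConst_nonneg (M₁ := M₁₂) hℓ h₂
  unfold stepError
  gcongr

theorem exists_stepError_le (ℓ M₀₁ M₁₁ K₁ M₀₂ M₁₂ K₂ : ℝ) {η : ℝ} (hη : 0 < η) :
    ∃ ε > 0, ∃ δ₀ > 0, ∀ δ, 0 ≤ δ → δ ≤ δ₀ → stepError ℓ M₀₁ M₁₁ K₁ M₀₂ M₁₂ K₂ ε δ ≤ η := by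
  have hA : 0 < 8 + M₁₁ ^ 2 + 2 * M₁₂ ^ 2 := by positivity
  obtain ⟨ε, hε⟩ : ∃ ε, ε = η / (2 * (8 + M₁₁ ^ 2 + 2 * M₁₂ ^ 2)) := ⟨_, rfl⟩
  obtain ⟨B, hB⟩ : ∃ B, B = incrementConst ℓ M₀₁ M₁₁ * (4 * K₁ ^ 2 + 2 / ε)
      + incrementConst ℓ M₀₂ M₁₂ * (4 * K₂ ^ 2 + 1 / ε) := ⟨_, rfl⟩
  refine ⟨ε, by rw [hε]; positivity, η / (2 * (|B| + 1)), by positivity, fun δ h0 h1 => ?_⟩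
  have h2 : ε * (8 + M₁₁ ^ 2 + 2 * M₁₂ ^ 2) = η / 2 := by
    rw [hε]
    field_simp
  have h3 : δ * (2 * (|B| + 1)) ≤ η := (le_div_iff₀ (by positivity)).1 h1
  have h4 := mul_le_mul_of_nonneg_right (le_abs_self B) h0
  rw [stepError, h2, ← hB]
  linarith

variable [TopologicalSpace U] [TopologicalSpace V]

theorem Generator.IsAdmissible.exists_drift_modulus (hL : L.IsAdmissible T M₀ M₁ K) {ε : ℝ}
    (hε : 0 < ε) : ∃ δ > 0, ∀ t ∈ Icc 0 T, ∀ s ∈ Icc 0 T, |t - s| < δ → ∀ x u v,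
      ‖L.drift t x u v - L.drift s x u v‖ ^ 2 ≤ ε := by
  obtain ⟨α, -, hα, h⟩ := hL.modulus
  have h1 := hα.eventually_lt_const hε
  rw [eventually_nhdsWithin_iff, Metric.eventually_nhds_iff] at h1
  obtain ⟨δ, hδ, h2⟩ := h1
  refine ⟨δ, hδ, fun t ht s hs hts x u v => ?_⟩
  rcases eq_or_ne t s with rfl | hne
  · simpa using hε.le
  · exact (h t ht s hs x u v).trans
      (h2 (by simpa [Real.dist_eq] using hts) (sub_ne_zero.2 hne)).le

theorem Generator.IsAdmissible.nonneg_lipschitz [Nonempty U] [Nonempty V] [Nontrivial (State d)]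
    (hL : L.IsAdmissible T M₀ M₁ K) (ht : t₀ ∈ Icc 0 T) : 0 ≤ K := by
  obtain ⟨x, y, hxy⟩ := exists_pair_ne (State d)
  have h := (norm_nonneg _).trans
    (hL.drift_lipschitz t₀ ht x y (Classical.arbitrary U) (Classical.arbitrary V))
  exact nonneg_of_mul_nonneg_left h (norm_pos_iff.2 (sub_ne_zero.2 hxy))

theorem Generator.IsAdmissible.nonneg_sigma [Nonempty U] [Nonempty V]
    (hL : L.IsAdmissible T M₀ M₁ K) (ht : t₀ ∈ Icc 0 T) : 0 ≤ M₀ :=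
  (abs_nonneg _).trans (hL.sigma_le t₀ ht 0 (Classical.arbitrary U) (Classical.arbitrary V))

variable [Nonempty U] [Nonempty V] [MeasurableSpace U] [BorelSpace U] [MeasurableSpace V]
  {c : ℝ → State d → ℝ} {Δ : TimePartition t₀ T}
  {M : Model.{uU, uV, w₁} D₂ L₁ L₂ c Δ} {S : ExtremalSelector L₁ L₂ Δ} {x₀ : State d}
  {𝔳 : Strategy.{w₂} d t₀ T V}

/-- At the terminal time the motion under the extremal shift is close to the model in mean
square. -/
theorem Realization.integral_norm_sub_sq_last_le (hL₁ : L₁.IsAdmissible T M₀₁ M₁₁ K₁)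
    (hL₂ : L₂.IsAdmissible T M₀₂ M₁₂ K₂) (hI : L₁.Isaacs T ∨ L₂.Isaacs T)
    (hD₁ : IsTestClass D₁) (hD₂ : IsTestClass D₂) (ht₀ : t₀ ∈ Icc 0 T)
    (R : Realization.{uU, uV, w, w₁, w₂} D₁ L₁ x₀ (extremalShift M S) 𝔳) {ε δ : ℝ} (hε : 0 < ε)
    (hδ : 0 ≤ δ) (hΔ : Δ.mesh ≤ δ)
    (hmod₁ : ∀ t ∈ Icc 0 T, ∀ s ∈ Icc 0 T, |t - s| ≤ δ → ∀ x u v,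
      ‖L₁.drift t x u v - L₁.drift s x u v‖ ^ 2 ≤ ε)
    (hmod₂ : ∀ t ∈ Icc 0 T, ∀ s ∈ Icc 0 T, |t - s| ≤ δ → ∀ x u v,
      ‖L₂.drift t x u v - L₂.drift s x u v‖ ^ 2 ≤ ε) :
    ∫ ω, ‖(R.X ω).1 (Δ.pt (Fin.last Δ.r)) - M.Y (R.X ω) (Δ.pt (Fin.last Δ.r)) ω.2.1‖ ^ 2 ∂(R.P)
      ≤ T * Real.exp (betaConst T L₁ K₁ K₂ * T) * (driftMismatch T L₁ L₂ + M₀₁ + M₀₂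
        + stepError (T - t₀) M₀₁ M₁₁ K₁ M₀₂ M₁₂ K₂ ε δ) := by
  have hM₀₁ := hL₁.nonneg_sigma ht₀
  have hM₀₂ := hL₂.nonneg_sigma ht₀
  have hℓ : 0 ≤ T - t₀ := sub_nonneg.2 ht₀.2
  have hT : 0 ≤ T := ht₀.1.trans ht₀.2
  have hmis := driftMismatch_nonneg (T := T) (L₁ := L₁) (L₂ := L₂)
  have herr := stepError_nonneg (M₁₁ := M₁₁) (K₁ := K₁) (M₁₂ := M₁₂) (K₂ := K₂) hℓ hM₀₁ hM₀₂
    hε.le hδ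
  -- In dimension zero the Lipschitz constants may be negative, but there is nothing to prove.
  rcases subsingleton_or_nontrivial (State d) with hd | hd
  · simp only [Subsingleton.elim _ (0 : State d), norm_zero]
    simp only [ne_eq, OfNat.ofNat_ne_zero, not_false_eq_true, zero_pow, integral_zero]
    positivity
  have hβ : 0 ≤ betaConst T L₁ K₁ K₂ := by
    have h₁ := hL₁.nonneg_lipschitz ht₀
    have h₂ := hL₂.nonneg_lipschitz ht₀
    unfold betaConst
    split_ifs <;> positivity
  have key := Δ.le_of_step_le (q := fun k =>
    ∫ ω, ‖(R.X ω).1 (Δ.pt k) - M.Y (R.X ω) (Δ.pt k) ω.2.1‖ ^ 2 ∂(R.P)) hβ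
    (θ := driftMismatch T L₁ L₂ + M₀₁ + M₀₂ + stepError (T - t₀) M₀₁ M₁₁ K₁ M₀₂ M₁₂ K₂ ε δ)
    (by positivity) (R.integral_norm_sub_sq_zero_le hL₁ hL₂ hD₁ hD₂ ht₀) (fun k => ?_)
    (Fin.last Δ.r)
  · refine key.trans ?_
    rw [Δ.last]
    have : T - t₀ ≤ T := sub_le_self T ht₀.1
    gcongr
  · have hstep := Δ.sub_le_mesh k
    have hle : (0 : ℝ) ≤ (Δ.pt k.succ : ℝ) - Δ.pt k.castSucc :=
      sub_nonneg.2 (Δ.strictMono.monotone k.castSucc_lt_succ.le)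
    have habs : ∀ τ : Icc t₀ T, Δ.pt k.castSucc ≤ τ → τ ≤ Δ.pt k.succ →
        |(τ : ℝ) - Δ.pt k.castSucc| ≤ δ := by
      intro τ h1 h2
      have h1' : (Δ.pt k.castSucc : ℝ) ≤ τ := h1
      have h2' : (τ : ℝ) ≤ Δ.pt k.succ := h2
      rw [abs_of_nonneg (sub_nonneg.2 h1')]
      linarith
    refine (R.integral_norm_sub_sq_step hL₁ hL₂ hI hD₁ hD₂ ht₀ rfl rfl hε
      (fun τ h1 h2 => hmod₁ τ (Icc_mem_of_start ht₀ τ) _ (Icc_mem_of_start ht₀ _) (habs τ h1 h2))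
      (fun τ h1 h2 => hmod₂ τ (Icc_mem_of_start ht₀ τ) _ (Icc_mem_of_start ht₀ _)
        (habs τ h1 h2))).trans ?_
    have := stepError_mono (M₁₁ := M₁₁) (K₁ := K₁) (M₁₂ := M₁₂) (K₂ := K₂) hℓ hM₀₁ hM₀₂ hε.le
      (hstep.trans hΔ)
    gcongr

theorem Realization.integral_payoff_le (hL₁ : L₁.IsAdmissible T M₀₁ M₁₁ K₁)
    (hL₂ : L₂.IsAdmissible T M₀₂ M₁₂ K₂) (hI : L₁.Isaacs T ∨ L₂.Isaacs T)
    (hD₁ : IsTestClass D₁) (hD₂ : IsTestClass D₂) (ht₀ : t₀ ∈ Icc 0 T) {g : State d → ℝ}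
    {C : ℝ≥0} (hg : LipschitzWith C g) (hc : ∀ x, c T x = g x)
    (R : Realization.{uU, uV, w, w₁, w₂} D₁ L₁ x₀ (extremalShift M S) 𝔳) {ε δ : ℝ} (hε : 0 < ε)
    (hδ : 0 ≤ δ) (hΔ : Δ.mesh ≤ δ)
    (hmod₁ : ∀ t ∈ Icc 0 T, ∀ s ∈ Icc 0 T, |t - s| ≤ δ → ∀ x u v,
      ‖L₁.drift t x u v - L₁.drift s x u v‖ ^ 2 ≤ ε)
    (hmod₂ : ∀ t ∈ Icc 0 T, ∀ s ∈ Icc 0 T, |t - s| ≤ δ → ∀ x u v,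
      ‖L₂.drift t x u v - L₂.drift s x u v‖ ^ 2 ≤ ε) :
    ∫ ω, g ((R.X ω).1 ⟨T, right_mem_Icc.2 ht₀.2⟩) ∂(R.P)
      ≤ c t₀ x₀ + C * √(T * Real.exp (betaConst T L₁ K₁ K₂ * T)
        * (driftMismatch T L₁ L₂ + M₀₁ + M₀₂
          + stepError (T - t₀) M₀₁ M₁₁ K₁ M₀₂ M₁₂ K₂ ε δ)) := by
  have := R.isProb
  have hdist := R.integral_norm_sub_sq_last_le hL₁ hL₂ hI hD₁ hD₂ ht₀ hε hδ hΔ hmod₁ hmod₂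
  obtain ⟨hi, hY⟩ := R.integral_payoff_model_le hL₁ hL₂ hD₁ hD₂ ht₀ hg hc
  have hT : Δ.pt (Fin.last Δ.r) = ⟨T, right_mem_Icc.2 ht₀.2⟩ := Subtype.ext Δ.last
  rw [hT] at hdist
  have hX := (R.isQuadraticSolution hL₁ hD₁ ht₀).memLp ⟨T, right_mem_Icc.2 ht₀.2⟩
  have hXY := hX.sub (R.memLp_model hL₁ hL₂ hD₁ hD₂ ht₀ ⟨T, right_mem_Icc.2 ht₀.2⟩)
  have hn : Integrable (fun ω => (C : ℝ) * ‖(R.X ω).1 ⟨T, right_mem_Icc.2 ht₀.2⟩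
      - M.Y (R.X ω) ⟨T, right_mem_Icc.2 ht₀.2⟩ ω.2.1‖) R.P :=
    (hXY.integrable one_le_two).norm.const_mul _
  calc ∫ ω, g ((R.X ω).1 ⟨T, right_mem_Icc.2 ht₀.2⟩) ∂(R.P)
      ≤ ∫ ω, (g (M.Y (R.X ω) ⟨T, right_mem_Icc.2 ht₀.2⟩ ω.2.1)
          + C * ‖(R.X ω).1 ⟨T, right_mem_Icc.2 ht₀.2⟩
            - M.Y (R.X ω) ⟨T, right_mem_Icc.2 ht₀.2⟩ ω.2.1‖) ∂(R.P) := by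
        refine integral_mono (hg.integrable_comp hX) (hi.add hn) fun ω => ?_
        have h := hg.dist_le_mul ((R.X ω).1 ⟨T, right_mem_Icc.2 ht₀.2⟩)
          (M.Y (R.X ω) ⟨T, right_mem_Icc.2 ht₀.2⟩ ω.2.1)
        rw [Real.dist_eq, dist_eq_norm] at h
        have := (abs_le.1 h).2
        simp only
        linarith
    _ = ∫ ω, g (M.Y (R.X ω) ⟨T, right_mem_Icc.2 ht₀.2⟩ ω.2.1) ∂(R.P)
          + C * ∫ ω, ‖(R.X ω).1 ⟨T, right_mem_Icc.2 ht₀.2⟩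
            - M.Y (R.X ω) ⟨T, right_mem_Icc.2 ht₀.2⟩ ω.2.1‖ ∂(R.P) := by
        rw [integral_add hi hn, integral_const_mul]
    _ ≤ _ := by
        gcongr
        exact (integral_norm_le_sqrt hXY).trans (Real.sqrt_le_sqrt hdist)

end Outcome

theorem mainTheorem1 {d : ℕ} {U : Type uU} {V : Type uV}
    [MetricSpace U] [CompactSpace U] [Nonempty U] [MeasurableSpace U] [BorelSpace U]
    [MetricSpace V] [CompactSpace V] [Nonempty V] [MeasurableSpace V] [BorelSpace V]
    (T : ℝ) (L₁ L₂ : Generator d U V) (D₁ D₂ : Set (State d → ℝ))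
    (hD₁ : IsTestClass D₁) (hD₂ : IsTestClass D₂)
    (M₀₁ M₁₁ K₁ M₀₂ M₁₂ K₂ : ℝ) (R : ℝ≥0) (g : State d → ℝ)
    (hL₁ : L₁.IsAdmissible T M₀₁ M₁₁ K₁) (hL₂ : L₂.IsAdmissible T M₀₂ M₁₂ K₂)
    (hg : LipschitzWith R g) (hI : L₁.Isaacs T ∨ L₂.Isaacs T)
    (c : ℝ → State d → ℝ) (hc : IsUStable.{uU, uV, w₃} D₂ L₂ T g c)
    (t₀ : ℝ) (x₀ : State d) (ht₀ : t₀ ∈ Set.Icc 0 T) :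
    ∃ ℓ : EReal,
      Filter.Tendsto
        (fun δ : ℝ => ⨆ (Δ : TimePartition t₀ T) (_ : Δ.mesh ≤ δ)
          (M : Model.{uU, uV, w₁} D₂ L₁ L₂ c Δ) (S : ExtremalSelector L₁ L₂ Δ)
          (𝔳 : Strategy.{w₂} d t₀ T V),
          upperOutcome.{uU, uV, w, w₁, w₂} D₁ L₁ g ht₀.2 x₀ (extremalShift M S) 𝔳)
        (𝓝[>] 0) (𝓝 ℓ) ∧
      ℓ ≤ ((c t₀ x₀ + R * √(T * Real.exp (betaConst T L₁ K₁ K₂ * T))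
            * √(driftMismatch T L₁ L₂ + M₀₁ + M₀₂) : ℝ) : EReal) := by
  -- The supremum increases with `δ`, so that it has a limit at `0`, its infimum over `δ > 0`.
  have hmono : Monotone (fun δ : ℝ => ⨆ (Δ : TimePartition t₀ T) (_ : Δ.mesh ≤ δ)
      (M : Model.{uU, uV, w₁} D₂ L₁ L₂ c Δ) (S : ExtremalSelector L₁ L₂ Δ)
      (𝔳 : Strategy.{w₂} d t₀ T V),
      upperOutcome.{uU, uV, w, w₁, w₂} D₁ L₁ g ht₀.2 x₀ (extremalShift M S) 𝔳) :=
    fun δ δ' h => iSup_mono fun Δ => iSup_mono' fun hΔ => ⟨hΔ.trans h, le_rfl⟩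
  refine ⟨_, hmono.tendsto_nhdsGT 0, ?_⟩
  have hA : 0 ≤ T * Real.exp (betaConst T L₁ K₁ K₂ * T) :=
    mul_nonneg (ht₀.1.trans ht₀.2) (Real.exp_nonneg _)
  rw [mul_assoc, ← Real.sqrt_mul hA]
  have hlim : Tendsto (fun η : ℝ => ((c t₀ x₀ + R * √(T * Real.exp (betaConst T L₁ K₁ K₂ * T)
      * (driftMismatch T L₁ L₂ + M₀₁ + M₀₂ + η)) : ℝ) : EReal)) (𝓝[>] 0)
      (𝓝 ((c t₀ x₀ + R * √(T * Real.exp (betaConst T L₁ K₁ K₂ * T)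
      * (driftMismatch T L₁ L₂ + M₀₁ + M₀₂)) : ℝ) : EReal)) := by
    have hcont : Continuous fun η : ℝ => ((c t₀ x₀ + R * √(T * Real.exp (betaConst T L₁ K₁ K₂ * T)
      * (driftMismatch T L₁ L₂ + M₀₁ + M₀₂ + η)) : ℝ) : EReal) :=
      continuous_coe_real_ereal.comp (by fun_prop)
    simpa using (hcont.tendsto 0).mono_left nhdsWithin_le_nhds
  refine ge_of_tendsto hlim ?_
  filter_upwards [self_mem_nhdsWithin] with η hη
  obtain ⟨ε, hε, δ₀, hδ₀, herr⟩ := exists_stepError_le (T - t₀) M₀₁ M₁₁ K₁ M₀₂ M₁₂ K₂ hη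
  obtain ⟨δ₁, hδ₁, hmod₁⟩ := hL₁.exists_drift_modulus hε
  obtain ⟨δ₂, hδ₂, hmod₂⟩ := hL₂.exists_drift_modulus hε
  obtain ⟨δ, hδ, hlt⟩ := exists_between (lt_min hδ₀ (lt_min hδ₁ hδ₂))
  obtain ⟨hlt₀, hlt'⟩ := lt_min_iff.1 hlt
  obtain ⟨hlt₁, hlt₂⟩ := lt_min_iff.1 hlt'
  refine (sInf_le (mem_image_of_mem _ (mem_Ioi.2 hδ))).trans ?_
  refine iSup₂_le fun Δ hΔ => iSup_le fun M => iSup₂_le fun S 𝔳 => iSup_le fun ρ =>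
    EReal.coe_le_coe_iff.2 ?_
  refine (ρ.integral_payoff_le hL₁ hL₂ hI hD₁ hD₂ ht₀ hg hc.1 hε hδ.le hΔ
    (fun t ht s hs hts => hmod₁ t ht s hs (hts.trans_lt hlt₁))
    (fun t ht s hs hts => hmod₂ t ht s hs (hts.trans_lt hlt₂))).trans ?_
  have := herr δ hδ.le hlt₀.le
  gcongr
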